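/- Let $\sigma>0$, let $g:\mathbb R^n\to\mathbb R$, and let $p$ be a probability density on $\mathbb R^n$. Write $G_\sigma$ for the density of $\mathcal N(0,\sigma^2 I)$, and put $p_\sigma=p*G_\sigma$, $h_\sigma(x)=-\mathbb E_{z\sim\mathcal N(0,I)}[\log p_\sigma(x+\sigma z)]$ and $f_\sigma=g+h_\sigma$. For a measurable denoiser $\mathsf D:\mathbb R^n\to\mathbb R^n$ put $U_\sigma(x,z)=\sigma^{-2}\bigl(x-\mathsf D(x+\sigma z)\bigr)$. Below, $z\sim\mathcal N(0,I)$. Assume: 1. $g$ and $h_\sigma$ are twice differentiable with Lipschitz gradients (constants $L_g,L_h$) and Lipschitz Hessians (constants $\rho_g,\rho_h$); $\nabla f_\sigma$ is bounded; and $f_\sigma$ is bounded below. Put $\rho=\rho_g+\rho_h$. 2. (Unbiased denoiser, as for the MMSE denoiser.) $\mathbb E_z[U_\sigma(x,z)]=\nabla h_\sigma(x)$ for all $x$. 3. There are constants $V_{\max}$ and $c>0$ such that, for every $x$, $U_\sigma(x,z)$ is square integrable with $\mathbb E_z\|U_\sigma(x,z)-\mathbb E_z U_\sigma(x,z)\|^2\le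 V_{\max}$, and $\mathrm{Var}_z\bigl(v_x^\top\mathsf D(x+\sigma z)\bigr)\ge c$, where $v_x$ is a unit eigenvector of $\nabla^2 f_\sigma(x)$ for its smallest eigenvalue. Let $x_0\in\mathbb R^n$, let $z_0,z_1,\dots$ be i.i.d. $\mathcal N(0,I)$, and consider the iteration $$x_{k+1}=x_k-\gamma_k\bigl(\nabla g(x_k)+U_\sigma(x_k,z_k)\bigr).$$ Then for every $\delta\in(0,1)$ and every $\varepsilon>0$ there are a deterministic stepsize schedule $(\gamma_k)_{k\ge0}$ with all $\gamma_k>0$ and a number of iterations $K$ such that, with probability at least $1-\delta$, every iterate $x_k$ with $k\ge K$ is an $(\varepsilon,\sqrt\rho\,\varepsilon)$-second-order stationary point of $f_\sigma$, that is, $\|\nabla f_\sigma(x_k)\|\le\varepsilon$ and $\nabla^2 f_\sigma(x_k)\succcurlyeq-\sqrt\rho\,\varepsilon I$, and is not a strict saddle point of $f_\sigma$, that is, not a critical point at which $\nabla^2 f_\sigma$ has a strictly negative eigenvalue. -/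

import Mathlib

open MeasureTheory ProbabilityTheory
open scoped NNReal

namespace SGPnP

noncomputable section

/-- The signal space `ℝⁿ` with its Euclidean norm. -/
abbrev Space (n : ℕ) : Type := EuclideanSpace ℝ (Fin n)

/-- The Hessian of `f` at `x`, as the derivative of the gradient field. -/
def hessian {n : ℕ} (f : Space n → ℝ) (x : Space n) : Space n →L[ℝ] Space n :=
  fderiv ℝ (gradient f) x

/-- `f` is twice differentiable, with `L`-Lipschitz gradient and `ρ`-Lipschitz Hessian
(in operator norm). -/
structure HasLipschitzDerivatives {n : ℕ} (f : Space n → ℝ) (L ρ : ℝ≥0) : Prop where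
  differentiable : Differentiable ℝ f
  differentiable_gradient : Differentiable ℝ (gradient f)
  lipschitz_gradient : LipschitzWith L (gradient f)
  lipschitz_hessian : LipschitzWith ρ (hessian f)

/-- `p` is a probability density with respect to Lebesgue measure on `ℝⁿ`. -/
structure IsProbDensity {n : ℕ} (p : Space n → ℝ) : Prop where
  measurable : Measurable p
  nonneg : ∀ x, 0 ≤ p x
  integrable : Integrable p
  integral_eq_one : ∫ x, p x = 1

/-- The density of `N(0, σ² I)` on `ℝⁿ`. -/
def gaussianKernel {n : ℕ} (σ : ℝ) (x : Space n) : ℝ :=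
  (2 * Real.pi * σ ^ 2) ^ (-(n : ℝ) / 2) * Real.exp (-‖x‖ ^ 2 / (2 * σ ^ 2))

/-- The Gaussian-smoothed prior `p_σ = p * G_σ`. -/
def smoothedPrior {n : ℕ} (σ : ℝ) (p : Space n → ℝ) (x : Space n) : ℝ :=
  ∫ u, p u * gaussianKernel σ (x - u)

/-- The stochastic regularizer `h_σ(x) = -𝔼 log p_σ(x + σ z)`, `z ∼ N(0, I)`. -/
def smoothedRegularizer {n : ℕ} (σ : ℝ) (p : Space n → ℝ) (x : Space n) : ℝ :=
  -∫ z, Real.log (smoothedPrior σ p (x + σ • z)) ∂(stdGaussian (Space n))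

/-- The smoothed objective `f_σ = g + h_σ`. -/
def smoothedObjective {n : ℕ} (σ : ℝ) (g p : Space n → ℝ) (x : Space n) : ℝ :=
  g x + smoothedRegularizer σ p x

/-- The stochastic vector field `U_σ(x, z) = σ⁻² (x - D(x + σ z))`. -/
def stochasticField {n : ℕ} (σ : ℝ) (D : Space n → Space n) (x z : Space n) : Space n :=
  (σ ^ 2)⁻¹ • (x - D (x + σ • z))

/-- The iteration `x_{k+1} = x_k - γ_k (∇g(x_k) + U_σ(x_k, z_k))` started at `x₀` and driven by
the noise sequence `z`. -/
def iterate {n : ℕ} (σ : ℝ) (g : Space n → ℝ) (D : Space n → Space n) (γ : ℕ → ℝ)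
    (x₀ : Space n) (z : ℕ → Space n) : ℕ → Space n
  | 0 => x₀
  | k + 1 =>
    iterate σ g D γ x₀ z k - γ k • (gradient g (iterate σ g D γ x₀ z k)
      + stochasticField σ D (iterate σ g D γ x₀ z k) (z k))

/-- `v` is a unit eigenvector of `T` for the smallest eigenvalue of `T`. -/
def IsUnitMinEigenvector {n : ℕ} (T : Space n →L[ℝ] Space n) (v : Space n) : Prop :=
  ‖v‖ = 1 ∧ ∃ μ : ℝ, Module.End.HasEigenvector (T : Module.End ℝ (Space n)) μ v ∧
    ∀ ν : ℝ, Module.End.HasEigenvalue (T : Module.End ℝ (Space n)) ν → μ ≤ ν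

/-- `x` is a strict saddle of `f`: a critical point at which the Hessian has a strictly negative
eigenvalue. -/
def IsStrictSaddle {n : ℕ} (f : Space n → ℝ) (x : Space n) : Prop :=
  gradient f x = 0 ∧
    ∃ μ : ℝ, μ < 0 ∧ Module.End.HasEigenvalue (hessian f x : Module.End ℝ (Space n)) μ

/-- `x` is an `(εg, εh)`-second-order stationary point of `f`: `‖∇f(x)‖ ≤ εg` and
`∇²f(x) ≽ -εh I`. -/
def IsSecondOrderStationary {n : ℕ} (f : Space n → ℝ) (εg εh : ℝ) (x : Space n) : Prop :=
  ‖gradient f x‖ ≤ εg ∧ ∀ u : Space n, -εh * ‖u‖ ^ 2 ≤ inner ℝ (hessian f x u) u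

end

end SGPnP

/-!
An unbiased denoiser is, up to null sets, the MMSE denoiser `mmse σ p`. Indeed, by Tweedie's
formula (`gradient_smoothedRegularizer`) both have the same average over `N(x, σ² I)` for every
`x`, and these averages determine a function (`ae_eq_zero_of_forall_integral_add_smul_eq_zero`).
The MMSE denoiser is the gradient of a log-Laplace transform, up to scaling, hence strictly
monotone with an invertible derivative. This yields everything that is needed of the noise
`ξ(x, z) = U_σ(x, z) - ∇h_σ(x)`:
* `‖ξ(x, z)‖ ≤ a + b ‖z‖` uniformly in `x` (`exists_norm_denoiser_sub_le`), so that all moments are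
  uniformly bounded, although only the variance is assumed to be;
* the noise along the minimal eigenvector at `x` keeps a second moment bounded below near `x`
  (`exists_le_integral_inner_fieldNoise_sq`), by the Cameron–Martin formula;
* a step of the iteration has an absolutely continuous law (`ae_step_notMem`).

The iteration is thus stochastic gradient descent on the smoothed objective `f`. With a small
constant step `γ` it improves `f` at points with large gradient, and it also escapes from
approximate saddles, by the improve-or-localise argument: if the expected objective does not drop
by order `γ` over a time horizon of `C / γ` steps, then the iterate stays within expected squared
distance `O(γ)`, polynomially in `C`, whereas its coordinate along the unstable eigenvector, fed by
the noise, has a second moment growing exponentially in `C` (`exists_forall_eventually_escape`).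
Since `f` is bounded below, at some deterministic time `k` the iterate is therefore second-order
stationary with a margin, with probability at least `1 - δ / 2` (`exists_measure_not_stationary_le`).

From time `k` on the steps decay geometrically and are so small that the whole remaining path stays
in a small ball around the `k`-th iterate with probability at least `1 - δ / 2`
(`measure_le_tsum_enorm_iterate_sub_le`), where second-order stationarity persists. Finally, strict
saddles are critical points with nonzero Hessian, which form a null set
(`volume_critical_hessian_ne_zero`), and are hence almost surely never hit.
-/

/-! ### The standard Gaussian measure -/

namespace SGPnP

variable {n : ℕ}

lemma gaussianKernel_nonneg (σ : ℝ) (x : Space n) : 0 ≤ gaussianKernel σ x := by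
  unfold gaussianKernel; positivity

lemma gaussianKernel_pos {σ : ℝ} (hσ : 0 < σ) (x : Space n) : 0 < gaussianKernel σ x := by
  unfold gaussianKernel; positivity

lemma continuous_gaussianKernel (σ : ℝ) : Continuous (gaussianKernel (n := n) σ) := by
  unfold gaussianKernel; fun_prop

lemma gaussianKernel_one (z : Space n) :
    gaussianKernel 1 z = (2 * Real.pi) ^ (-(n : ℝ) / 2) * Real.exp (-(1 / 2) * ‖z‖ ^ 2) := by
  unfold gaussianKernel
  congr 2 <;> ring

lemma integrable_gaussianKernel_one : Integrable (gaussianKernel (n := n) 1) := by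
  have h := (GaussianFourier.integrable_cexp_neg_mul_sq_norm_add (V := Space n)
    (b := (1 / 2 : ℂ)) (by norm_num) 0 0).norm
  simp only [Complex.norm_exp] at h
  have h2 := h.const_mul ((2 * Real.pi) ^ (-(n : ℝ) / 2))
  refine h2.congr (Filter.Eventually.of_forall fun z => ?_)
  simp only [gaussianKernel_one]
  congr 2
  have : (-(1 / 2 : ℂ) * (‖z‖ : ℂ) ^ 2 + 0 * ((inner ℝ (0 : Space n) z : ℝ) : ℂ))
      = ((-(1 / 2) * ‖z‖ ^ 2 : ℝ) : ℂ) := by push_cast; ring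
  rw [this, Complex.ofReal_re]

/-- The standard Gaussian measure has the density `G₁`. -/
theorem stdGaussian_eq_withDensity :
    stdGaussian (Space n)
      = volume.withDensity (fun z => ENNReal.ofReal (gaussianKernel 1 z)) := by
  have hfin : IsFiniteMeasure
      (volume.withDensity (fun z : Space n => ENNReal.ofReal (gaussianKernel 1 z))) :=
    isFiniteMeasure_withDensity_ofReal integrable_gaussianKernel_one.2
  apply Measure.ext_of_charFun
  ext t
  rw [charFun_stdGaussian, charFun_apply, integral_withDensity_eq_integral_toReal_smul
    (by exact (continuous_gaussianKernel 1).measurable.ennreal_ofReal)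
    (Filter.Eventually.of_forall fun _ => ENNReal.ofReal_lt_top)]
  have h := GaussianFourier.integral_cexp_neg_mul_sq_norm_add (V := Space n)
    (b := (1 / 2 : ℂ)) (by norm_num) Complex.I t
  have h2 : ∀ z : Space n, (ENNReal.ofReal (gaussianKernel 1 z)).toReal •
      Complex.exp (((inner ℝ z t : ℝ) : ℂ) * Complex.I)
      = (((2 * Real.pi) ^ (-(n : ℝ) / 2) : ℝ) : ℂ) *
        Complex.exp (-(1 / 2 : ℂ) * ‖z‖ ^ 2 + Complex.I * ((inner ℝ t z : ℝ) : ℂ)) := by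
    intro z
    rw [ENNReal.toReal_ofReal (gaussianKernel_nonneg _ _), gaussianKernel_one, real_inner_comm,
      Complex.exp_add, Complex.real_smul]
    push_cast
    rw [mul_comm Complex.I]
    ring
  simp_rw [h2]
  rw [integral_const_mul, h]
  simp only [finrank_euclideanSpace, Fintype.card_fin, Complex.I_sq]
  rw [← mul_assoc]
  have h3 : (((2 * Real.pi) ^ (-(n : ℝ) / 2) : ℝ) : ℂ) * ((Real.pi : ℂ) / (1 / 2)) ^ ((n : ℂ) / 2)
      = 1 := by
    have h4 : ((Real.pi : ℂ) / (1 / 2)) ^ ((n : ℂ) / 2)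
        = (((2 * Real.pi) ^ ((n : ℝ) / 2) : ℝ) : ℂ) := by
      rw [Complex.ofReal_cpow (by positivity)]
      push_cast
      congr 1
      ring
    rw [h4, ← Complex.ofReal_mul, ← Real.rpow_add (by positivity)]
    simp [neg_div]
  rw [h3, one_mul]
  congr 1
  ring

lemma integral_stdGaussian {F : Type*} [NormedAddCommGroup F] [NormedSpace ℝ F]
    (φ : Space n → F) :
    ∫ z, φ z ∂(stdGaussian (Space n)) = ∫ z, gaussianKernel 1 z • φ z := by
  rw [stdGaussian_eq_withDensity, integral_withDensity_eq_integral_toReal_smul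
    (by exact (continuous_gaussianKernel 1).measurable.ennreal_ofReal)
    (Filter.Eventually.of_forall fun _ => ENNReal.ofReal_lt_top)]
  simp_rw [ENNReal.toReal_ofReal (gaussianKernel_nonneg _ _)]

lemma integrable_stdGaussian_iff {F : Type*} [NormedAddCommGroup F] [NormedSpace ℝ F]
    (φ : Space n → F) :
    Integrable φ (stdGaussian (Space n)) ↔ Integrable (fun z => gaussianKernel 1 z • φ z) := by
  rw [stdGaussian_eq_withDensity, integrable_withDensity_iff_integrable_smul'
    (by exact (continuous_gaussianKernel 1).measurable.ennreal_ofReal)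
    (Filter.Eventually.of_forall fun _ => ENNReal.ofReal_lt_top)]
  simp_rw [ENNReal.toReal_ofReal (gaussianKernel_nonneg _ _)]

lemma stdGaussian_absolutelyContinuous : stdGaussian (Space n) ≪ volume := by
  rw [stdGaussian_eq_withDensity]
  exact withDensity_absolutelyContinuous _ _

lemma absolutelyContinuous_stdGaussian : (volume : Measure (Space n)) ≪ stdGaussian (Space n) := by
  rw [stdGaussian_eq_withDensity]
  refine withDensity_absolutelyContinuous'
    (continuous_gaussianKernel 1).measurable.ennreal_ofReal.aemeasurable ?_
  exact Filter.Eventually.of_forall fun z =>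
    (ENNReal.ofReal_pos.2 (gaussianKernel_pos one_pos z)).ne'

lemma quasiMeasurePreserving_add_smul {σ : ℝ} (hσ : σ ≠ 0) (x : Space n) :
    Measure.QuasiMeasurePreserving (fun z : Space n => x + σ • z) := by
  have h1 : Measure.QuasiMeasurePreserving (fun z : Space n => σ • z) :=
    ⟨by fun_prop, by
      rw [Measure.map_addHaar_smul _ hσ]
      exact Measure.AbsolutelyContinuous.rfl.smul_left _⟩
  exact (measurePreserving_add_left volume x).quasiMeasurePreserving.comp h1

/-- A property that holds Lebesgue-almost everywhere holds almost surely at `x + σ z`. -/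
lemma ae_stdGaussian_add_smul {σ : ℝ} (hσ : σ ≠ 0) (x : Space n) {q : Space n → Prop}
    (h : ∀ᵐ y, q y) : ∀ᵐ z ∂(stdGaussian (Space n)), q (x + σ • z) :=
  stdGaussian_absolutelyContinuous.ae_le ((quasiMeasurePreserving_add_smul hσ x).ae h)

lemma ae_of_ae_stdGaussian_smul {σ : ℝ} (hσ : σ ≠ 0) {q : Space n → Prop}
    (h : ∀ᵐ z ∂(stdGaussian (Space n)), q (σ • z)) : ∀ᵐ y, q y := by
  have h1 : ∀ᵐ z : Space n, q (σ • z) := absolutelyContinuous_stdGaussian.ae_le h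
  have h2 := (quasiMeasurePreserving_add_smul (inv_ne_zero hσ) (0 : Space n)).ae h1
  filter_upwards [h2] with y hy
  simpa [smul_smul, hσ] using hy

lemma gaussianKernel_one_sub (a z : Space n) :
    gaussianKernel 1 (z - a) = gaussianKernel 1 z * Real.exp (inner ℝ a z - ‖a‖ ^ 2 / 2) := by
  simp only [gaussianKernel_one]
  rw [mul_assoc, ← Real.exp_add, norm_sub_sq_real, real_inner_comm]
  congr 2
  ring

/-- The Cameron–Martin formula for the standard Gaussian measure. -/
lemma integral_stdGaussian_add {F : Type*} [NormedAddCommGroup F] [NormedSpace ℝ F]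
    (φ : Space n → F) (a : Space n) :
    ∫ z, φ (z + a) ∂(stdGaussian (Space n))
      = ∫ z, Real.exp (inner ℝ a z - ‖a‖ ^ 2 / 2) • φ z ∂(stdGaussian (Space n)) := by
  rw [integral_stdGaussian, integral_stdGaussian,
    ← integral_sub_right_eq_self (fun z => gaussianKernel 1 z • φ (z + a)) a]
  simp_rw [gaussianKernel_one_sub, sub_add_cancel, mul_smul]

lemma integrable_stdGaussian_add_iff {F : Type*} [NormedAddCommGroup F] [NormedSpace ℝ F]
    (φ : Space n → F) (a : Space n) :
    Integrable (fun z => φ (z + a)) (stdGaussian (Space n))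
      ↔ Integrable (fun z => Real.exp (inner ℝ a z - ‖a‖ ^ 2 / 2) • φ z)
          (stdGaussian (Space n)) := by
  rw [integrable_stdGaussian_iff, integrable_stdGaussian_iff,
    ← (measurePreserving_sub_right volume a).integrable_comp_emb
      (MeasurableEquiv.subRight a).measurableEmbedding]
  simp_rw [Function.comp_def, gaussianKernel_one_sub, sub_add_cancel, mul_smul]

lemma integrable_norm_pow_stdGaussian (k : ℕ) :
    Integrable (fun z : Space n => ‖z‖ ^ k) (stdGaussian (Space n)) := by
  rcases Nat.eq_zero_or_pos k with rfl | hk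
  · simp
  · have := (IsGaussian.memLp_id (stdGaussian (Space n)) k (by simp)).integrable_norm_pow hk.ne'
    simpa using this

lemma integrable_const_add_norm_pow_stdGaussian (a b : ℝ) (k : ℕ) :
    Integrable (fun z : Space n => (a + b * ‖z‖) ^ k) (stdGaussian (Space n)) := by
  simp_rw [add_pow, mul_pow]
  refine integrable_finsetSum _ fun i _ => ?_
  exact (((integrable_norm_pow_stdGaussian _).const_mul _).const_mul _).mul_const _

/-- If the Gaussian average of `φ` around every point vanishes, then so does `φ`: the Gaussian
averages are the values of a two-sided Laplace transform, which determines a measure. -/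
theorem ae_eq_zero_of_forall_integral_add_smul_eq_zero {σ : ℝ} (hσ : 0 < σ) {φ : Space n → ℝ}
    (hφ : Measurable φ)
    (hint : ∀ x, Integrable (fun z => φ (x + σ • z)) (stdGaussian (Space n)))
    (h0 : ∀ x, ∫ z, φ (x + σ • z) ∂(stdGaussian (Space n)) = 0) : ∀ᵐ y, φ y = 0 := by
  set γ := stdGaussian (Space n)
  set ψ : Space n → ℝ := fun z => φ (σ • z) with hψdef
  have hψ : Measurable ψ := hφ.comp (measurable_const_smul σ)
  have hshift : ∀ a z : Space n, φ (σ • a + σ • z) = ψ (z + a) := fun a z => by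
    simp only [hψdef]; congr 1; rw [← smul_add, add_comm]
  have hexpint : ∀ a : Space n, Integrable (fun z => Real.exp (inner ℝ a z) * ψ z) γ := by
    intro a
    have h1 := hint (σ • a)
    simp_rw [hshift] at h1
    have h2 := ((integrable_stdGaussian_add_iff ψ a).1 h1).const_mul (Real.exp (‖a‖ ^ 2 / 2))
    refine h2.congr (Filter.Eventually.of_forall fun z => ?_)
    simp only [smul_eq_mul, ← mul_assoc, ← Real.exp_add]
    congr 2; ring
  have hexp0 : ∀ a : Space n, ∫ z, Real.exp (inner ℝ a z) * ψ z ∂γ = 0 := by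
    intro a
    have h1 := h0 (σ • a)
    simp_rw [hshift] at h1
    rw [integral_stdGaussian_add] at h1
    have h2 : ∀ z : Space n, Real.exp (inner ℝ a z) * ψ z
        = Real.exp (‖a‖ ^ 2 / 2) * (Real.exp (inner ℝ a z - ‖a‖ ^ 2 / 2) • ψ z) := by
      intro z
      simp only [smul_eq_mul, ← mul_assoc, ← Real.exp_add]
      congr 2; ring
    simp_rw [h2]
    rw [integral_const_mul, h1, mul_zero]
  have hψint : Integrable ψ γ := by simpa using hexpint 0
  -- the positive and the negative part of `ψ` as densities of two finite measures
  set μ₁ := γ.withDensity fun z => ENNReal.ofReal (ψ z)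
  set μ₂ := γ.withDensity fun z => ENNReal.ofReal (-ψ z)
  have hf1 : IsFiniteMeasure μ₁ := isFiniteMeasure_withDensity_ofReal hψint.2
  have hf2 : IsFiniteMeasure μ₂ := isFiniteMeasure_withDensity_ofReal hψint.neg.2
  have hpart : ∀ χ : Space n → ℝ, Measurable χ →
      (∀ a : Space n, Integrable (fun z => Real.exp (inner ℝ a z) * χ z) γ) → ∀ a : Space n,
      Integrable (fun z => Real.exp (inner ℝ a z)) (γ.withDensity fun z => ENNReal.ofReal (χ z)) ∧
      Integrable (fun z => Real.exp (inner ℝ a z) * max (χ z) 0) γ ∧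
      ∫ z, Real.exp (inner ℝ a z) ∂(γ.withDensity fun z => ENNReal.ofReal (χ z))
        = ∫ z, Real.exp (inner ℝ a z) * max (χ z) 0 ∂γ := by
    intro χ hχ hi a
    have i1 : Integrable (fun z => Real.exp (inner ℝ a z) * max (χ z) 0) γ := by
      refine (hi a).mono (by fun_prop) (Filter.Eventually.of_forall fun z => ?_)
      rw [norm_mul, norm_mul]
      gcongr
      simpa [abs_of_nonneg] using le_abs_self (χ z)
    refine ⟨?_, i1, ?_⟩
    · rw [integrable_withDensity_iff_integrable_smul' hχ.ennreal_ofReal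
        (Filter.Eventually.of_forall fun _ => ENNReal.ofReal_lt_top)]
      simpa [ENNReal.toReal_ofReal', mul_comm] using i1
    · rw [integral_withDensity_eq_integral_toReal_smul hχ.ennreal_ofReal
        (Filter.Eventually.of_forall fun _ => ENNReal.ofReal_lt_top)]
      simp_rw [ENNReal.toReal_ofReal', smul_eq_mul, mul_comm]
  have hψneg : Measurable fun z => -ψ z := hψ.neg
  have hp1 := hpart ψ hψ hexpint
  have hp2 := hpart (fun z => -ψ z) hψneg fun a => by simpa using (hexpint a).neg
  have hI : ∀ (a : Space n), ∫ z, Real.exp (inner ℝ a z) ∂μ₁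
      = ∫ z, Real.exp (inner ℝ a z) ∂μ₂ := by
    intro a
    rw [(hp1 a).2.2, (hp2 a).2.2, ← sub_eq_zero, ← integral_sub (hp1 a).2.1 (hp2 a).2.1]
    refine (integral_congr_ae (Filter.Eventually.of_forall fun z => ?_)).trans (hexp0 a)
    simp only [← mul_sub]
    congr 1
    rcases le_total 0 (ψ z) with h | h
    · rw [max_eq_left h, max_eq_right (by linarith)]; ring
    · rw [max_eq_right h, max_eq_left (by linarith)]; ring
  have hzero : μ₁ = 0 ↔ μ₂ = 0 := by
    have h := hI 0
    simp only [inner_zero_left, Real.exp_zero, integral_const, smul_eq_mul, mul_one] at h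
    rw [← Measure.measure_univ_eq_zero, ← Measure.measure_univ_eq_zero,
      ← measureReal_eq_zero_iff, ← measureReal_eq_zero_iff, h]
  have hμ : μ₁ = μ₂ := by
    apply Measure.ext_of_charFun
    ext t
    have hmgf : mgf (fun z : Space n => inner ℝ z t) μ₁
        = mgf (fun z : Space n => inner ℝ z t) μ₂ := by
      ext s
      simp only [mgf]
      have := hI (s • t)
      simpa only [real_inner_smul_left, real_inner_comm t] using this
    have hset : integrableExpSet (fun z : Space n => inner ℝ z t) μ₁ = Set.univ := by
      ext s
      simp only [integrableExpSet, Set.mem_ofPred_eq, Set.mem_univ, iff_true]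
      have := (hp1 (s • t)).1
      simpa only [real_inner_smul_left, real_inner_comm t] using this
    have h := eqOn_complexMGF_of_mgf' hmgf hzero (x := Complex.I) (by simp [hset])
    simpa [complexMGF, charFun_apply, mul_comm] using h
  have hae := (withDensity_eq_iff (μ := γ) hψ.ennreal_ofReal.aemeasurable
    hψneg.ennreal_ofReal.aemeasurable
    (by
      have := measure_lt_top μ₁ Set.univ
      rw [withDensity_apply _ MeasurableSet.univ, setLIntegral_univ] at this
      exact this.ne)).1 hμ
  refine ae_of_ae_stdGaussian_smul hσ.ne' ?_
  filter_upwards [hae] with z hz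
  change ψ z = 0
  rcases le_total 0 (ψ z) with h | h
  · have : ENNReal.ofReal (-ψ z) = 0 := ENNReal.ofReal_of_nonpos (by linarith)
    have hz' : ENNReal.ofReal (ψ z) = ENNReal.ofReal (-ψ z) := hz
    rw [this, ENNReal.ofReal_eq_zero] at hz'
    linarith
  · have : ENNReal.ofReal (ψ z) = 0 := ENNReal.ofReal_of_nonpos h
    have hz' : ENNReal.ofReal (ψ z) = ENNReal.ofReal (-ψ z) := hz
    rw [this, eq_comm, ENNReal.ofReal_eq_zero] at hz'
    linarith

end SGPnP

/-! ### The log-Laplace transform and tilted means -/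

namespace SGPnP

variable {n : ℕ}

/-- All exponential moments of the norm are finite. -/
def HasExpMoments (μ : Measure (Space n)) : Prop :=
  ∀ t : ℝ, Integrable (fun u => Real.exp (t * ‖u‖)) μ

/-- The Laplace transform `y ↦ ∫ e^⟨u, y⟩ dμ(u)` of a measure. -/
noncomputable def laplace (μ : Measure (Space n)) (y : Space n) : ℝ :=
  ∫ u, Real.exp (inner ℝ u y) ∂μ

/-- The mean of the exponentially tilted measure `e^⟨u, y⟩ dμ(u)`, normalised to total mass one. -/
noncomputable def tiltedMean (μ : Measure (Space n)) (y : Space n) : Space n :=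
  (laplace μ y)⁻¹ • ∫ u, Real.exp (inner ℝ u y) • u ∂μ

variable {μ : Measure (Space n)}

lemma HasExpMoments.integrable_smul {F : Type*} [NormedAddCommGroup F] [NormedSpace ℝ F]
    (hμ : HasExpMoments μ) {Φ : Space n → F} (hΦ : Continuous Φ) {t : ℝ}
    (hb : ∀ u, ‖Φ u‖ ≤ Real.exp (t * ‖u‖)) (y : Space n) :
    Integrable (fun u => Real.exp (inner ℝ u y) • Φ u) μ := by
  refine (hμ (‖y‖ + t)).mono' (by
    have : Continuous fun u => Real.exp (inner ℝ u y) • Φ u := by fun_prop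
    exact this.aestronglyMeasurable) (Filter.Eventually.of_forall fun u => ?_)
  rw [norm_smul, Real.norm_eq_abs, Real.abs_exp, add_mul, Real.exp_add]
  gcongr
  · exact (real_inner_le_norm _ _).trans (by rw [mul_comm])
  · exact hb u

lemma norm_le_exp_norm (u : Space n) : ‖u‖ ≤ Real.exp (1 * ‖u‖) := by
  have := Real.add_one_le_exp (1 * ‖u‖)
  linarith

lemma one_le_exp_norm (u : Space n) : ‖(1 : ℝ)‖ ≤ Real.exp (1 * ‖u‖) := by
  rw [norm_one]
  exact Real.one_le_exp (by positivity)

/-- Differentiation of `y ↦ ∫ e^⟨u, y⟩ Φ(u) dμ(u)` under the integral sign. -/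
lemma HasExpMoments.hasFDerivAt_integral {F : Type*} [NormedAddCommGroup F] [NormedSpace ℝ F]
    [CompleteSpace F]
    (hμ : HasExpMoments μ) {Φ : Space n → F} (hΦ : Continuous Φ)
    (hb : ∀ u, ‖Φ u‖ ≤ Real.exp (1 * ‖u‖)) (y : Space n) :
    HasFDerivAt (fun y => ∫ u, Real.exp (inner ℝ u y) • Φ u ∂μ)
      (∫ u, Real.exp (inner ℝ u y) • (innerSL ℝ u).smulRight (Φ u) ∂μ) y := by
  have hc : Continuous fun u : Space n => (innerSL ℝ u).smulRight (Φ u) :=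
    (ContinuousLinearMap.smulRightL ℝ (Space n) F).continuous₂.comp
      ((innerSL ℝ).continuous.prodMk hΦ)
  refine hasFDerivAt_integral_of_dominated_of_fderiv_le
    (F := fun y u => Real.exp (inner ℝ u y) • Φ u)
    (F' := fun y u => Real.exp (inner ℝ u y) • (innerSL ℝ u).smulRight (Φ u))
    (s := Metric.ball y 1) (bound := fun u => Real.exp ((‖y‖ + 3) * ‖u‖))
    (Metric.ball_mem_nhds y one_pos) ?_ (hμ.integrable_smul hΦ hb y) ?_ ?_ (hμ _) ?_
  · refine Filter.Eventually.of_forall fun y' => ?_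
    have : Continuous fun u => Real.exp (inner ℝ u y') • Φ u := by fun_prop
    exact this.aestronglyMeasurable
  · have : Continuous fun u : Space n =>
        Real.exp (inner ℝ u y) • (innerSL ℝ u).smulRight (Φ u) := by fun_prop
    exact this.aestronglyMeasurable
  · refine Filter.Eventually.of_forall fun u y' hy' => ?_
    rw [norm_smul, Real.norm_eq_abs, Real.abs_exp, ContinuousLinearMap.norm_smulRight_apply,
      innerSL_apply_norm]
    have h1 : ‖y'‖ ≤ ‖y‖ + 1 := by
      have := norm_sub_norm_le y' y
      rw [Metric.mem_ball, dist_eq_norm] at hy'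
      linarith
    calc Real.exp (inner ℝ u y') * (‖u‖ * ‖Φ u‖)
        ≤ Real.exp ((‖y‖ + 1) * ‖u‖) * (Real.exp (1 * ‖u‖) * Real.exp (1 * ‖u‖)) := by
          gcongr
          · refine (real_inner_le_norm _ _).trans ?_
            rw [mul_comm]
            gcongr
          · exact norm_le_exp_norm u
          · exact hb u
      _ = Real.exp ((‖y‖ + 3) * ‖u‖) := by
          rw [← Real.exp_add, ← Real.exp_add]; congr 1; ring
  · refine Filter.Eventually.of_forall fun u y' _ => ?_
    have h1 : HasFDerivAt (fun y : Space n => Real.exp (inner ℝ u y))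
        (Real.exp (inner ℝ u y') • innerSL ℝ u) y' :=
      ((innerSL ℝ u).hasFDerivAt (x := y')).exp
    have h2 := h1.smul_const (Φ u)
    convert h2 using 1
    ext v
    simp [smul_smul]

lemma HasExpMoments.integrable_exp (hμ : HasExpMoments μ) (y : Space n) :
    Integrable (fun u => Real.exp (inner ℝ u y)) μ := by
  simpa using hμ.integrable_smul (Φ := fun _ => (1 : ℝ)) continuous_const one_le_exp_norm y

lemma HasExpMoments.integrable_exp_smul (hμ : HasExpMoments μ) (y : Space n) :
    Integrable (fun u => Real.exp (inner ℝ u y) • u) μ :=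
  hμ.integrable_smul continuous_id norm_le_exp_norm y

lemma HasExpMoments.laplace_pos [NeZero μ] (hμ : HasExpMoments μ) (y : Space n) :
    0 < laplace μ y :=
  integral_exp_pos (hμ.integrable_exp y)

lemma laplace_smul_tiltedMean [NeZero μ] (hμ : HasExpMoments μ) (y : Space n) :
    laplace μ y • tiltedMean μ y = ∫ u, Real.exp (inner ℝ u y) • u ∂μ := by
  rw [tiltedMean, smul_smul, mul_inv_cancel₀ (hμ.laplace_pos y).ne', one_smul]

lemma HasExpMoments.hasFDerivAt_laplace [NeZero μ] (hμ : HasExpMoments μ) (y : Space n) :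
    HasFDerivAt (laplace μ) (laplace μ y • innerSL ℝ (tiltedMean μ y)) y := by
  have h := hμ.hasFDerivAt_integral (Φ := fun _ => (1 : ℝ)) continuous_const one_le_exp_norm y
  have h1 : (fun y => ∫ u, Real.exp (inner ℝ u y) • (1 : ℝ) ∂μ) = laplace μ := by
    ext y; simp [laplace]
  rw [h1] at h
  refine h.congr_fderiv ?_
  symm
  rw [← map_smul, laplace_smul_tiltedMean hμ,
    ← (innerSL ℝ).integral_comp_comm (hμ.integrable_exp_smul y)]
  refine integral_congr_ae (Filter.Eventually.of_forall fun u => ?_)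
  ext v
  simp only [map_smul, _root_.smul_apply, ContinuousLinearMap.smulRight_apply, smul_eq_mul,
    mul_one]

/-- The gradient of the log-Laplace transform is the tilted mean. -/
lemma HasExpMoments.hasFDerivAt_log_laplace [NeZero μ] (hμ : HasExpMoments μ) (y : Space n) :
    HasFDerivAt (fun y => Real.log (laplace μ y)) (innerSL ℝ (tiltedMean μ y)) y := by
  have h := (hμ.hasFDerivAt_laplace y).log (hμ.laplace_pos y).ne'
  rwa [smul_smul, inv_mul_cancel₀ (hμ.laplace_pos y).ne', one_smul] at h

/-- The log-Laplace transform lies above its tangents: Jensen's inequality for the tilted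
measure. -/
lemma HasExpMoments.inner_tiltedMean_le [NeZero μ] (hμ : HasExpMoments μ) (y w : Space n) :
    inner ℝ (tiltedMean μ y) w
      ≤ Real.log (laplace μ (y + w)) - Real.log (laplace μ y) := by
  have hpos := hμ.laplace_pos y
  set m := inner ℝ (tiltedMean μ y) w with hm
  rw [← Real.log_div (hμ.laplace_pos _).ne' hpos.ne', Real.le_log_iff_exp_le
    (div_pos (hμ.laplace_pos _) hpos), le_div_iff₀ hpos]
  have hint : ∫ u, Real.exp (inner ℝ u y) * inner ℝ u w ∂μ = laplace μ y * m := by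
    have h1 := (innerSL ℝ w).integral_comp_comm (hμ.integrable_exp_smul y)
    rw [← laplace_smul_tiltedMean hμ] at h1
    simpa [hm, real_inner_comm] using h1
  have hi2 : Integrable (fun u => Real.exp (inner ℝ u y) * inner ℝ u w) μ := by
    have h1 := (innerSL ℝ w).integrable_comp (hμ.integrable_exp_smul y)
    simpa [real_inner_comm w] using h1
  have hi3 : Integrable (fun u => Real.exp (inner ℝ u y) * inner ℝ u w
      - m * Real.exp (inner ℝ u y)) μ := hi2.sub ((hμ.integrable_exp y).const_mul m)
  calc Real.exp m * laplace μ y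
      = ∫ u, Real.exp m * (Real.exp (inner ℝ u y)
          + (Real.exp (inner ℝ u y) * inner ℝ u w - m * Real.exp (inner ℝ u y))) ∂μ := by
        rw [integral_const_mul, integral_add (hμ.integrable_exp y) hi3,
          integral_sub hi2 ((hμ.integrable_exp y).const_mul m), hint, integral_const_mul]
        simp only [laplace]
        ring
    _ ≤ ∫ u, Real.exp (inner ℝ u (y + w)) ∂μ := by
        refine integral_mono (((hμ.integrable_exp y).add hi3).const_mul _)
          (hμ.integrable_exp (y + w)) fun u => ?_
        have h1 := Real.add_one_le_exp (inner ℝ u w - m)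
        have h2 : Real.exp (inner ℝ u (y + w))
            = Real.exp m * Real.exp (inner ℝ u y) * Real.exp (inner ℝ u w - m) := by
          rw [← Real.exp_add, ← Real.exp_add, inner_add_right]; congr 1; ring
        have h3 : (0 : ℝ) ≤ Real.exp m * Real.exp (inner ℝ u y) := by positivity
        change Real.exp m * _ ≤ _
        rw [h2]
        calc _ = Real.exp m * Real.exp (inner ℝ u y) * (inner ℝ u w - m + 1) := by ring
          _ ≤ _ := by gcongr

/-- The second-moment operator `v ↦ ∫ e^⟨u, y⟩ ⟨u, v⟩ u dμ(u)`. -/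
noncomputable def tiltedSecondMoment (μ : Measure (Space n)) (y : Space n) :
    Space n →L[ℝ] Space n :=
  ∫ u, Real.exp (inner ℝ u y) • (innerSL ℝ u).smulRight u ∂μ

/-- The covariance operator of the tilted measure. -/
noncomputable def tiltedCov (μ : Measure (Space n)) (y : Space n) : Space n →L[ℝ] Space n :=
  (laplace μ y)⁻¹ • tiltedSecondMoment μ y
    - (innerSL ℝ (tiltedMean μ y)).smulRight (tiltedMean μ y)

lemma HasExpMoments.integrable_secondMoment (hμ : HasExpMoments μ) (y : Space n) :
    Integrable (fun u => Real.exp (inner ℝ u y) • (innerSL ℝ u).smulRight u) μ := by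
  have hc : Continuous fun u : Space n => (innerSL ℝ u).smulRight u :=
    (ContinuousLinearMap.smulRightL ℝ (Space n) (Space n)).continuous₂.comp
      ((innerSL ℝ).continuous.prodMk continuous_id)
  refine hμ.integrable_smul hc (t := 2) (fun u => ?_) y
  rw [ContinuousLinearMap.norm_smulRight_apply, innerSL_apply_norm]
  calc ‖u‖ * ‖u‖ ≤ Real.exp (1 * ‖u‖) * Real.exp (1 * ‖u‖) := by
        gcongr <;> exact norm_le_exp_norm u
    _ = _ := by rw [← Real.exp_add]; congr 1; ring

lemma HasExpMoments.hasFDerivAt_tiltedMean [NeZero μ] (hμ : HasExpMoments μ) (y : Space n) :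
    HasFDerivAt (tiltedMean μ) (tiltedCov μ y) y := by
  have h1 := hμ.hasFDerivAt_integral continuous_id norm_le_exp_norm y
  have hpos := hμ.laplace_pos y
  have h2 := (hasDerivAt_inv hpos.ne').comp_hasFDerivAt y (hμ.hasFDerivAt_laplace y)
  have h3 := h2.smul h1
  refine h3.congr_fderiv ?_
  ext1 v
  have h4 := laplace_smul_tiltedMean hμ y
  simp only [tiltedCov, tiltedSecondMoment, id, _root_.add_apply,
    _root_.sub_apply, _root_.smul_apply,
    ContinuousLinearMap.smulRight_apply, innerSL_apply_apply, Function.comp_apply]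
  rw [← h4, sub_eq_add_neg, ← neg_smul, smul_smul, smul_eq_mul, smul_eq_mul]
  congr 2
  field_simp

/-- The quadratic form of the tilted covariance is the variance of `⟨u, v⟩`. -/
lemma HasExpMoments.inner_tiltedCov [NeZero μ] (hμ : HasExpMoments μ) (y v : Space n) :
    laplace μ y * inner ℝ (tiltedCov μ y v) v
      = ∫ u, Real.exp (inner ℝ u y) * (inner ℝ u v - inner ℝ (tiltedMean μ y) v) ^ 2 ∂μ
    ∧ Integrable (fun u =>
        Real.exp (inner ℝ u y) * (inner ℝ u v - inner ℝ (tiltedMean μ y) v) ^ 2) μ := by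
  set m := inner ℝ (tiltedMean μ y) v with hm
  have hpos := hμ.laplace_pos y
  have hint1 : ∫ u, Real.exp (inner ℝ u y) * inner ℝ u v ∂μ = laplace μ y * m := by
    have h1 := (innerSL ℝ v).integral_comp_comm (hμ.integrable_exp_smul y)
    rw [← laplace_smul_tiltedMean hμ] at h1
    simpa [hm, real_inner_comm] using h1
  have hi1 : Integrable (fun u => Real.exp (inner ℝ u y) * inner ℝ u v) μ := by
    have h1 := (innerSL ℝ v).integrable_comp (hμ.integrable_exp_smul y)
    simpa [real_inner_comm v] using h1
  let ev : (Space n →L[ℝ] Space n) →L[ℝ] ℝ :=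
    (innerSL ℝ v).comp (ContinuousLinearMap.apply ℝ (Space n) v)
  have hev : ∀ u, ev (Real.exp (inner ℝ u y) • (innerSL ℝ u).smulRight u)
      = Real.exp (inner ℝ u y) * inner ℝ u v ^ 2 := by
    intro u
    simp only [ev, ContinuousLinearMap.comp_apply, ContinuousLinearMap.apply_apply,
      _root_.smul_apply, ContinuousLinearMap.smulRight_apply, innerSL_apply_apply,
      real_inner_smul_right]
    rw [real_inner_comm u v]
    ring
  have hint2 : ∫ u, Real.exp (inner ℝ u y) * inner ℝ u v ^ 2 ∂μ
      = inner ℝ (tiltedSecondMoment μ y v) v := by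
    have h1 := ev.integral_comp_comm (hμ.integrable_secondMoment y)
    simp_rw [hev] at h1
    rw [h1, real_inner_comm]
    rfl
  have hi2 : Integrable (fun u => Real.exp (inner ℝ u y) * inner ℝ u v ^ 2) μ := by
    have h1 := ev.integrable_comp (hμ.integrable_secondMoment y)
    simpa [hev] using h1
  have hsplit : (fun u : Space n => Real.exp (inner ℝ u y) * (inner ℝ u v - m) ^ 2)
      = fun u => Real.exp (inner ℝ u y) * inner ℝ u v ^ 2
        - 2 * m * (Real.exp (inner ℝ u y) * inner ℝ u v) + m ^ 2 * Real.exp (inner ℝ u y) := by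
    ext u; ring
  rw [hsplit]
  have hi3 : Integrable (fun u => Real.exp (inner ℝ u y) * inner ℝ u v ^ 2
      - 2 * m * (Real.exp (inner ℝ u y) * inner ℝ u v)) μ := hi2.sub (hi1.const_mul (2 * m))
  refine ⟨?_, hi3.add ((hμ.integrable_exp y).const_mul _)⟩
  rw [integral_add hi3 ((hμ.integrable_exp y).const_mul _), integral_sub hi2 (hi1.const_mul _),
    integral_const_mul, integral_const_mul, hint1, hint2]
  change _ = _ - _ + m ^ 2 * laplace μ y
  simp only [tiltedCov, _root_.sub_apply, _root_.smul_apply,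
    ContinuousLinearMap.smulRight_apply, innerSL_apply_apply, inner_sub_left,
    real_inner_smul_left]
  rw [← hm]
  field_simp
  ring

lemma volume_setOf_inner_eq {v : Space n} (hv : v ≠ 0) (a : ℝ) :
    volume {u : Space n | inner ℝ u v = a} = 0 := by
  by_cases h : ∃ u₀ : Space n, inner ℝ u₀ v = a
  · obtain ⟨u₀, hu₀⟩ := h
    let W : Submodule ℝ (Space n) := LinearMap.ker (innerSL ℝ v : Space n →ₗ[ℝ] ℝ)
    have hW : W ≠ ⊤ := by
      intro hW
      have : v ∈ W := hW ▸ Submodule.mem_top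
      simp [W] at this
      exact hv this
    have h1 := Measure.addHaar_submodule volume W hW
    have h2 : {u : Space n | inner ℝ u v = a} = (fun u => u - u₀) ⁻¹' (W : Set (Space n)) := by
      ext u
      simp [W, inner_sub_right, sub_eq_zero, real_inner_comm, ← hu₀]
    rw [h2, (measurePreserving_sub_right volume u₀).measure_preimage_emb
      (MeasurableEquiv.subRight u₀).measurableEmbedding, h1]
  · have : {u : Space n | inner ℝ u v = a} = ∅ := by
      ext u
      simpa using fun hu => h ⟨u, hu⟩
    simp [this]

lemma HasExpMoments.inner_tiltedCov_pos [NeZero μ] (hμ : HasExpMoments μ) (hac : μ ≪ volume)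
    (y : Space n) {v : Space n} (hv : v ≠ 0) : 0 < inner ℝ (tiltedCov μ y v) v := by
  obtain ⟨h1, h2⟩ := hμ.inner_tiltedCov y v
  refine pos_of_mul_pos_right (h1 ▸ ?_) (hμ.laplace_pos y).le
  rw [integral_pos_iff_support_of_nonneg (fun u => by positivity) h2]
  have h3 : ∀ᵐ u ∂μ, u ∈ Function.support
      fun u => Real.exp (inner ℝ u y) * (inner ℝ u v - inner ℝ (tiltedMean μ y) v) ^ 2 := by
    have h4 := hac.ae_le (measure_eq_zero_iff_ae_notMem.1
      (volume_setOf_inner_eq hv (inner ℝ (tiltedMean μ y) v)))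
    filter_upwards [h4] with u hu
    have : inner ℝ u v - inner ℝ (tiltedMean μ y) v ≠ 0 := sub_ne_zero.2 hu
    simpa using this
  rw [measure_eq_measure_of_null_sdiff (Set.subset_univ _)
    (by rw [← Set.compl_eq_univ_sdiff]; exact h3)]
  exact NeZero.pos _

/-- The tilted mean is strictly monotone, since its derivative is a nondegenerate covariance. -/
theorem HasExpMoments.inner_tiltedMean_sub_pos [NeZero μ] (hμ : HasExpMoments μ)
    (hac : μ ≪ volume) (y : Space n) {w : Space n} (hw : w ≠ 0) :
    0 < inner ℝ (tiltedMean μ (y + w) - tiltedMean μ y) w := by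
  have hd : ∀ t : ℝ, HasDerivAt (fun t : ℝ => inner ℝ (tiltedMean μ (y + t • w)) w)
      (inner ℝ (tiltedCov μ (y + t • w) w) w) t := by
    intro t
    have h1 : HasDerivAt (fun t : ℝ => y + t • w) w t := by
      simpa using ((hasDerivAt_id t).smul_const w).const_add y
    have h2 := (hμ.hasFDerivAt_tiltedMean (y + t • w)).comp_hasDerivAt t h1
    simpa using h2.inner ℝ (hasDerivAt_const t w)
  have hm : StrictMono fun t : ℝ => inner ℝ (tiltedMean μ (y + t • w)) w := by
    refine strictMono_of_deriv_pos fun t => ?_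
    rw [(hd t).deriv]
    exact hμ.inner_tiltedCov_pos hac _ hw
  have := hm zero_lt_one
  simp only [zero_smul, add_zero, one_smul] at this
  rw [inner_sub_left]
  linarith

/-- Preimages of Lebesgue-null sets under the tilted mean, an injective map with invertible
derivative, are Lebesgue-null. -/
theorem HasExpMoments.quasiMeasurePreserving_tiltedMean [NeZero μ] (hμ : HasExpMoments μ)
    (hac : μ ≪ volume) : Measure.QuasiMeasurePreserving (tiltedMean μ) := by
  have hcont : Continuous (tiltedMean μ) :=
    continuous_iff_continuousAt.2 fun y => (hμ.hasFDerivAt_tiltedMean y).continuousAt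
  have hinj : Function.Injective (tiltedMean μ) := by
    intro y y' h
    by_contra hne
    have := hμ.inner_tiltedMean_sub_pos hac y (sub_ne_zero.2 (Ne.symm hne))
    rw [add_sub_cancel, h, sub_self, inner_zero_left] at this
    exact lt_irrefl _ this
  refine ⟨hcont.measurable, ?_⟩
  have hmap := map_withDensity_abs_det_fderiv_eq_addHaar volume MeasurableSet.univ.nullMeasurableSet
    (fun y _ => (hμ.hasFDerivAt_tiltedMean y).hasFDerivWithinAt) hinj.injOn
  have hdet : ∀ y, (tiltedCov μ y).det ≠ 0 := by
    intro y h0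
    obtain ⟨v, hv, hv0⟩ := (LinearMap.bot_lt_ker_of_det_eq_zero (f := (tiltedCov μ y).toLinearMap)
      h0).ne' |> (Submodule.ne_bot_iff _).1
    have := hμ.inner_tiltedCov_pos hac y hv0
    rw [LinearMap.mem_ker] at hv
    rw [show tiltedCov μ y v = 0 from hv, inner_zero_left] at this
    exact lt_irrefl _ this
  rw [Measure.restrict_univ] at hmap
  have h1 : (volume : Measure (Space n)) ≪
      volume.withDensity fun y => ENNReal.ofReal |(tiltedCov μ y).det| := by
    refine withDensity_absolutelyContinuous' ?_ (Filter.Eventually.of_forall fun y => ?_)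
    · have := aemeasurable_ofReal_abs_det_fderivWithin (μ := volume) MeasurableSet.univ
        (fun y _ => (hμ.hasFDerivAt_tiltedMean y).hasFDerivWithinAt)
      simpa using this
    · exact (ENNReal.ofReal_pos.2 (abs_pos.2 (hdet y))).ne'
  refine (h1.map hcont.measurable).trans ?_
  rw [hmap]
  exact Measure.absolutelyContinuous_of_le Measure.restrict_le_self

end SGPnP

/-! ### The MMSE denoiser -/

namespace SGPnP

variable {n : ℕ}

/-- The measure `p(u) G_σ(u) du`. Its exponential tilts are the posterior laws of the clean signal
given a noisy observation. -/
noncomputable def posteriorBase (σ : ℝ) (p : Space n → ℝ) : Measure (Space n) :=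
  volume.withDensity fun u => ENNReal.ofReal (p u * gaussianKernel σ u)

/-- The minimum-mean-square-error denoiser, that is, the posterior mean
`y ↦ ∫ u p(u) G_σ(y - u) du / p_σ(y)`. -/
noncomputable def mmse (σ : ℝ) (p : Space n → ℝ) (y : Space n) : Space n :=
  tiltedMean (posteriorBase σ p) ((σ ^ 2)⁻¹ • y)

variable {σ : ℝ} {p : Space n → ℝ}

lemma posteriorBase_absolutelyContinuous : posteriorBase σ p ≪ volume :=
  withDensity_absolutelyContinuous _ _

lemma measurable_posteriorBase_density (hp : IsProbDensity p) :
    Measurable fun u => ENNReal.ofReal (p u * gaussianKernel σ u) :=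
  (hp.measurable.mul (continuous_gaussianKernel σ).measurable).ennreal_ofReal

lemma integrable_posteriorBase_iff (hp : IsProbDensity p) (φ : Space n → ℝ) :
    Integrable φ (posteriorBase σ p) ↔ Integrable fun u => p u * gaussianKernel σ u * φ u := by
  rw [posteriorBase, integrable_withDensity_iff_integrable_smul'
    (measurable_posteriorBase_density hp)
    (Filter.Eventually.of_forall fun _ => ENNReal.ofReal_lt_top)]
  simp_rw [ENNReal.toReal_ofReal (mul_nonneg (hp.nonneg _) (gaussianKernel_nonneg _ _)),
    smul_eq_mul]

lemma integral_posteriorBase (hp : IsProbDensity p) (φ : Space n → ℝ) :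
    ∫ u, φ u ∂(posteriorBase σ p) = ∫ u, p u * gaussianKernel σ u * φ u := by
  rw [posteriorBase, integral_withDensity_eq_integral_toReal_smul
    (measurable_posteriorBase_density hp)
    (Filter.Eventually.of_forall fun _ => ENNReal.ofReal_lt_top)]
  simp_rw [ENNReal.toReal_ofReal (mul_nonneg (hp.nonneg _) (gaussianKernel_nonneg _ _)),
    smul_eq_mul]

lemma gaussianKernel_mul_exp_le (hσ : 0 < σ) (t : ℝ) (u : Space n) :
    gaussianKernel σ u * Real.exp (t * ‖u‖)
      ≤ (2 * Real.pi * σ ^ 2) ^ (-(n : ℝ) / 2) * Real.exp (t ^ 2 * σ ^ 2 / 2) := by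
  unfold gaussianKernel
  rw [mul_assoc, ← Real.exp_add]
  gcongr
  have h : t ^ 2 * σ ^ 2 / 2 - (-‖u‖ ^ 2 / (2 * σ ^ 2) + t * ‖u‖)
      = (‖u‖ / σ - t * σ) ^ 2 / 2 := by field_simp; ring
  have := sq_nonneg (‖u‖ / σ - t * σ)
  linarith

lemma hasExpMoments_posteriorBase (hσ : 0 < σ) (hp : IsProbDensity p) :
    HasExpMoments (posteriorBase σ p) := by
  intro t
  rw [integrable_posteriorBase_iff hp]
  refine (hp.integrable.mul_const
    ((2 * Real.pi * σ ^ 2) ^ (-(n : ℝ) / 2) * Real.exp (t ^ 2 * σ ^ 2 / 2))).mono' ?_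
    (Filter.Eventually.of_forall fun u => ?_)
  · have h1 := hp.measurable
    have h2 := (continuous_gaussianKernel (n := n) σ).measurable
    exact ((h1.mul h2).mul (by fun_prop)).aestronglyMeasurable
  · rw [Real.norm_eq_abs, abs_of_nonneg (by
      have := hp.nonneg u
      have := gaussianKernel_nonneg σ u
      positivity), mul_assoc]
    exact mul_le_mul_of_nonneg_left (gaussianKernel_mul_exp_le hσ t u) (hp.nonneg u)

lemma neZero_posteriorBase (hσ : 0 < σ) (hp : IsProbDensity p) : NeZero (posteriorBase σ p) := by
  refine ⟨fun h => ?_⟩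
  rw [posteriorBase, withDensity_eq_zero_iff (measurable_posteriorBase_density hp).aemeasurable]
    at h
  have h1 : p =ᵐ[volume] 0 := by
    filter_upwards [h] with u hu
    have hu' : ENNReal.ofReal (p u * gaussianKernel σ u) = 0 := hu
    rw [ENNReal.ofReal_eq_zero] at hu'
    have h2 := gaussianKernel_pos hσ u
    have h3 := hp.nonneg u
    change p u = 0
    nlinarith [mul_nonneg h3 h2.le]
  have h2 := hp.integral_eq_one
  rw [integral_congr_ae h1] at h2
  simp at h2

lemma gaussianKernel_sub (hσ : 0 < σ) (y u : Space n) :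
    gaussianKernel σ (y - u) = Real.exp (-‖y‖ ^ 2 / (2 * σ ^ 2)) *
      (gaussianKernel σ u * Real.exp (inner ℝ u ((σ ^ 2)⁻¹ • y))) := by
  have h : Real.exp (-‖y - u‖ ^ 2 / (2 * σ ^ 2)) = Real.exp (-‖y‖ ^ 2 / (2 * σ ^ 2)) *
      (Real.exp (-‖u‖ ^ 2 / (2 * σ ^ 2)) * Real.exp (inner ℝ u ((σ ^ 2)⁻¹ • y))) := by
    rw [real_inner_smul_right, ← Real.exp_add, ← Real.exp_add, norm_sub_sq_real,
      real_inner_comm]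
    congr 1
    field_simp
    ring
  rw [gaussianKernel, h, gaussianKernel]
  ring

lemma smoothedPrior_eq (hσ : 0 < σ) (hp : IsProbDensity p) (y : Space n) :
    smoothedPrior σ p y
      = Real.exp (-‖y‖ ^ 2 / (2 * σ ^ 2)) * laplace (posteriorBase σ p) ((σ ^ 2)⁻¹ • y) := by
  rw [smoothedPrior, laplace, integral_posteriorBase hp, ← integral_const_mul]
  congr 1; ext u
  rw [gaussianKernel_sub hσ]
  ring

lemma log_smoothedPrior (hσ : 0 < σ) (hp : IsProbDensity p) (y : Space n) :
    Real.log (smoothedPrior σ p y) = -‖y‖ ^ 2 / (2 * σ ^ 2)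
      + Real.log (laplace (posteriorBase σ p) ((σ ^ 2)⁻¹ • y)) := by
  have := neZero_posteriorBase hσ hp
  rw [smoothedPrior_eq hσ hp, Real.log_mul (Real.exp_pos _).ne'
    ((hasExpMoments_posteriorBase hσ hp).laplace_pos _).ne', Real.log_exp]

/-- Tweedie's formula: `σ² ∇ log p_σ(y) = mmse(y) - y`. -/
lemma hasFDerivAt_log_smoothedPrior (hσ : 0 < σ) (hp : IsProbDensity p) (y : Space n) :
    HasFDerivAt (fun y => Real.log (smoothedPrior σ p y))
      (innerSL ℝ ((σ ^ 2)⁻¹ • (mmse σ p y - y))) y := by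
  have := neZero_posteriorBase hσ hp
  have h1 : HasFDerivAt (fun y : Space n => -‖y‖ ^ 2 / (2 * σ ^ 2))
      (-(σ ^ 2)⁻¹ • innerSL ℝ y) y := by
    have h := ((hasStrictFDerivAt_norm_sq y).hasFDerivAt).const_mul (-(2 * σ ^ 2)⁻¹)
    have he : (fun y : Space n => -‖y‖ ^ 2 / (2 * σ ^ 2))
        = fun y => -(2 * σ ^ 2)⁻¹ * ‖y‖ ^ 2 := by ext y; ring
    rw [he]
    refine h.congr_fderiv ?_
    ext v
    simp
    ring
  have h2 : HasFDerivAt (fun y : Space n => (σ ^ 2)⁻¹ • y)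
      ((σ ^ 2)⁻¹ • ContinuousLinearMap.id ℝ (Space n)) y :=
    (hasFDerivAt_id (𝕜 := ℝ) y).const_smul ((σ ^ 2)⁻¹)
  have h3 := ((hasExpMoments_posteriorBase hσ hp).hasFDerivAt_log_laplace
    ((σ ^ 2)⁻¹ • y)).comp y h2
  have he : (fun y => Real.log (smoothedPrior σ p y))
      = fun y => -‖y‖ ^ 2 / (2 * σ ^ 2)
        + Real.log (laplace (posteriorBase σ p) ((σ ^ 2)⁻¹ • y)) := by
    ext y; exact log_smoothedPrior hσ hp y
  rw [he]
  refine (h1.add h3).congr_fderiv ?_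
  ext v
  simp only [mmse, _root_.add_apply, _root_.smul_apply, innerSL_apply_apply,
    ContinuousLinearMap.comp_apply, ContinuousLinearMap.id_apply, inner_smul_left,
    inner_smul_right, inner_sub_left, smul_eq_mul, conj_trivial]
  ring

/-- The log-Laplace transform of the prior weighted by a Gaussian has at most quadratic growth. -/
lemma exists_abs_log_laplace_le (hσ : 0 < σ) (hp : IsProbDensity p) :
    ∃ a : ℝ, 0 ≤ a ∧ ∀ w, |Real.log (laplace (posteriorBase σ p) w)| ≤ a * (1 + ‖w‖) ^ 2 := by
  have := neZero_posteriorBase hσ hp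
  have hE := hasExpMoments_posteriorBase hσ hp
  set κ : ℝ := (2 * Real.pi * σ ^ 2) ^ (-(n : ℝ) / 2) with hκ
  have hκpos : 0 < κ := by rw [hκ]; positivity
  set l₀ := Real.log (laplace (posteriorBase σ p) 0)
  set m₀ := tiltedMean (posteriorBase σ p) 0
  refine ⟨|Real.log κ| + σ ^ 2 + |l₀| + ‖m₀‖, by positivity, fun w => ?_⟩
  have hup : Real.log (laplace (posteriorBase σ p) w) ≤ Real.log κ + ‖w‖ ^ 2 * σ ^ 2 / 2 := by
    rw [Real.log_le_iff_le_exp (hE.laplace_pos w), Real.exp_add, Real.exp_log hκpos]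
    calc laplace (posteriorBase σ p) w
        = ∫ u, p u * gaussianKernel σ u * Real.exp (inner ℝ u w) := integral_posteriorBase hp _
      _ ≤ ∫ u, p u * (κ * Real.exp (‖w‖ ^ 2 * σ ^ 2 / 2)) := by
          refine integral_mono ((integrable_posteriorBase_iff hp _).1 (hE.integrable_exp w))
            (hp.integrable.mul_const _) fun u => ?_
          change p u * gaussianKernel σ u * _ ≤ _
          rw [mul_assoc]
          refine mul_le_mul_of_nonneg_left (le_trans ?_ (gaussianKernel_mul_exp_le hσ ‖w‖ u))
            (hp.nonneg u)
          gcongr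
          · exact gaussianKernel_nonneg _ _
          · exact (real_inner_le_norm _ _).trans (by rw [mul_comm])
      _ = _ := by rw [integral_mul_const, hp.integral_eq_one, one_mul]
  have hlow : l₀ - ‖m₀‖ * ‖w‖ ≤ Real.log (laplace (posteriorBase σ p) w) := by
    have h1 := hE.inner_tiltedMean_le 0 w
    rw [zero_add] at h1
    have h2 := neg_le_of_abs_le (abs_real_inner_le_norm m₀ w)
    linarith
  have hw := norm_nonneg w
  have b1 := le_abs_self (Real.log κ)
  have b2 := neg_le_abs l₀
  have b3 := abs_nonneg l₀
  have b4 := abs_nonneg (Real.log κ)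
  have b5 := norm_nonneg m₀
  have e1 : 1 ≤ (1 + ‖w‖) ^ 2 := by nlinarith
  have e2 : ‖w‖ ≤ (1 + ‖w‖) ^ 2 := by nlinarith
  have e3 : ‖w‖ ^ 2 ≤ (1 + ‖w‖) ^ 2 := by nlinarith
  have f1 := mul_le_mul_of_nonneg_left e1 b4
  have f2 := mul_le_mul_of_nonneg_left e1 b3
  have f3 := mul_le_mul_of_nonneg_left e2 b5
  have f4 := mul_le_mul_of_nonneg_left e3 (sq_nonneg σ)
  have f5 : 0 ≤ σ ^ 2 * (1 + ‖w‖) ^ 2 := by positivity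
  have f6 : 0 ≤ ‖m₀‖ * (1 + ‖w‖) ^ 2 := by positivity
  have f7 : 0 ≤ |l₀| * (1 + ‖w‖) ^ 2 := by positivity
  have f8 : 0 ≤ |Real.log κ| * (1 + ‖w‖) ^ 2 := by positivity
  rw [abs_le]
  constructor <;> nlinarith

/-- The posterior mean has at most quadratic growth, because it is the gradient of a convex
function of at most quadratic growth. -/
lemma exists_norm_mmse_le (hσ : 0 < σ) (hp : IsProbDensity p) :
    ∃ a : ℝ, 0 ≤ a ∧ ∀ y, ‖mmse σ p y‖ ≤ a * (1 + ‖y‖) ^ 2 := by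
  have := neZero_posteriorBase hσ hp
  have hE := hasExpMoments_posteriorBase hσ hp
  obtain ⟨a, ha, hb⟩ := exists_abs_log_laplace_le hσ hp
  have key : ∀ w, ‖tiltedMean (posteriorBase σ p) w‖ ≤ 5 * a * (1 + ‖w‖) ^ 2 := by
    intro w
    set m := tiltedMean (posteriorBase σ p) w with hm
    by_cases h0 : m = 0
    · rw [h0, norm_zero]; positivity
    have hm0 : 0 < ‖m‖ := norm_pos_iff.2 h0
    have h1 := hE.inner_tiltedMean_le w (‖m‖⁻¹ • m)
    rw [← hm, real_inner_smul_right, real_inner_self_eq_norm_sq, pow_two, ← mul_assoc,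
      inv_mul_cancel₀ hm0.ne', one_mul] at h1
    have hunit : ‖‖m‖⁻¹ • m‖ = 1 := by
      rw [norm_smul, norm_inv, norm_norm, inv_mul_cancel₀ hm0.ne']
    have h2 := (abs_le.1 (hb (w + ‖m‖⁻¹ • m))).2
    have h3 := (abs_le.1 (hb w)).1
    have h4 : ‖w + ‖m‖⁻¹ • m‖ ≤ ‖w‖ + 1 := (norm_add_le _ _).trans (by rw [hunit])
    have h5 : (1 + ‖w + ‖m‖⁻¹ • m‖) ^ 2 ≤ 4 * (1 + ‖w‖) ^ 2 := by
      have hw := norm_nonneg w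
      calc (1 + ‖w + ‖m‖⁻¹ • m‖) ^ 2 ≤ (2 * (1 + ‖w‖)) ^ 2 := by
            gcongr; linarith
        _ = _ := by ring
    have h6 := mul_le_mul_of_nonneg_left h5 ha
    linarith
  refine ⟨5 * a * (1 + (σ ^ 2)⁻¹) ^ 2, by positivity, fun y => (key _).trans ?_⟩
  rw [norm_smul, norm_inv, norm_pow, Real.norm_eq_abs, sq_abs, mul_assoc (5 * a),
    ← mul_pow]
  have hy := norm_nonneg y
  have hs : 0 ≤ (σ ^ 2)⁻¹ := by positivity
  gcongr
  nlinarith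

lemma continuous_mmse (hσ : 0 < σ) (hp : IsProbDensity p) : Continuous (mmse σ p) := by
  have := neZero_posteriorBase hσ hp
  have : Continuous (tiltedMean (posteriorBase σ p)) := continuous_iff_continuousAt.2 fun y =>
    ((hasExpMoments_posteriorBase hσ hp).hasFDerivAt_tiltedMean y).continuousAt
  exact this.comp (continuous_const_smul _)

lemma inner_mmse_le (hσ : 0 < σ) (hp : IsProbDensity p) (y w : Space n) :
    inner ℝ (mmse σ p y) w ≤ inner ℝ (mmse σ p (y + w)) w := by
  have := neZero_posteriorBase hσ hp
  by_cases hw : w = 0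
  · simp [hw]
  have hs : 0 < (σ ^ 2)⁻¹ := by positivity
  have h := (hasExpMoments_posteriorBase hσ hp).inner_tiltedMean_sub_pos
    posteriorBase_absolutelyContinuous ((σ ^ 2)⁻¹ • y) (smul_ne_zero hs.ne' hw)
  rw [real_inner_smul_right, ← smul_add, inner_sub_left] at h
  have := pos_of_mul_pos_right h hs.le
  simp only [mmse]
  linarith

lemma quasiMeasurePreserving_mmse (hσ : 0 < σ) (hp : IsProbDensity p) :
    Measure.QuasiMeasurePreserving (mmse σ p) := by
  have := neZero_posteriorBase hσ hp
  have h1 := quasiMeasurePreserving_add_smul (n := n)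
    (inv_ne_zero (pow_ne_zero 2 hσ.ne')) (0 : Space n)
  simp only [zero_add] at h1
  exact ((hasExpMoments_posteriorBase hσ hp).quasiMeasurePreserving_tiltedMean
    posteriorBase_absolutelyContinuous).comp h1

lemma one_add_norm_add_smul_le (hσ : 0 < σ) (x z : Space n) :
    1 + ‖x + σ • z‖ ≤ (1 + ‖x‖) + σ * ‖z‖ := by
  have := norm_add_le x (σ • z)
  rw [norm_smul, Real.norm_eq_abs, abs_of_pos hσ] at this
  linarith

lemma integrable_mmse_add_smul (hσ : 0 < σ) (hp : IsProbDensity p) (x : Space n) :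
    Integrable (fun z => mmse σ p (x + σ • z)) (stdGaussian (Space n)) := by
  obtain ⟨a, ha, hb⟩ := exists_norm_mmse_le hσ hp
  refine ((integrable_const_add_norm_pow_stdGaussian (1 + ‖x‖) σ 2).const_mul a).mono'
    ((continuous_mmse hσ hp).comp (by fun_prop)).aestronglyMeasurable
    (Filter.Eventually.of_forall fun z => (hb _).trans ?_)
  have := one_add_norm_add_smul_le hσ x z
  gcongr a * ?_ ^ 2

lemma integrable_id_stdGaussian : Integrable (fun z : Space n => z) (stdGaussian (Space n)) :=
  IsGaussian.integrable_id

/-- The gradient of the stochastic regularizer is the averaged residual of the MMSE denoiser. -/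
theorem gradient_smoothedRegularizer (hσ : 0 < σ) (hp : IsProbDensity p) (x : Space n) :
    gradient (smoothedRegularizer σ p) x
      = (σ ^ 2)⁻¹ • (x - ∫ z, mmse σ p (x + σ • z) ∂(stdGaussian (Space n))) := by
  obtain ⟨a, ha, hb⟩ := exists_norm_mmse_le hσ hp
  obtain ⟨l, hl, hlb⟩ := exists_abs_log_laplace_le hσ hp
  set γ := stdGaussian (Space n)
  have hs : 0 ≤ (σ ^ 2)⁻¹ := by positivity
  have hmc := continuous_mmse hσ hp
  have hlogc : Continuous fun y => Real.log (smoothedPrior σ p y) :=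
    continuous_iff_continuousAt.2 fun y => (hasFDerivAt_log_smoothedPrior hσ hp y).continuousAt
  have hlogint : Integrable (fun z => Real.log (smoothedPrior σ p (x + σ • z))) γ := by
    refine ((integrable_const_add_norm_pow_stdGaussian (1 + ‖x‖) σ 2).const_mul
      ((2 * σ ^ 2)⁻¹ + l * (1 + (σ ^ 2)⁻¹) ^ 2)).mono'
      (hlogc.comp (by fun_prop)).aestronglyMeasurable
      (Filter.Eventually.of_forall fun z => ?_)
    set y := x + σ • z
    have hy := norm_nonneg y
    rw [log_smoothedPrior hσ hp, Real.norm_eq_abs]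
    refine (abs_add_le _ _).trans ?_
    have h1 : |-‖y‖ ^ 2 / (2 * σ ^ 2)| ≤ (2 * σ ^ 2)⁻¹ * (1 + ‖y‖) ^ 2 := by
      rw [neg_div, abs_neg, abs_of_nonneg (by positivity), div_eq_inv_mul]
      gcongr
      linarith
    have h2 := hlb ((σ ^ 2)⁻¹ • y)
    rw [norm_smul, norm_inv, norm_pow, Real.norm_eq_abs σ, sq_abs] at h2
    have h3 : l * (1 + (σ ^ 2)⁻¹ * ‖y‖) ^ 2 ≤ l * (1 + (σ ^ 2)⁻¹) ^ 2 * (1 + ‖y‖) ^ 2 := by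
      rw [mul_assoc, ← mul_pow]
      gcongr
      nlinarith
    calc _ ≤ (2 * σ ^ 2)⁻¹ * (1 + ‖y‖) ^ 2 + l * (1 + (σ ^ 2)⁻¹) ^ 2 * (1 + ‖y‖) ^ 2 :=
          add_le_add h1 (h2.trans h3)
      _ = ((2 * σ ^ 2)⁻¹ + l * (1 + (σ ^ 2)⁻¹) ^ 2) * (1 + ‖y‖) ^ 2 := by ring
      _ ≤ _ := by
          have := one_add_norm_add_smul_le hσ x z
          gcongr _ * ?_ ^ 2
  have hF := hasFDerivAt_integral_of_dominated_of_fderiv_le (𝕜 := ℝ) (μ := γ)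
    (F := fun x z => Real.log (smoothedPrior σ p (x + σ • z)))
    (F' := fun x z => innerSL ℝ ((σ ^ 2)⁻¹ • (mmse σ p (x + σ • z) - (x + σ • z))))
    (x₀ := x) (s := Metric.ball x 1)
    (bound := fun z => (σ ^ 2)⁻¹ * ((a + 1) * ((2 + ‖x‖) + σ * ‖z‖) ^ 2))
    (Metric.ball_mem_nhds x one_pos)
    (Filter.Eventually.of_forall fun x' => (hlogc.comp (by fun_prop)).aestronglyMeasurable)
    hlogint
    (by
      have : Continuous fun z : Space n =>
        innerSL ℝ ((σ ^ 2)⁻¹ • (mmse σ p (x + σ • z) - (x + σ • z))) := by fun_prop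
      exact this.aestronglyMeasurable)
    (Filter.Eventually.of_forall fun z x' hx' => by
      rw [innerSL_apply_norm, norm_smul, norm_inv, norm_pow, Real.norm_eq_abs, sq_abs]
      gcongr
      set y := x' + σ • z
      have h1 : 1 + ‖y‖ ≤ (2 + ‖x‖) + σ * ‖z‖ := by
        have h2 := one_add_norm_add_smul_le hσ x' z
        have h3 := norm_sub_norm_le x' x
        rw [Metric.mem_ball, dist_eq_norm] at hx'
        linarith
      have hy := norm_nonneg y
      calc ‖mmse σ p y - y‖ ≤ a * (1 + ‖y‖) ^ 2 + (1 + ‖y‖) ^ 2 :=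
            (norm_sub_le _ _).trans (add_le_add (hb y) (by nlinarith))
        _ = (a + 1) * (1 + ‖y‖) ^ 2 := by ring
        _ ≤ _ := by gcongr)
    (((integrable_const_add_norm_pow_stdGaussian (2 + ‖x‖) σ 2).const_mul _).const_mul _)
    (Filter.Eventually.of_forall fun z x' _ => by
      have h := (hasFDerivAt_log_smoothedPrior hσ hp (x' + σ • z)).comp x'
        ((hasFDerivAt_id (𝕜 := ℝ) x').add_const (σ • z))
      rwa [ContinuousLinearMap.comp_id] at h)
  have hG : HasGradientAt (smoothedRegularizer σ p)
      ((σ ^ 2)⁻¹ • (x - ∫ z, mmse σ p (x + σ • z) ∂γ)) x := by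
    rw [hasGradientAt_iff_hasFDerivAt]
    refine hF.neg.congr_fderiv ?_
    have hi := integrable_mmse_add_smul hσ hp x
    have hz' : Integrable (fun z : Space n => σ • z) γ := integrable_id_stdGaussian.smul σ
    have hz : Integrable (fun z : Space n => x + σ • z) γ := (integrable_const x).add hz'
    have hr : Integrable (fun z => (σ ^ 2)⁻¹ • (mmse σ p (x + σ • z) - (x + σ • z))) γ :=
      (hi.sub hz).smul ((σ ^ 2)⁻¹)
    rw [ContinuousLinearMap.integral_comp_comm _ hr, integral_smul, integral_sub hi hz,
      integral_add (integrable_const x) hz', integral_smul]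
    have h0 : ∫ z : Space n, z ∂γ = 0 := integral_id_stdGaussian
    rw [h0]
    ext v
    change -inner ℝ _ v = inner ℝ _ v
    rw [← inner_neg_left, integral_const, probReal_univ]
    congr 1
    module
  exact hG.gradient

end SGPnP

/-! ### The noise of an unbiased denoiser -/

namespace SGPnP

variable {n : ℕ} {σ : ℝ} {p : Space n → ℝ} {D : Space n → Space n}

/-- The zero-mean part of the stochastic field, `U_σ(x, z) - ∇h_σ(x)`. -/
noncomputable def fieldNoise (σ : ℝ) (p : Space n → ℝ) (D : Space n → Space n) (x z : Space n) :
    Space n :=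
  stochasticField σ D x z - gradient (smoothedRegularizer σ p) x

/-- The mean `x - σ² ∇h_σ(x)` of the output of an unbiased denoiser at the noise-free point `x`. -/
noncomputable def denoiserMean (σ : ℝ) (p : Space n → ℝ) (x : Space n) : Space n :=
  x - σ ^ 2 • gradient (smoothedRegularizer σ p) x

lemma fieldNoise_eq (hσ : 0 < σ) (x z : Space n) :
    fieldNoise σ p D x z = -((σ ^ 2)⁻¹ • (D (x + σ • z) - denoiserMean σ p x)) := by
  have : (σ ^ 2)⁻¹ * σ ^ 2 = 1 := inv_mul_cancel₀ (by positivity)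
  simp only [fieldNoise, stochasticField, denoiserMean]
  rw [smul_sub, smul_sub, smul_sub, smul_smul, this, one_smul]
  abel

lemma denoiser_eq (hσ : 0 < σ) (x z : Space n) :
    D (x + σ • z) = x - σ ^ 2 • stochasticField σ D x z := by
  have : σ ^ 2 * (σ ^ 2)⁻¹ = 1 := mul_inv_cancel₀ (by positivity)
  simp only [stochasticField]
  rw [smul_smul, this, one_smul]
  abel

lemma integrable_denoiser (hσ : 0 < σ)
    (hL2 : ∀ x, MemLp (stochasticField σ D x) 2 (stdGaussian (Space n))) (x : Space n) :
    Integrable (fun z => D (x + σ • z)) (stdGaussian (Space n)) := by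
  simp_rw [denoiser_eq hσ]
  exact (integrable_const x).sub (((hL2 x).integrable (by norm_num)).smul (σ ^ 2))

lemma integral_denoiser (hσ : 0 < σ)
    (hunbiased : ∀ x, ∫ z, stochasticField σ D x z ∂(stdGaussian (Space n))
      = gradient (smoothedRegularizer σ p) x)
    (hL2 : ∀ x, MemLp (stochasticField σ D x) 2 (stdGaussian (Space n))) (x : Space n) :
    ∫ z, D (x + σ • z) ∂(stdGaussian (Space n)) = denoiserMean σ p x := by
  simp_rw [denoiser_eq hσ]
  have hi : Integrable (fun z => σ ^ 2 • stochasticField σ D x z) (stdGaussian (Space n)) :=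
    ((hL2 x).integrable (by norm_num)).smul (σ ^ 2)
  rw [integral_sub (integrable_const x) hi, integral_smul, hunbiased, integral_const,
    probReal_univ, one_smul, denoiserMean]

lemma integral_mmse (hσ : 0 < σ) (hp : IsProbDensity p) (x : Space n) :
    ∫ z, mmse σ p (x + σ • z) ∂(stdGaussian (Space n)) = denoiserMean σ p x := by
  rw [denoiserMean, gradient_smoothedRegularizer hσ hp, smul_smul,
    mul_inv_cancel₀ (by positivity), one_smul, sub_sub_cancel]

/-- An unbiased denoiser is the MMSE denoiser almost everywhere: both have the same Gaussian
averages by Tweedie's formula, and the Gaussian averages determine a function. -/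
theorem denoiser_ae_eq_mmse (hσ : 0 < σ) (hp : IsProbDensity p) (hD : Measurable D)
    (hunbiased : ∀ x, ∫ z, stochasticField σ D x z ∂(stdGaussian (Space n))
      = gradient (smoothedRegularizer σ p) x)
    (hL2 : ∀ x, MemLp (stochasticField σ D x) 2 (stdGaussian (Space n))) :
    ∀ᵐ y, D y = mmse σ p y := by
  have h : ∀ i, ∀ᵐ y, D y i - mmse σ p y i = 0 := by
    intro i
    have hi : ∀ x, Integrable (fun z => D (x + σ • z) - mmse σ p (x + σ • z))
        (stdGaussian (Space n)) := fun x =>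
      (integrable_denoiser hσ hL2 x).sub (integrable_mmse_add_smul hσ hp x)
    let e : Space n →L[ℝ] ℝ := EuclideanSpace.proj i
    refine ae_eq_zero_of_forall_integral_add_smul_eq_zero hσ
      (φ := fun y => e (D y - mmse σ p y)) ?_ (fun x => e.integrable_comp (hi x)) fun x => ?_
    · exact e.continuous.measurable.comp (hD.sub (continuous_mmse hσ hp).measurable)
    · rw [e.integral_comp_comm (hi x), integral_sub (integrable_denoiser hσ hL2 x)
        (integrable_mmse_add_smul hσ hp x), integral_denoiser hσ hunbiased hL2,
        integral_mmse hσ hp, sub_self, map_zero]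
  filter_upwards [ae_all_iff.2 h] with y hy
  ext i
  exact sub_eq_zero.1 (hy i)

lemma integral_norm_denoiser_sub_sq_le (hσ : 0 < σ)
    (hunbiased : ∀ x, ∫ z, stochasticField σ D x z ∂(stdGaussian (Space n))
      = gradient (smoothedRegularizer σ p) x) {V : ℝ}
    (hL2 : ∀ x, MemLp (stochasticField σ D x) 2 (stdGaussian (Space n)))
    (hvar : ∀ x, ∫ z, ‖stochasticField σ D x z
        - ∫ z', stochasticField σ D x z' ∂(stdGaussian (Space n))‖ ^ 2
      ∂(stdGaussian (Space n)) ≤ V) (x : Space n) :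
    Integrable (fun z => ‖D (x + σ • z) - denoiserMean σ p x‖ ^ 2) (stdGaussian (Space n)) ∧
    ∫ z, ‖D (x + σ • z) - denoiserMean σ p x‖ ^ 2 ∂(stdGaussian (Space n)) ≤ σ ^ 4 * V := by
  have h1 : ∀ z, ‖D (x + σ • z) - denoiserMean σ p x‖ ^ 2
      = σ ^ 4 * ‖stochasticField σ D x z - gradient (smoothedRegularizer σ p) x‖ ^ 2 := by
    intro z
    have h := fieldNoise_eq (p := p) (D := D) hσ x z
    rw [fieldNoise] at h
    rw [h, norm_neg, norm_smul, mul_pow, norm_inv, norm_pow, Real.norm_eq_abs, sq_abs]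
    field_simp
  simp_rw [h1]
  constructor
  · have := ((hL2 x).sub (memLp_const (gradient (smoothedRegularizer σ p) x))).integrable_norm_pow
      (by norm_num)
    exact this.const_mul _
  · rw [integral_const_mul]
    have := hvar x
    rw [hunbiased] at this
    gcongr

lemma norm_denoiserMean_sub_le {L : ℝ≥0} (hσ : 0 < σ)
    (hL : LipschitzWith L (gradient (smoothedRegularizer σ p))) (x y : Space n) :
    ‖denoiserMean σ p x - denoiserMean σ p y‖ ≤ (1 + σ ^ 2 * L) * ‖x - y‖ := by
  have h : denoiserMean σ p x - denoiserMean σ p y = (x - y) - σ ^ 2 •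
      (gradient (smoothedRegularizer σ p) x - gradient (smoothedRegularizer σ p) y) := by
    simp only [denoiserMean]; module
  rw [h]
  refine (norm_sub_le _ _).trans ?_
  rw [norm_smul, norm_pow, Real.norm_eq_abs, sq_abs, add_mul, one_mul, mul_assoc]
  gcongr
  exact hL.norm_sub_le x y

/-- The MMSE denoiser stays within a bounded distance of its Gaussian average: being monotone, it
satisfies `⟨mmse(y), w⟩ ≤ ⟨mmse(y + w), w⟩` for all `w`, and averaging over
`w ∼ N(σe, σ² I)` bounds the component along the unit vector `e`. -/
theorem exists_norm_mmse_sub_le (hσ : 0 < σ) (hp : IsProbDensity p) {L : ℝ≥0}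
    (hL : LipschitzWith L (gradient (smoothedRegularizer σ p))) {W : ℝ}
    (hi : ∀ x, Integrable (fun z => ‖mmse σ p (x + σ • z) - denoiserMean σ p x‖ ^ 2)
      (stdGaussian (Space n)))
    (hW : ∀ x, ∫ z, ‖mmse σ p (x + σ • z) - denoiserMean σ p x‖ ^ 2 ∂(stdGaussian (Space n))
      ≤ W) :
    ∃ C : ℝ, ∀ y, ‖mmse σ p y - denoiserMean σ p y‖ ≤ C := by
  set γ := stdGaussian (Space n)
  set T := mmse σ p
  set m := denoiserMean σ p
  set A := ∫ z : Space n, (1 + 1 * ‖z‖) ^ 2 ∂γ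
  have hA := integrable_const_add_norm_pow_stdGaussian (n := n) 1 1 2
  have key : ∀ y e : Space n, ‖e‖ = 1 →
      inner ℝ (T y - m y) e ≤ (W + A) / 2 + (1 + σ ^ 2 * L) * σ := by
    intro y e he
    have hmono : ∀ z : Space n, inner ℝ (T y) (e + z)
        ≤ (‖T (y + σ • e + σ • z) - m (y + σ • e)‖ ^ 2 + (1 + 1 * ‖z‖) ^ 2) / 2
          + inner ℝ (m (y + σ • e)) (e + z) := by
      intro z
      have h1 := inner_mmse_le hσ hp y (σ • (e + z))
      rw [real_inner_smul_right, real_inner_smul_right, smul_add, ← add_assoc] at h1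
      have h2 := le_of_mul_le_mul_left h1 hσ
      have h3 : inner ℝ (T (y + σ • e + σ • z)) (e + z)
          = inner ℝ (T (y + σ • e + σ • z) - m (y + σ • e)) (e + z)
            + inner ℝ (m (y + σ • e)) (e + z) := by rw [inner_sub_left]; ring
      have h4 := real_inner_le_norm (T (y + σ • e + σ • z) - m (y + σ • e)) (e + z)
      have h5 : ‖e + z‖ ≤ 1 + 1 * ‖z‖ := (norm_add_le e z).trans (by rw [he, one_mul])
      have h6 : ‖T (y + σ • e + σ • z) - m (y + σ • e)‖ * ‖e + z‖
          ≤ ‖T (y + σ • e + σ • z) - m (y + σ • e)‖ * (1 + 1 * ‖z‖) := by gcongr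
      nlinarith [sq_nonneg (‖T (y + σ • e + σ • z) - m (y + σ • e)‖ - (1 + 1 * ‖z‖))]
    have hlin : ∀ u : Space n, Integrable (fun z => inner ℝ u (e + z)) γ
        ∧ ∫ z, inner ℝ u (e + z) ∂γ = inner ℝ u e := by
      intro u
      have hi1 : Integrable (fun z : Space n => e + z) γ :=
        (integrable_const e).add integrable_id_stdGaussian
      refine ⟨(innerSL ℝ u).integrable_comp hi1, ?_⟩
      have h := (innerSL ℝ u).integral_comp_comm hi1
      simp only [innerSL_apply_apply] at h
      have h0 : ∫ z : Space n, z ∂γ = 0 := ProbabilityTheory.integral_id_stdGaussian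
      rw [h, integral_add (integrable_const e) integrable_id_stdGaussian, h0,
        integral_const, probReal_univ, one_smul, add_zero]
    have hi2 := ((hi (y + σ • e)).add hA).div_const 2
    have h := integral_mono (hlin (T y)).1 (hi2.add (hlin (m (y + σ • e))).1) hmono
    rw [(hlin (T y)).2] at h
    have h' : inner ℝ (T y) e ≤ (W + A) / 2 + inner ℝ (m (y + σ • e)) e := by
      refine h.trans ?_
      simp only [Pi.add_apply]
      rw [integral_add (by exact hi2) (hlin (m (y + σ • e))).1, integral_div,
        integral_add (hi _) hA, (hlin (m (y + σ • e))).2]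
      have := hW (y + σ • e)
      gcongr
    have h7 : inner ℝ (m (y + σ • e) - m y) e ≤ (1 + σ ^ 2 * L) * σ := by
      refine (real_inner_le_norm _ _).trans ?_
      rw [he, mul_one]
      refine (norm_denoiserMean_sub_le hσ hL _ _).trans (le_of_eq ?_)
      rw [add_sub_cancel_left, norm_smul, he, mul_one, Real.norm_eq_abs, abs_of_pos hσ]
    rw [inner_sub_left] at h7 ⊢
    linarith
  refine ⟨max 0 ((W + A) / 2 + (1 + σ ^ 2 * L) * σ), fun y => ?_⟩
  by_cases h0 : T y - m y = 0
  · rw [h0, norm_zero]; exact le_max_left _ _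
  · have hpos : 0 < ‖T y - m y‖ := norm_pos_iff.2 h0
    refine le_trans ?_ (le_max_right _ _)
    refine le_trans (le_of_eq ?_) (key y (‖T y - m y‖⁻¹ • (T y - m y)) ?_)
    · rw [real_inner_smul_right, real_inner_self_eq_norm_sq, pow_two, ← mul_assoc,
        inv_mul_cancel₀ hpos.ne', one_mul]
    · rw [norm_smul, norm_inv, norm_norm, inv_mul_cancel₀ hpos.ne']

/-- The output of an unbiased denoiser deviates from its mean by at most an affine function of the
size of the injected noise, uniformly in the point. -/
theorem exists_norm_denoiser_sub_le (hσ : 0 < σ) (hp : IsProbDensity p) (hD : Measurable D)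
    {L : ℝ≥0} (hL : LipschitzWith L (gradient (smoothedRegularizer σ p)))
    (hunbiased : ∀ x, ∫ z, stochasticField σ D x z ∂(stdGaussian (Space n))
      = gradient (smoothedRegularizer σ p) x) {V : ℝ}
    (hL2 : ∀ x, MemLp (stochasticField σ D x) 2 (stdGaussian (Space n)))
    (hvar : ∀ x, ∫ z, ‖stochasticField σ D x z
        - ∫ z', stochasticField σ D x z' ∂(stdGaussian (Space n))‖ ^ 2
      ∂(stdGaussian (Space n)) ≤ V) :
    ∃ a b : ℝ, 0 ≤ a ∧ 0 ≤ b ∧ ∀ x, ∀ᵐ z ∂(stdGaussian (Space n)),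
      ‖D (x + σ • z) - denoiserMean σ p x‖ ≤ a + b * ‖z‖ := by
  have hae := denoiser_ae_eq_mmse hσ hp hD hunbiased hL2
  have hcongr : ∀ x, (fun z => ‖D (x + σ • z) - denoiserMean σ p x‖ ^ 2)
      =ᵐ[stdGaussian (Space n)] fun z => ‖mmse σ p (x + σ • z) - denoiserMean σ p x‖ ^ 2 := by
    intro x
    filter_upwards [ae_stdGaussian_add_smul hσ.ne' x hae] with z hz
    rw [hz]
  obtain ⟨C, hC⟩ := exists_norm_mmse_sub_le hσ hp hL (W := σ ^ 4 * V)
    (fun x => (integral_norm_denoiser_sub_sq_le hσ hunbiased hL2 hvar x).1.congr (hcongr x))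
    (fun x => by
      rw [← integral_congr_ae (hcongr x)]
      exact (integral_norm_denoiser_sub_sq_le hσ hunbiased hL2 hvar x).2)
  have hC0 : 0 ≤ C := (norm_nonneg _).trans (hC 0)
  refine ⟨C, (1 + σ ^ 2 * L) * σ, hC0, by positivity, fun x => ?_⟩
  filter_upwards [ae_stdGaussian_add_smul hσ.ne' x hae] with z hz
  have h1 := norm_denoiserMean_sub_le hσ hL (x + σ • z) x
  rw [add_sub_cancel_left, norm_smul, Real.norm_eq_abs, abs_of_pos hσ, ← mul_assoc] at h1
  have h2 := norm_sub_le_norm_sub_add_norm_sub (D (x + σ • z)) (denoiserMean σ p (x + σ • z))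
    (denoiserMean σ p x)
  have h3 := hC (x + σ • z)
  rw [← hz] at h3
  linarith

/-- A lower bound for the integral of a nonnegative function against a shifted Gaussian. By the
Cameron–Martin formula, the density of the shifted Gaussian is at least `1 + ⟨d, z⟩ - ‖d‖² / 2`. -/
lemma sub_le_integral_stdGaussian_add {φ R : Space n → ℝ} (hφ0 : ∀ z, 0 ≤ φ z)
    (hφ : Integrable φ (stdGaussian (Space n))) (hR : Integrable R (stdGaussian (Space n)))
    (hφR : ∀ᵐ z ∂(stdGaussian (Space n)), φ z * (1 + ‖z‖) ≤ R z) {d : Space n}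
    (hd : Integrable (fun z => φ (z + d)) (stdGaussian (Space n))) {r : ℝ} (hdr : ‖d‖ ≤ r)
    (hr1 : r ≤ 1) :
    ∫ z, φ z ∂(stdGaussian (Space n)) - r * ∫ z, R z ∂(stdGaussian (Space n))
      ≤ ∫ z, φ (z + d) ∂(stdGaussian (Space n)) := by
  have hd0 := norm_nonneg d
  rw [integral_stdGaussian_add, ← integral_const_mul, ← integral_sub hφ (hR.const_mul r)]
  refine integral_mono_ae (hφ.sub (hR.const_mul r))
    ((integrable_stdGaussian_add_iff φ d).1 hd) ?_
  filter_upwards [hφR] with z hz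
  have h1 := Real.add_one_le_exp (inner ℝ d z - ‖d‖ ^ 2 / 2)
  have h2 := neg_le_of_abs_le (abs_real_inner_le_norm d z)
  have hz0 := norm_nonneg z
  have h3 : 1 - r * (1 + ‖z‖) ≤ Real.exp (inner ℝ d z - ‖d‖ ^ 2 / 2) := by
    nlinarith [mul_le_mul_of_nonneg_right hdr hz0]
  have h4 := mul_le_mul_of_nonneg_left hz (hd0.trans hdr)
  have h5 := mul_le_mul_of_nonneg_right h3 (hφ0 z)
  simp only [smul_eq_mul]
  linarith

lemma integrable_one_add_norm_mul_sq (a b : ℝ) :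
    Integrable (fun z : Space n => (a + b * ‖z‖) ^ 2 * (1 + ‖z‖)) (stdGaussian (Space n)) := by
  have : (fun z : Space n => (a + b * ‖z‖) ^ 2 * (1 + ‖z‖))
      = fun z => a ^ 2 + (a ^ 2 + 2 * a * b) * ‖z‖ ^ 1 + (2 * a * b + b ^ 2) * ‖z‖ ^ 2
        + b ^ 2 * ‖z‖ ^ 3 := by ext z; ring
  rw [this]
  exact (((integrable_const _).add ((integrable_norm_pow_stdGaussian 1).const_mul _)).add
    ((integrable_norm_pow_stdGaussian 2).const_mul _)).add
      ((integrable_norm_pow_stdGaussian 3).const_mul _)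

/-- The second moment of the noise along a direction in which the variance of the denoiser is
bounded below at `x` remains bounded below near `x`. -/
lemma le_integral_inner_fieldNoise_sq (hσ : 0 < σ)
    {L : ℝ≥0} (hL : LipschitzWith L (gradient (smoothedRegularizer σ p)))
    (hL2 : ∀ x, MemLp (stochasticField σ D x) 2 (stdGaussian (Space n)))
    {a b : ℝ} (hab : ∀ x, ∀ᵐ z ∂(stdGaussian (Space n)),
      ‖D (x + σ • z) - denoiserMean σ p x‖ ≤ a + b * ‖z‖)
    {v x x' : Space n} (hv : ‖v‖ = 1) {c : ℝ}
    (hvar_lower : c ≤ variance (fun z => inner ℝ v (D (x + σ • z))) (stdGaussian (Space n)))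
    {r : ℝ} (hr1 : r ≤ 1) (hx : ‖x' - x‖ ≤ r * σ) :
    ((σ ^ 2)⁻¹) ^ 2 * (c - r * ∫ z, (((a + (1 + σ ^ 2 * L) * σ) + b * ‖z‖) ^ 2 * (1 + ‖z‖))
        ∂(stdGaussian (Space n)))
      ≤ ∫ z, (inner ℝ v (fieldNoise σ p D x' z)) ^ 2 ∂(stdGaussian (Space n)) := by
  set γ := stdGaussian (Space n)
  set m := denoiserMean σ p
  have hκ : (0 : ℝ) < ((σ ^ 2)⁻¹) ^ 2 := by positivity
  set d := σ⁻¹ • (x' - x) with hd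
  have hdn : ‖d‖ = ‖x' - x‖ / σ := by
    rw [hd, norm_smul, norm_inv, Real.norm_eq_abs, abs_of_pos hσ, div_eq_inv_mul]
  have hdr : ‖d‖ ≤ r := by rwa [hdn, div_le_iff₀ hσ]
  set β : ℝ := inner ℝ v (m x') with hβ
  set φ : Space n → ℝ := fun z => (inner ℝ v (D (x + σ • z)) - β) ^ 2 with hφ
  have hshift : ∀ z, (inner ℝ v (fieldNoise σ p D x' z)) ^ 2 = ((σ ^ 2)⁻¹) ^ 2 * φ (z + d) := by
    intro z
    have hx' : x + σ • (z + d) = x' + σ • z := by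
      rw [hd, smul_add, smul_smul, mul_inv_cancel₀ hσ.ne', one_smul]; abel
    simp only [hφ, hβ, hx']
    rw [fieldNoise_eq hσ, inner_neg_right, real_inner_smul_right, inner_sub_right]
    ring
  have hDi : MemLp (fun z => D (x + σ • z)) 2 γ := by
    simp_rw [denoiser_eq hσ]
    exact (memLp_const x).sub ((hL2 x).const_smul (σ ^ 2))
  have hψ : MemLp (fun z => inner ℝ v (D (x + σ • z))) 2 γ := hDi.const_inner _
  have hφint : Integrable φ γ := (hψ.sub (memLp_const β)).integrable_sq
  have hφc : c ≤ ∫ z, φ z ∂γ := by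
    refine hvar_lower.trans ?_
    have h1 := variance_le_expectation_sq (μ := γ)
      (X := fun z => inner ℝ v (D (x + σ • z)) - β)
      (hψ.sub (memLp_const β)).aestronglyMeasurable
    rwa [variance_sub_const hψ.aestronglyMeasurable] at h1
  have hφle : ∀ᵐ z ∂γ, φ z * (1 + ‖z‖)
      ≤ ((a + (1 + σ ^ 2 * L) * σ) + b * ‖z‖) ^ 2 * (1 + ‖z‖) := by
    filter_upwards [hab x] with z hz
    have h1 : inner ℝ v (D (x + σ • z)) - β
        = inner ℝ v (D (x + σ • z) - m x) + inner ℝ v (m x - m x') := by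
      rw [inner_sub_right, inner_sub_right]; ring
    have h2 := abs_real_inner_le_norm v (D (x + σ • z) - m x)
    have h3 := abs_real_inner_le_norm v (m x - m x')
    rw [hv, one_mul] at h2 h3
    have h4 : ‖m x - m x'‖ ≤ (1 + σ ^ 2 * L) * σ := by
      refine (norm_denoiserMean_sub_le hσ hL x x').trans ?_
      rw [norm_sub_rev]
      have : ‖x' - x‖ ≤ σ := hx.trans (mul_le_of_le_one_left hσ.le hr1)
      gcongr
    have h5 : |inner ℝ v (D (x + σ • z)) - β| ≤ (a + (1 + σ ^ 2 * L) * σ) + b * ‖z‖ := by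
      rw [h1]
      refine (abs_add_le _ _).trans ?_
      linarith
    simp only [hφ]
    rw [← sq_abs]
    gcongr
  have hshiftint : Integrable (fun z => φ (z + d)) γ := by
    have hDi' : MemLp (fieldNoise σ p D x') 2 γ := (hL2 x').sub (memLp_const _)
    refine ((hDi'.const_inner (𝕜 := ℝ) v).integrable_sq.const_mul
      ((((σ ^ 2)⁻¹) ^ 2)⁻¹)).congr (Filter.Eventually.of_forall fun z => ?_)
    simp only [hshift]
    rw [← mul_assoc, inv_mul_cancel₀ hκ.ne', one_mul]
  have hmain := sub_le_integral_stdGaussian_add (fun z => sq_nonneg _) hφint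
    (integrable_one_add_norm_mul_sq _ _) hφle hshiftint hdr hr1
  simp_rw [hshift]
  rw [integral_const_mul]
  gcongr
  linarith

/-- The second moment of the noise along the direction `v x`, as a function of the point, is bounded
below near `x`; the quartic term makes the bound trivial far from `x`. -/
theorem exists_le_integral_inner_fieldNoise_sq (hσ : 0 < σ)
    {L : ℝ≥0} (hL : LipschitzWith L (gradient (smoothedRegularizer σ p)))
    (hL2 : ∀ x, MemLp (stochasticField σ D x) 2 (stdGaussian (Space n)))
    {a b : ℝ} (hab : ∀ x, ∀ᵐ z ∂(stdGaussian (Space n)),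
      ‖D (x + σ • z) - denoiserMean σ p x‖ ≤ a + b * ‖z‖)
    {v : Space n → Space n} (hv : ∀ x, ‖v x‖ = 1) {c : ℝ} (hc : 0 < c)
    (hvar_lower : ∀ x, c ≤ variance (fun z => inner ℝ (v x) (D (x + σ • z)))
      (stdGaussian (Space n))) :
    ∃ c₀ C : ℝ, 0 < c₀ ∧ 0 ≤ C ∧ ∀ x x' : Space n, c₀ - C * ‖x' - x‖ ^ 4
      ≤ ∫ z, (inner ℝ (v x) (fieldNoise σ p D x' z)) ^ 2 ∂(stdGaussian (Space n)) := by
  obtain ⟨Q, hQ⟩ : ∃ Q : ℝ, Q = ∫ z, (((a + (1 + σ ^ 2 * L) * σ) + b * ‖z‖) ^ 2 * (1 + ‖z‖))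
      ∂(stdGaussian (Space n)) := ⟨_, rfl⟩
  have hQ0 : 0 ≤ Q := hQ ▸ integral_nonneg fun z => by positivity
  obtain ⟨r₀, hr₀pos, hr₀1, hr₀Q⟩ : ∃ r₀ : ℝ, 0 < r₀ ∧ r₀ ≤ 1 ∧ r₀ * Q ≤ c / 2 := by
    refine ⟨min 1 (c / (2 * (Q + 1))), by positivity, min_le_left _ _, ?_⟩
    calc min 1 (c / (2 * (Q + 1))) * Q ≤ c / (2 * (Q + 1)) * (Q + 1) := by
          gcongr
          · exact min_le_right _ _
          · linarith
      _ = c / 2 := by field_simp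
  obtain ⟨κ, hκ⟩ : ∃ κ : ℝ, κ = ((σ ^ 2)⁻¹) ^ 2 := ⟨_, rfl⟩
  have hκ0 : 0 < κ := by rw [hκ]; positivity
  refine ⟨κ * (c / 2), κ * (c / 2) / (r₀ * σ) ^ 4, by positivity, by positivity, fun x x' => ?_⟩
  by_cases hfar : r₀ * σ ≤ ‖x' - x‖
  · have h1 : (r₀ * σ) ^ 4 ≤ ‖x' - x‖ ^ 4 := by gcongr
    have h2 : κ * (c / 2) ≤ κ * (c / 2) / (r₀ * σ) ^ 4 * ‖x' - x‖ ^ 4 := by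
      rw [div_mul_eq_mul_div, le_div_iff₀ (by positivity)]
      gcongr
    exact (sub_nonpos.2 h2).trans (integral_nonneg fun z => sq_nonneg _)
  · push Not at hfar
    have h := le_integral_inner_fieldNoise_sq hσ hL hL2 hab (hv x) (hvar_lower x) hr₀1 hfar.le
    rw [← hQ, ← hκ] at h
    have h7 : 0 ≤ κ * (c / 2) / (r₀ * σ) ^ 4 * ‖x' - x‖ ^ 4 := by positivity
    have h8 : κ * (c / 2) ≤ κ * (c - r₀ * Q) := by gcongr; linarith
    linarith

/-- A step of the iteration almost surely avoids any given Lebesgue-null set: the step is an affine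
image of the MMSE denoiser at a Gaussian point. -/
theorem ae_step_notMem (hσ : 0 < σ) (hp : IsProbDensity p)
    (hae : ∀ᵐ y, D y = mmse σ p y) {S : Set (Space n)} (hS : volume S = 0)
    {t : ℝ} (ht : 0 < t) (x w : Space n) :
    ∀ᵐ z ∂(stdGaussian (Space n)), x - t • (w + stochasticField σ D x z) ∉ S := by
  have hτ : t * (σ ^ 2)⁻¹ ≠ 0 := by positivity
  have h1 := ((quasiMeasurePreserving_add_smul hτ
    (x - t • (w + (σ ^ 2)⁻¹ • x))).comp (quasiMeasurePreserving_mmse hσ hp)).ae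
      (measure_eq_zero_iff_ae_notMem.1 hS)
  filter_upwards [ae_stdGaussian_add_smul hσ.ne' x hae, ae_stdGaussian_add_smul hσ.ne' x h1]
    with z hz1 hz2
  have he : x - t • (w + stochasticField σ D x z)
      = x - t • (w + (σ ^ 2)⁻¹ • x) + (t * (σ ^ 2)⁻¹) • mmse σ p (x + σ • z) := by
    simp only [stochasticField, hz1]
    module
  rw [he]
  exact hz2

end SGPnP

/-! ### Stochastic gradient descent with Gaussian-driven noise -/

namespace SGPnP

variable {n : ℕ}

namespace HasLipschitzDerivatives

variable {F : Space n → ℝ} {L ρ : ℝ≥0}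

lemma hasFDerivAt (hF : HasLipschitzDerivatives F L ρ) (x : Space n) :
    HasFDerivAt F (innerSL ℝ (gradient F x)) x :=
  (hF.differentiable x).hasGradientAt.hasFDerivAt

lemma hasFDerivAt_gradient (hF : HasLipschitzDerivatives F L ρ) (x : Space n) :
    HasFDerivAt (gradient F) (hessian F x) x :=
  (hF.differentiable_gradient x).hasFDerivAt

lemma continuous_gradient (hF : HasLipschitzDerivatives F L ρ) : Continuous (gradient F) :=
  hF.lipschitz_gradient.continuous

lemma continuous_hessian (hF : HasLipschitzDerivatives F L ρ) : Continuous (hessian F) :=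
  hF.lipschitz_hessian.continuous

/-- The first-order Taylor bound for a function with Lipschitz gradient. -/
lemma abs_taylor_one_le (hF : HasLipschitzDerivatives F L ρ) (x h : Space n) :
    |F (x + h) - F x - inner ℝ (gradient F x) h| ≤ L * ‖h‖ ^ 2 := by
  have := (convex_closedBall x ‖h‖).norm_image_sub_le_of_norm_hasFDerivWithin_le' (𝕜 := ℝ)
    (f := F) (f' := fun y => innerSL ℝ (gradient F y)) (C := L * ‖h‖)
    (φ := innerSL ℝ (gradient F x)) (x := x) (y := x + h)
    (fun y _ => (hF.hasFDerivAt y).hasFDerivWithinAt)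
    (fun y hy => by
      rw [← map_sub, innerSL_apply_norm]
      refine (hF.lipschitz_gradient.norm_sub_le _ _).trans ?_
      gcongr
      rwa [mem_closedBall_iff_norm] at hy)
    (Metric.mem_closedBall_self (norm_nonneg _)) (by simp)
  rw [add_sub_cancel_left, innerSL_apply_apply, Real.norm_eq_abs] at this
  linarith [this, sq ‖h‖, mul_assoc (L : ℝ) ‖h‖ ‖h‖]

/-- The first-order Taylor bound for the gradient. -/
lemma norm_gradient_taylor_le (hF : HasLipschitzDerivatives F L ρ) (x h : Space n) :
    ‖gradient F (x + h) - gradient F x - hessian F x h‖ ≤ ρ * ‖h‖ ^ 2 := by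
  have := (convex_closedBall x ‖h‖).norm_image_sub_le_of_norm_hasFDerivWithin_le' (𝕜 := ℝ)
    (f := gradient F) (f' := hessian F) (C := ρ * ‖h‖)
    (φ := hessian F x) (x := x) (y := x + h)
    (fun y _ => (hF.hasFDerivAt_gradient y).hasFDerivWithinAt)
    (fun y hy => by
      refine (hF.lipschitz_hessian.norm_sub_le _ _).trans ?_
      gcongr
      rwa [mem_closedBall_iff_norm] at hy)
    (Metric.mem_closedBall_self (norm_nonneg _)) (by simp)
  rw [add_sub_cancel_left] at this
  linarith [this, sq ‖h‖, mul_assoc (ρ : ℝ) ‖h‖ ‖h‖]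

lemma inner_hessian_comm (hF : HasLipschitzDerivatives F L ρ) (x u v : Space n) :
    inner ℝ (hessian F x u) v = inner ℝ u (hessian F x v) := by
  have h := second_derivative_symmetric (f := F) (f' := fun y => innerSL ℝ (gradient F y))
    (f'' := (innerSL ℝ).comp (hessian F x)) (x := x) hF.hasFDerivAt
    ((innerSL ℝ).hasFDerivAt.comp x (hF.hasFDerivAt_gradient x)) u v
  simpa [real_inner_comm] using h

end HasLipschitzDerivatives

/-- A stochastic gradient oracle `∇F(x) + ξ(x, z)` driven by Gaussian `z`: the noise `ξ(x, ·)` has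
mean zero, and its second and fourth moments are bounded uniformly in `x`. -/
structure IsStochasticOracle (F : Space n → ℝ) (ξ : Space n → Space n → Space n) (L ρ : ℝ≥0)
    (V₂ V₄ : ℝ) : Prop where
  smooth : HasLipschitzDerivatives F L ρ
  measurable : Measurable (Function.uncurry ξ)
  memLp : ∀ x, MemLp (ξ x) 4 (stdGaussian (Space n))
  integral_eq_zero : ∀ x, ∫ z, ξ x z ∂(stdGaussian (Space n)) = 0
  second_moment : ∀ x, ∫ z, ‖ξ x z‖ ^ 2 ∂(stdGaussian (Space n)) ≤ V₂
  fourth_moment : ∀ x, ∫ z, ‖ξ x z‖ ^ 4 ∂(stdGaussian (Space n)) ≤ V₄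

/-- One step of stochastic gradient descent with step size `γ`. -/
noncomputable def sgdStep (F : Space n → ℝ) (ξ : Space n → Space n → Space n) (γ : ℝ)
    (x z : Space n) : Space n :=
  x - γ • (gradient F x + ξ x z)

/-- The transition kernel of stochastic gradient descent with step size `γ`. -/
noncomputable def sgdKernel (F : Space n → ℝ) (ξ : Space n → Space n → Space n) (γ : ℝ) :
    Kernel (Space n) (Space n) :=
  (Kernel.id ×ₖ Kernel.const _ (stdGaussian (Space n))).map (Function.uncurry (sgdStep F ξ γ))

instance {α : Type*} [MeasurableSpace α] (κ : Kernel α α) [IsMarkovKernel κ] (k : ℕ) :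
    IsMarkovKernel (κ ^ k) := by
  induction k with
  | zero => exact (inferInstance : IsMarkovKernel Kernel.id)
  | succ k ih => exact (inferInstance : IsMarkovKernel ((κ ^ k) ∘ₖ κ))

namespace IsStochasticOracle

variable {F : Space n → ℝ} {ξ : Space n → Space n → Space n} {L ρ : ℝ≥0} {V₂ V₄ : ℝ}

lemma measurable_step (h : IsStochasticOracle F ξ L ρ V₂ V₄) (γ : ℝ) :
    Measurable (Function.uncurry (sgdStep F ξ γ)) := by
  have h1 := h.smooth.continuous_gradient.measurable
  exact measurable_fst.sub (((h1.comp measurable_fst).add h.measurable).const_smul γ)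

lemma measurable_step_right (h : IsStochasticOracle F ξ L ρ V₂ V₄) (γ : ℝ) (x : Space n) :
    Measurable (sgdStep F ξ γ x) :=
  (h.measurable_step γ).comp measurable_prodMk_left

lemma kernel_apply (h : IsStochasticOracle F ξ L ρ V₂ V₄) (γ : ℝ) (x : Space n) :
    sgdKernel F ξ γ x = (stdGaussian (Space n)).map (sgdStep F ξ γ x) := by
  rw [sgdKernel, Kernel.map_apply _ (h.measurable_step γ), Kernel.prod_apply, Kernel.id_apply,
    Kernel.const_apply, Measure.dirac_prod, Measure.map_map (h.measurable_step γ)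
    measurable_prodMk_left]
  rfl

lemma isMarkovKernel (h : IsStochasticOracle F ξ L ρ V₂ V₄) (γ : ℝ) :
    IsMarkovKernel (sgdKernel F ξ γ) :=
  Kernel.IsMarkovKernel.map _ (h.measurable_step γ)

lemma integral_kernel (h : IsStochasticOracle F ξ L ρ V₂ V₄) (γ : ℝ) (x : Space n)
    {φ : Space n → ℝ} (hφ : Continuous φ) :
    ∫ y, φ y ∂(sgdKernel F ξ γ x) = ∫ z, φ (sgdStep F ξ γ x z) ∂(stdGaussian (Space n)) := by
  rw [h.kernel_apply, integral_map (h.measurable_step_right γ x).aemeasurable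
    hφ.aestronglyMeasurable]

lemma integrable_kernel_iff (h : IsStochasticOracle F ξ L ρ V₂ V₄) (γ : ℝ) (x : Space n)
    {φ : Space n → ℝ} (hφ : Continuous φ) :
    Integrable φ (sgdKernel F ξ γ x)
      ↔ Integrable (fun z => φ (sgdStep F ξ γ x z)) (stdGaussian (Space n)) := by
  rw [h.kernel_apply, integrable_map_measure hφ.aestronglyMeasurable
    (h.measurable_step_right γ x).aemeasurable]
  rfl

lemma integrable_noise (h : IsStochasticOracle F ξ L ρ V₂ V₄) (x : Space n) :
    Integrable (ξ x) (stdGaussian (Space n)) :=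
  (h.memLp x).integrable (by norm_num)

lemma integrable_noise_sq (h : IsStochasticOracle F ξ L ρ V₂ V₄) (x : Space n) :
    Integrable (fun z => ‖ξ x z‖ ^ 2) (stdGaussian (Space n)) :=
  ((h.memLp x).mono_exponent (p := 2) (by norm_num)).integrable_norm_pow (by norm_num)

lemma integrable_noise_pow_four (h : IsStochasticOracle F ξ L ρ V₂ V₄) (x : Space n) :
    Integrable (fun z => ‖ξ x z‖ ^ 4) (stdGaussian (Space n)) :=
  (h.memLp x).integrable_norm_pow (by norm_num)

lemma integrable_inner_noise (h : IsStochasticOracle F ξ L ρ V₂ V₄) (x u : Space n) :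
    Integrable (fun z => inner ℝ u (ξ x z)) (stdGaussian (Space n)) :=
  (innerSL ℝ u).integrable_comp (h.integrable_noise x)

lemma integral_inner_noise (h : IsStochasticOracle F ξ L ρ V₂ V₄) (x u : Space n) :
    ∫ z, inner ℝ u (ξ x z) ∂(stdGaussian (Space n)) = 0 := by
  have h1 := (innerSL ℝ u).integral_comp_comm (h.integrable_noise x)
  simpa [h.integral_eq_zero] using h1

lemma second_nonneg (h : IsStochasticOracle F ξ L ρ V₂ V₄) : 0 ≤ V₂ :=
  (integral_nonneg fun _ => by positivity).trans (h.second_moment 0)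

lemma fourth_nonneg (h : IsStochasticOracle F ξ L ρ V₂ V₄) : 0 ≤ V₄ :=
  (integral_nonneg fun _ => by positivity).trans (h.fourth_moment 0)

/-! ### One-step estimates -/

/-- Descent in expectation. -/
lemma integral_objective_step_le (h : IsStochasticOracle F ξ L ρ V₂ V₄) {γ : ℝ} (hγ : 0 ≤ γ)
    (hγL : γ * L ≤ 1 / 2) (x : Space n) :
    Integrable (fun z => F (sgdStep F ξ γ x z)) (stdGaussian (Space n)) ∧
    ∫ z, F (sgdStep F ξ γ x z) ∂(stdGaussian (Space n))
      ≤ F x - γ / 2 * ‖gradient F x‖ ^ 2 + γ ^ 2 * (L * V₂) := by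
  set g := gradient F x
  set ν := stdGaussian (Space n)
  -- `F (x + w)` is trapped between its tangent plane minus and plus `L ‖w‖²`
  have hw : ∀ z, |F (sgdStep F ξ γ x z) - (F x - γ * ‖g‖ ^ 2 - γ * inner ℝ g (ξ x z))|
      ≤ L * γ ^ 2 * (‖g‖ ^ 2 + 2 * inner ℝ g (ξ x z) + ‖ξ x z‖ ^ 2) := by
    intro z
    have h1 := h.smooth.abs_taylor_one_le x (-(γ • (g + ξ x z)))
    rw [← sub_eq_add_neg, norm_neg, norm_smul, mul_pow, Real.norm_eq_abs, sq_abs,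
      norm_add_sq_real, inner_neg_right, real_inner_smul_right, inner_add_right,
      real_inner_self_eq_norm_sq] at h1
    have h2 : F (sgdStep F ξ γ x z) - (F x - γ * ‖g‖ ^ 2 - γ * inner ℝ g (ξ x z))
        = F (x - γ • (g + ξ x z)) - F x - -(γ * (‖g‖ ^ 2 + inner ℝ g (ξ x z))) := by
      simp only [sgdStep]; ring
    rw [h2]
    linarith
  have hi1 := h.integrable_inner_noise x g
  have hi2 := h.integrable_noise_sq x
  have hbd : Integrable (fun z => L * γ ^ 2 *
      (‖g‖ ^ 2 + 2 * inner ℝ g (ξ x z) + ‖ξ x z‖ ^ 2)) ν :=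
    (((integrable_const _).add (hi1.const_mul 2)).add hi2).const_mul _
  have hlin : Integrable (fun z => F x - γ * ‖g‖ ^ 2 - γ * inner ℝ g (ξ x z)) ν :=
    (integrable_const _).sub (hi1.const_mul γ)
  have hFm : AEStronglyMeasurable (fun z => F (sgdStep F ξ γ x z)) ν :=
    (h.smooth.differentiable.continuous.measurable.comp
      (h.measurable_step_right γ x)).aestronglyMeasurable
  have hFi : Integrable (fun z => F (sgdStep F ξ γ x z)) ν := by
    have h1 : Integrable (fun z => F (sgdStep F ξ γ x z)
        - (F x - γ * ‖g‖ ^ 2 - γ * inner ℝ g (ξ x z))) ν :=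
      hbd.mono' (hFm.sub hlin.1) (Filter.Eventually.of_forall hw)
    exact (h1.add hlin).congr (Filter.Eventually.of_forall fun z => sub_add_cancel _ _)
  refine ⟨hFi, ?_⟩
  have hle : ∫ z, F (sgdStep F ξ γ x z) ∂ν
      ≤ ∫ z, ((F x - γ * ‖g‖ ^ 2 + L * γ ^ 2 * ‖g‖ ^ 2)
        + ((2 * (L * γ ^ 2) - γ) * inner ℝ g (ξ x z) + L * γ ^ 2 * ‖ξ x z‖ ^ 2)) ∂ν := by
    refine integral_mono hFi ((integrable_const _).add ((hi1.const_mul _).add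
      (hi2.const_mul _))) fun z => ?_
    have := (abs_le.1 (hw z)).2
    linarith
  rw [integral_add (integrable_const _) (by exact (hi1.const_mul _).add (hi2.const_mul _)),
    integral_add (hi1.const_mul _) (hi2.const_mul _), integral_const_mul, integral_const_mul,
    h.integral_inner_noise, integral_const, probReal_univ, one_smul] at hle
  have h2 := mul_le_mul_of_nonneg_left (h.second_moment x)
    (by positivity : (0 : ℝ) ≤ L * γ ^ 2)
  have h3 : γ * (γ * L) * ‖g‖ ^ 2 ≤ γ * (1 / 2) * ‖g‖ ^ 2 := by gcongr
  nlinarith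

lemma sgdStep_sub (γ : ℝ) (x₀ x z : Space n) :
    sgdStep F ξ γ x z - x₀ = (x - x₀ - γ • gradient F x) - γ • ξ x z := by
  simp only [sgdStep, smul_add]
  abel

/-- Growth in expectation of the squared distance to the starting point. -/
lemma integral_dist_sq_step_le (h : IsStochasticOracle F ξ L ρ V₂ V₄) (γ : ℝ) {θ : ℝ} (hθ : 0 < θ)
    (hγ : 0 ≤ γ) (x₀ x : Space n) :
    ∫ z, ‖sgdStep F ξ γ x z - x₀‖ ^ 2 ∂(stdGaussian (Space n))
      ≤ (1 + γ * θ) * ‖x - x₀‖ ^ 2 + (γ / θ + γ ^ 2) * ‖gradient F x‖ ^ 2 + γ ^ 2 * V₂ := by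
  set a := x - x₀ - γ • gradient F x with ha
  have hi1 := h.integrable_inner_noise x a
  have hi2 := h.integrable_noise_sq x
  have he : ∀ z, ‖sgdStep F ξ γ x z - x₀‖ ^ 2
      = ‖a‖ ^ 2 + (-(2 * γ) * inner ℝ a (ξ x z) + γ ^ 2 * ‖ξ x z‖ ^ 2) := by
    intro z
    rw [sgdStep_sub, norm_sub_sq_real, real_inner_smul_right, norm_smul, mul_pow,
      Real.norm_eq_abs, sq_abs]
    ring
  simp_rw [he]
  rw [integral_add (integrable_const _) (by exact (hi1.const_mul _).add (hi2.const_mul _)),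
    integral_add (hi1.const_mul _) (hi2.const_mul _), integral_const_mul, integral_const_mul,
    h.integral_inner_noise, integral_const, probReal_univ, one_smul]
  have h1 := mul_le_mul_of_nonneg_left (h.second_moment x) (sq_nonneg γ)
  have h2 : ‖a‖ ^ 2 ≤ (1 + γ * θ) * ‖x - x₀‖ ^ 2 + (γ / θ + γ ^ 2) * ‖gradient F x‖ ^ 2 := by
    have h3 : ‖a‖ ≤ ‖x - x₀‖ + γ * ‖gradient F x‖ := by
      refine (norm_sub_le _ _).trans ?_
      rw [norm_smul, Real.norm_eq_abs, abs_of_nonneg hγ]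
    have h4 : 2 * ‖x - x₀‖ * ‖gradient F x‖ ≤ θ * ‖x - x₀‖ ^ 2 + ‖gradient F x‖ ^ 2 / θ := by
      have h5 : θ * ‖x - x₀‖ ^ 2 + ‖gradient F x‖ ^ 2 / θ - 2 * ‖x - x₀‖ * ‖gradient F x‖
          = (θ * ‖x - x₀‖ - ‖gradient F x‖) ^ 2 / θ := by field_simp; ring
      have h6 : 0 ≤ (θ * ‖x - x₀‖ - ‖gradient F x‖) ^ 2 / θ := by positivity
      linarith
    calc ‖a‖ ^ 2 ≤ (‖x - x₀‖ + γ * ‖gradient F x‖) ^ 2 := by gcongr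
      _ = ‖x - x₀‖ ^ 2 + γ * (2 * ‖x - x₀‖ * ‖gradient F x‖) + γ ^ 2 * ‖gradient F x‖ ^ 2 := by
          ring
      _ ≤ ‖x - x₀‖ ^ 2 + γ * (θ * ‖x - x₀‖ ^ 2 + ‖gradient F x‖ ^ 2 / θ)
          + γ ^ 2 * ‖gradient F x‖ ^ 2 := by gcongr
      _ = _ := by ring
  linarith

lemma add_mul_pow_four_le {u s γ : ℝ} (hγ : 0 ≤ γ) :
    (u + γ * s) ^ 4 ≤ (1 + γ) ^ 3 * (u ^ 4 + γ * s ^ 4) := by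
  have h1 : 4 * u ^ 3 * s ≤ 3 * u ^ 4 + s ^ 4 := by
    nlinarith [sq_nonneg (u ^ 2 - s * u), sq_nonneg (u ^ 2 - s ^ 2), sq_nonneg (u - s),
      sq_nonneg (u ^ 2 - 2 * u * s + s ^ 2), mul_nonneg (sq_nonneg (u - s)) (sq_nonneg (u + s)),
      mul_nonneg (sq_nonneg (u - s)) (sq_nonneg u), mul_nonneg (sq_nonneg (u - s)) (sq_nonneg s)]
  have h2 : 2 * u ^ 2 * s ^ 2 ≤ u ^ 4 + s ^ 4 := by nlinarith [sq_nonneg (u ^ 2 - s ^ 2)]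
  have h3 : 4 * u * s ^ 3 ≤ u ^ 4 + 3 * s ^ 4 := by
    nlinarith [sq_nonneg (u ^ 2 - s * u), sq_nonneg (u ^ 2 - s ^ 2), sq_nonneg (u - s),
      sq_nonneg (u ^ 2 - 2 * u * s + s ^ 2), mul_nonneg (sq_nonneg (u - s)) (sq_nonneg (u + s)),
      mul_nonneg (sq_nonneg (u - s)) (sq_nonneg u), mul_nonneg (sq_nonneg (u - s)) (sq_nonneg s)]
  have e1 := mul_le_mul_of_nonneg_left h1 hγ
  have e2 := mul_le_mul_of_nonneg_left h2 (by positivity : 0 ≤ 3 * γ ^ 2)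
  have e3 := mul_le_mul_of_nonneg_left h3 (by positivity : 0 ≤ γ ^ 3)
  nlinarith

/-- Growth in expectation of the fourth power of the distance to a starting point at which the
gradient is of the order of the square root of the step size. -/
lemma integral_dist_pow_four_step_le (h : IsStochasticOracle F ξ L ρ V₂ V₄) {γ B : ℝ} (hγ : 0 ≤ γ)
    (hγ1 : γ ≤ 1) (x₀ x : Space n) (hx₀ : ‖gradient F x₀‖ ^ 2 ≤ B * γ) :
    ∫ z, ‖sgdStep F ξ γ x z - x₀‖ ^ 4 ∂(stdGaussian (Space n))
      ≤ (1 + γ) ^ 7 * (1 + γ * L) ^ 4 * ‖x - x₀‖ ^ 4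
        + γ ^ 3 * (40 * B ^ 2 + 4 * V₂ ^ 2 + 3 * V₄) := by
  set a := x - x₀ - γ • gradient F x with ha
  have hi1 := h.integrable_inner_noise x a
  have hi2 := h.integrable_noise_sq x
  have hi4 := h.integrable_noise_pow_four x
  have hV2 := h.second_nonneg
  have hV4 := h.fourth_nonneg
  have hle : ∀ z, ‖sgdStep F ξ γ x z - x₀‖ ^ 4
      ≤ ‖a‖ ^ 4 + (-(4 * γ * ‖a‖ ^ 2) * inner ℝ a (ξ x z)
        + (8 * γ ^ 2 * ‖a‖ ^ 2 * ‖ξ x z‖ ^ 2 + 3 * γ ^ 4 * ‖ξ x z‖ ^ 4)) := by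
    intro z
    have e : ‖sgdStep F ξ γ x z - x₀‖ ^ 2
        = ‖a‖ ^ 2 - 2 * γ * inner ℝ a (ξ x z) + γ ^ 2 * ‖ξ x z‖ ^ 2 := by
      rw [sgdStep_sub, norm_sub_sq_real, real_inner_smul_right, norm_smul, mul_pow,
        Real.norm_eq_abs, sq_abs]
      ring
    have hs := abs_real_inner_le_norm a (ξ x z)
    have hs2 : (inner ℝ a (ξ x z)) ^ 2 ≤ ‖a‖ ^ 2 * ‖ξ x z‖ ^ 2 := by
      rw [← mul_pow, ← sq_abs]; gcongr
    have hs3 : -(inner ℝ a (ξ x z)) ≤ ‖a‖ * ‖ξ x z‖ := (neg_le_abs _).trans hs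
    have k1 := mul_le_mul_of_nonneg_left hs2 (by positivity : 0 ≤ 4 * γ ^ 2)
    have k2 := mul_le_mul_of_nonneg_left hs3
      (by positivity : 0 ≤ 4 * γ ^ 3 * ‖ξ x z‖ ^ 2)
    have k3 : 0 ≤ 2 * γ ^ 2 * ‖ξ x z‖ ^ 2 * (‖a‖ - γ * ‖ξ x z‖) ^ 2 := by positivity
    calc ‖sgdStep F ξ γ x z - x₀‖ ^ 4 = (‖sgdStep F ξ γ x z - x₀‖ ^ 2) ^ 2 := by ring
      _ = (‖a‖ ^ 2 - 2 * γ * inner ℝ a (ξ x z) + γ ^ 2 * ‖ξ x z‖ ^ 2) ^ 2 := by rw [e]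
      _ ≤ _ := by nlinarith
  have hbd := (integrable_const (‖a‖ ^ 4)).add ((hi1.const_mul (-(4 * γ * ‖a‖ ^ 2))).add
    ((hi2.const_mul (8 * γ ^ 2 * ‖a‖ ^ 2)).add (hi4.const_mul (3 * γ ^ 4))))
  have hmono := integral_mono_of_nonneg (Filter.Eventually.of_forall fun z => by positivity) hbd
    (Filter.Eventually.of_forall hle)
  simp only [Pi.add_apply] at hmono
  rw [integral_add (integrable_const _) (by exact (hi1.const_mul _).add ((hi2.const_mul _).add
      (hi4.const_mul _))),
    integral_add (hi1.const_mul _) (by exact (hi2.const_mul _).add (hi4.const_mul _)),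
    integral_add (hi2.const_mul _) (hi4.const_mul _),
    integral_const_mul, integral_const_mul, integral_const_mul,
    h.integral_inner_noise, integral_const, probReal_univ, one_smul] at hmono
  have m2 := mul_le_mul_of_nonneg_left (h.second_moment x)
    (by positivity : 0 ≤ 8 * γ ^ 2 * ‖a‖ ^ 2)
  have m4 := mul_le_mul_of_nonneg_left (h.fourth_moment x) (by positivity : 0 ≤ 3 * γ ^ 4)
  have ha4 : ‖a‖ ^ 4 ≤ (1 + γ) ^ 3 * ((1 + γ * L) ^ 4 * ‖x - x₀‖ ^ 4 + γ ^ 3 * B ^ 2) := by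
    have h1 : ‖gradient F x‖ ≤ ‖gradient F x₀‖ + L * ‖x - x₀‖ := by
      have := h.smooth.lipschitz_gradient.norm_sub_le x x₀
      have := norm_sub_norm_le (gradient F x) (gradient F x₀)
      linarith
    have h2 : ‖a‖ ≤ (1 + γ * L) * ‖x - x₀‖ + γ * ‖gradient F x₀‖ := by
      have h3 := norm_sub_le (x - x₀) (γ • gradient F x)
      rw [norm_smul, Real.norm_eq_abs, abs_of_nonneg hγ] at h3
      have h4 := mul_le_mul_of_nonneg_left h1 hγ
      linarith
    have h5 : ‖gradient F x₀‖ ^ 4 ≤ γ ^ 2 * B ^ 2 := by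
      calc ‖gradient F x₀‖ ^ 4 = (‖gradient F x₀‖ ^ 2) ^ 2 := by ring
        _ ≤ (B * γ) ^ 2 := by gcongr
        _ = _ := by ring
    calc ‖a‖ ^ 4 ≤ ((1 + γ * L) * ‖x - x₀‖ + γ * ‖gradient F x₀‖) ^ 4 := by gcongr
      _ ≤ (1 + γ) ^ 3 * (((1 + γ * L) * ‖x - x₀‖) ^ 4 + γ * ‖gradient F x₀‖ ^ 4) :=
          add_mul_pow_four_le hγ
      _ ≤ (1 + γ) ^ 3 * (((1 + γ * L) * ‖x - x₀‖) ^ 4 + γ * (γ ^ 2 * B ^ 2)) := by gcongr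
      _ = _ := by ring
  have hy : 8 * γ ^ 2 * ‖a‖ ^ 2 * V₂ ≤ 4 * γ * ‖a‖ ^ 4 + 4 * γ ^ 3 * V₂ ^ 2 := by
    have : 0 ≤ 4 * γ * (‖a‖ ^ 2 - γ * V₂) ^ 2 := by positivity
    nlinarith
  have h40 : (1 + 4 * γ) * (1 + γ) ^ 3 ≤ 40 := by
    calc (1 + 4 * γ) * (1 + γ) ^ 3 ≤ (1 + 4 * 1) * (1 + 1) ^ 3 := by gcongr
      _ = 40 := by norm_num
  have h14 : 1 + 4 * γ ≤ (1 + γ) ^ 4 := by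
    have := one_add_mul_le_pow (by linarith : (-2 : ℝ) ≤ γ) 4
    push_cast at this
    linarith
  have hγ4 : γ ^ 4 ≤ γ ^ 3 := pow_le_pow_of_le_one hγ hγ1 (by norm_num)
  calc ∫ z, ‖sgdStep F ξ γ x z - x₀‖ ^ 4 ∂(stdGaussian (Space n))
      ≤ (1 + 4 * γ) * ‖a‖ ^ 4 + 4 * γ ^ 3 * V₂ ^ 2 + 3 * γ ^ 4 * V₄ := by linarith
    _ ≤ (1 + 4 * γ) * ((1 + γ) ^ 3 * ((1 + γ * L) ^ 4 * ‖x - x₀‖ ^ 4 + γ ^ 3 * B ^ 2))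
        + 4 * γ ^ 3 * V₂ ^ 2 + 3 * γ ^ 3 * V₄ := by gcongr
    _ = (1 + 4 * γ) * (1 + γ) ^ 3 * ((1 + γ * L) ^ 4 * ‖x - x₀‖ ^ 4)
        + (1 + 4 * γ) * (1 + γ) ^ 3 * (γ ^ 3 * B ^ 2)
        + 4 * γ ^ 3 * V₂ ^ 2 + 3 * γ ^ 3 * V₄ := by ring
    _ ≤ (1 + γ) ^ 4 * (1 + γ) ^ 3 * ((1 + γ * L) ^ 4 * ‖x - x₀‖ ^ 4)
        + 40 * (γ ^ 3 * B ^ 2) + 4 * γ ^ 3 * V₂ ^ 2 + 3 * γ ^ 3 * V₄ := by gcongr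
    _ = _ := by ring

/-- The component of `x - x₀` along an eigenvector `v` of the Hessian at `x₀` for the eigenvalue
`-lam`, centred at the equilibrium of the linearised gradient flow. -/
noncomputable def unstableCoord (F : Space n → ℝ) (x₀ v : Space n) (lam : ℝ) (x : Space n) : ℝ :=
  inner ℝ v (x - x₀) - inner ℝ v (gradient F x₀) / lam

/-- Growth in expectation of the square of the unstable coordinate: expansion at rate `κ` by
negative curvature, and the noise injected along the eigenvector. -/
lemma le_integral_unstableCoord_sq_step (h : IsStochasticOracle F ξ L ρ V₂ V₄) {γ κ : ℝ}
    (hγ : 0 < γ) (hκ : 0 < κ) (hγκ : γ * κ ≤ 1) {x₀ v : Space n} {lam : ℝ} (hlam : κ ≤ lam)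
    (hv : ‖v‖ = 1) (hHv : hessian F x₀ v = -lam • v) (x : Space n) :
    (1 + γ * κ) * unstableCoord F x₀ v lam x ^ 2 - 2 * γ * ρ ^ 2 / κ * ‖x - x₀‖ ^ 4
        + γ ^ 2 * ∫ z, (inner ℝ v (ξ x z)) ^ 2 ∂(stdGaussian (Space n))
      ≤ ∫ z, unstableCoord F x₀ v lam (sgdStep F ξ γ x z) ^ 2 ∂(stdGaussian (Space n)) := by
  have hlam0 : 0 < lam := hκ.trans_le hlam
  set w := unstableCoord F x₀ v lam x with hw
  set R := gradient F x - gradient F x₀ - hessian F x₀ (x - x₀) with hR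
  set r := inner ℝ v R with hr
  have hrle : |r| ≤ ρ * ‖x - x₀‖ ^ 2 := by
    have h1 := h.smooth.norm_gradient_taylor_le x₀ (x - x₀)
    rw [add_sub_cancel] at h1
    have h2 := abs_real_inner_le_norm v R
    rw [hv, one_mul] at h2
    exact h2.trans h1
  have hgrad : inner ℝ v (gradient F x) = -lam * w + r := by
    have h1 : inner ℝ v (hessian F x₀ (x - x₀)) = -lam * inner ℝ v (x - x₀) := by
      rw [← h.smooth.inner_hessian_comm, hHv, real_inner_smul_left]
    rw [hr, hR, inner_sub_right, inner_sub_right, h1, hw, unstableCoord]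
    field_simp
    ring
  have hstep : ∀ z, unstableCoord F x₀ v lam (sgdStep F ξ γ x z)
      = ((1 + γ * lam) * w - γ * r) - γ * inner ℝ v (ξ x z) := by
    intro z
    have h1 : unstableCoord F x₀ v lam (sgdStep F ξ γ x z)
        = w - γ * inner ℝ v (gradient F x) - γ * inner ℝ v (ξ x z) := by
      simp only [hw, unstableCoord, sgdStep_sub, inner_sub_right, real_inner_smul_right]
      ring
    rw [h1, hgrad]
    ring
  set A := (1 + γ * lam) * w - γ * r with hA
  have hi1 := h.integrable_inner_noise x v
  have hi2 : Integrable (fun z => (inner ℝ v (ξ x z)) ^ 2) (stdGaussian (Space n)) := by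
    have h1 := ((h.memLp x).mono_exponent (p := 2) (by norm_num)).const_inner (𝕜 := ℝ) v
    exact h1.integrable_sq
  have he : ∀ z, unstableCoord F x₀ v lam (sgdStep F ξ γ x z) ^ 2
      = A ^ 2 + (-(2 * γ * A) * inner ℝ v (ξ x z) + γ ^ 2 * (inner ℝ v (ξ x z)) ^ 2) := by
    intro z
    rw [hstep]
    ring
  simp_rw [he]
  rw [integral_add (integrable_const _) (by exact (hi1.const_mul _).add (hi2.const_mul _)),
    integral_add (hi1.const_mul _) (hi2.const_mul _), integral_const_mul, integral_const_mul,
    h.integral_inner_noise, integral_const, probReal_univ, one_smul]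
  have hr2 : r ^ 2 ≤ ρ ^ 2 * ‖x - x₀‖ ^ 4 := by
    calc r ^ 2 = |r| ^ 2 := (sq_abs r).symm
      _ ≤ (ρ * ‖x - x₀‖ ^ 2) ^ 2 := by gcongr
      _ = _ := by ring
  -- `(p - q)² ≥ (1 - θ) p² - q² / θ` with `θ = γ κ / 2`
  have hγκ0 : 0 < γ * κ := by positivity
  have hyoung : (1 - γ * κ / 2) * ((1 + γ * lam) * w) ^ 2 - 2 * γ / κ * r ^ 2 ≤ A ^ 2 := by
    have e : A ^ 2 - ((1 - γ * κ / 2) * ((1 + γ * lam) * w) ^ 2 - 2 * γ / κ * r ^ 2)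
        = γ * κ / 2 * ((1 + γ * lam) * w - 2 / κ * r) ^ 2 + γ ^ 2 * r ^ 2 := by
      rw [hA]
      field_simp
      ring
    have : 0 ≤ γ * κ / 2 * ((1 + γ * lam) * w - 2 / κ * r) ^ 2 + γ ^ 2 * r ^ 2 := by positivity
    linarith
  have hgrow : (1 + γ * κ) * w ^ 2 ≤ (1 - γ * κ / 2) * ((1 + γ * lam) * w) ^ 2 := by
    have h1 : 1 + γ * κ ≤ (1 - γ * κ / 2) * (1 + γ * κ) ^ 2 := by
      nlinarith [mul_nonneg hγκ0.le (sub_nonneg.2 hγκ)]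
    have h2 : (1 + γ * κ) ^ 2 ≤ (1 + γ * lam) ^ 2 := by gcongr
    have h3 : 0 ≤ 1 - γ * κ / 2 := by linarith
    calc (1 + γ * κ) * w ^ 2 ≤ (1 - γ * κ / 2) * (1 + γ * lam) ^ 2 * w ^ 2 := by
          have := mul_le_mul_of_nonneg_left h2 h3
          gcongr
          linarith
      _ = _ := by ring
  have hr3 : 2 * γ / κ * r ^ 2 ≤ 2 * γ * ρ ^ 2 / κ * ‖x - x₀‖ ^ 4 := by
    calc 2 * γ / κ * r ^ 2 ≤ 2 * γ / κ * (ρ ^ 2 * ‖x - x₀‖ ^ 4) := by gcongr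
      _ = _ := by ring
  linarith

end IsStochasticOracle

end SGPnP

/-! ### Moments of the iterates -/

namespace SGPnP

variable {n : ℕ}

/-- Continuous functions growing at most like the fourth power of the norm. -/
def QuarticGrowth (φ : Space n → ℝ) : Prop :=
  Continuous φ ∧ ∃ c, ∀ x, |φ x| ≤ c * (1 + ‖x‖) ^ 4

lemma quarticGrowth_norm_sub_pow_four (x₀ : Space n) :
    QuarticGrowth fun x => ‖x - x₀‖ ^ 4 := by
  refine ⟨by fun_prop, (1 + ‖x₀‖) ^ 4, fun x => ?_⟩
  have h1 := norm_sub_le x x₀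
  have h2 := norm_nonneg x
  have h3 := norm_nonneg x₀
  rw [abs_of_nonneg (by positivity), ← mul_pow]
  exact pow_le_pow_left₀ (norm_nonneg _) (by nlinarith) 4

/-- Continuous functions of at most quadratic growth have at most quartic growth. -/
lemma quarticGrowth_of_le_sq {φ : Space n → ℝ} (hφ : Continuous φ) {a b : ℝ} (ha : 0 ≤ a)
    (hb : 0 ≤ b) (h : ∀ x, |φ x| ≤ (a + b * ‖x‖) ^ 2) : QuarticGrowth φ := by
  refine ⟨hφ, (a + b) ^ 2, fun x => (h x).trans ?_⟩
  have hx := norm_nonneg x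
  calc (a + b * ‖x‖) ^ 2 ≤ ((a + b) * (1 + ‖x‖)) ^ 2 := by
        gcongr
        nlinarith
    _ = (a + b) ^ 2 * (1 + ‖x‖) ^ 2 := by ring
    _ ≤ (a + b) ^ 2 * (1 + ‖x‖) ^ 4 := by
        gcongr
        · linarith
        · norm_num

namespace IsStochasticOracle

variable {F : Space n → ℝ} {ξ : Space n → Space n → Space n} {L ρ : ℝ≥0} {V₂ V₄ : ℝ}

lemma quarticGrowth_objective (h : IsStochasticOracle F ξ L ρ V₂ V₄) : QuarticGrowth F := by
  refine quarticGrowth_of_le_sq h.smooth.differentiable.continuous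
    (a := |F 0| + 1 + ‖gradient F 0‖) (b := 1 + ‖gradient F 0‖ + L) (by positivity)
    (by positivity) fun x => ?_
  have h1 := h.smooth.abs_taylor_one_le 0 x
  rw [zero_add] at h1
  have h2 := abs_real_inner_le_norm (gradient F 0) x
  have h3 : |F x| ≤ |F 0| + ‖gradient F 0‖ * ‖x‖ + L * ‖x‖ ^ 2 := by
    have e : F x = (F x - F 0 - inner ℝ (gradient F 0) x) + (F 0 + inner ℝ (gradient F 0) x) := by
      ring
    rw [e]
    refine (abs_add_le _ _).trans ?_
    have := abs_add_le (F 0) (inner ℝ (gradient F 0) x)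
    linarith
  have hx := norm_nonneg x
  have hL : (0 : ℝ) ≤ L := L.2
  have hg := norm_nonneg (gradient F 0)
  have h0 := abs_nonneg (F 0)
  have p1 : |F 0| ≤ (|F 0| + 1 + ‖gradient F 0‖) ^ 2 := by nlinarith
  have p2 : ‖gradient F 0‖ * ‖x‖ ≤ 2 * (|F 0| + 1 + ‖gradient F 0‖) *
      ((1 + ‖gradient F 0‖ + L) * ‖x‖) := by
    have : ‖gradient F 0‖ ≤ 2 * (|F 0| + 1 + ‖gradient F 0‖) * (1 + ‖gradient F 0‖ + L) := by
      nlinarith [mul_nonneg h0 hg, mul_nonneg h0 hL, mul_nonneg hg hL]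
    nlinarith [mul_le_mul_of_nonneg_right this hx]
  have p3 : L * ‖x‖ ^ 2 ≤ ((1 + ‖gradient F 0‖ + L) * ‖x‖) ^ 2 := by
    rw [mul_pow]
    gcongr
    nlinarith [mul_nonneg hg hL]
  nlinarith

lemma quarticGrowth_norm_gradient_sq (h : IsStochasticOracle F ξ L ρ V₂ V₄) :
    QuarticGrowth fun x => ‖gradient F x‖ ^ 2 := by
  have hc := h.smooth.continuous_gradient
  refine quarticGrowth_of_le_sq (by fun_prop) (norm_nonneg (gradient F 0)) L.2 fun x => ?_
  rw [abs_of_nonneg (by positivity)]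
  have h1 := h.smooth.lipschitz_gradient.norm_sub_le x 0
  rw [sub_zero] at h1
  have h2 := norm_sub_norm_le (gradient F x) (gradient F 0)
  gcongr
  change _ ≤ _ + (L : ℝ) * ‖x‖
  linarith

lemma quarticGrowth_norm_sub_sq (x₀ : Space n) : QuarticGrowth fun x => ‖x - x₀‖ ^ 2 := by
  refine quarticGrowth_of_le_sq (by fun_prop) (norm_nonneg x₀) zero_le_one fun x => ?_
  rw [abs_of_nonneg (by positivity)]
  have := norm_sub_le x x₀
  gcongr
  linarith

lemma quarticGrowth_unstableCoord_sq (x₀ v : Space n) (lam : ℝ) :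
    QuarticGrowth fun x => unstableCoord F x₀ v lam x ^ 2 := by
  unfold unstableCoord
  refine quarticGrowth_of_le_sq (by fun_prop)
    (a := |inner ℝ v x₀| + |inner ℝ v (gradient F x₀) / lam|) (b := ‖v‖) (by positivity)
    (norm_nonneg v) fun x => ?_
  rw [abs_of_nonneg (sq_nonneg _), ← sq_abs]
  gcongr
  rw [inner_sub_right]
  refine (abs_sub _ _).trans ?_
  have := abs_sub (inner ℝ v x) (inner ℝ v x₀)
  have := abs_real_inner_le_norm v x
  linarith

lemma integrable_one_add_norm_pow_kernel (h : IsStochasticOracle F ξ L ρ V₂ V₄) (γ : ℝ) :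
    (∀ x, Integrable (fun y => (1 + ‖y‖) ^ 4) (sgdKernel F ξ γ x)) ∧
    ∃ c, ∀ x, ∫ y, (1 + ‖y‖) ^ 4 ∂(sgdKernel F ξ γ x) ≤ c * (1 + ‖x‖) ^ 4 := by
  set s : ℝ := 1 + |γ| * (‖gradient F 0‖ + L) with hs
  have hbd : ∀ x z, (1 + ‖sgdStep F ξ γ x z‖) ^ 4
      ≤ 8 * s ^ 4 * (1 + ‖x‖) ^ 4 + 8 * |γ| ^ 4 * ‖ξ x z‖ ^ 4 := by
    intro x z
    have hx := norm_nonneg x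
    have h1 := h.smooth.lipschitz_gradient.norm_sub_le x 0
    rw [sub_zero] at h1
    have h2 := norm_sub_norm_le (gradient F x) (gradient F 0)
    have h3 : ‖gradient F x‖ ≤ (‖gradient F 0‖ + L) * (1 + ‖x‖) := by
      have hL : (0 : ℝ) ≤ L := L.2
      nlinarith [mul_nonneg (norm_nonneg (gradient F 0)) hx]
    have h4 : ‖sgdStep F ξ γ x z‖ ≤ ‖x‖ + |γ| * (‖gradient F x‖ + ‖ξ x z‖) := by
      refine (norm_sub_le _ _).trans ?_
      rw [norm_smul, Real.norm_eq_abs]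
      gcongr
      exact norm_add_le _ _
    have h5 : 1 + ‖sgdStep F ξ γ x z‖ ≤ s * (1 + ‖x‖) + |γ| * ‖ξ x z‖ := by
      have := mul_le_mul_of_nonneg_left h3 (abs_nonneg γ)
      rw [hs]
      linarith
    calc (1 + ‖sgdStep F ξ γ x z‖) ^ 4 ≤ (s * (1 + ‖x‖) + |γ| * ‖ξ x z‖) ^ 4 := by gcongr
      _ ≤ 2 ^ (4 - 1) * ((s * (1 + ‖x‖)) ^ 4 + (|γ| * ‖ξ x z‖) ^ 4) :=
          add_pow_le (by positivity) (by positivity) 4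
      _ = _ := by ring
  have hint : ∀ x, Integrable (fun z => 8 * s ^ 4 * (1 + ‖x‖) ^ 4 + 8 * |γ| ^ 4 * ‖ξ x z‖ ^ 4)
      (stdGaussian (Space n)) := fun x =>
    (integrable_const _).add ((h.integrable_noise_pow_four x).const_mul _)
  refine ⟨fun x => ?_, 8 * s ^ 4 + 8 * |γ| ^ 4 * V₄, fun x => ?_⟩
  · rw [h.integrable_kernel_iff γ x (by fun_prop)]
    refine (hint x).mono' ?_ (Filter.Eventually.of_forall fun z => ?_)
    · have := h.measurable_step_right γ x
      exact (by fun_prop : Measurable fun z => (1 + ‖sgdStep F ξ γ x z‖) ^ 4).aestronglyMeasurable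
    · rw [Real.norm_of_nonneg (by positivity)]
      exact hbd x z
  · rw [h.integral_kernel γ x (by fun_prop)]
    refine (integral_mono_of_nonneg (Filter.Eventually.of_forall fun z => by positivity) (hint x)
      (Filter.Eventually.of_forall (hbd x))).trans ?_
    rw [integral_add (integrable_const _) ((h.integrable_noise_pow_four x).const_mul _),
      integral_const, probReal_univ, one_smul, integral_const_mul]
    have h1 := mul_le_mul_of_nonneg_left (h.fourth_moment x)
      (by positivity : 0 ≤ 8 * |γ| ^ 4)
    have h2 : 8 * |γ| ^ 4 * V₄ * 1 ≤ 8 * |γ| ^ 4 * V₄ * (1 + ‖x‖) ^ 4 := by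
      have := h.fourth_nonneg
      gcongr
      exact one_le_pow₀ (by linarith [norm_nonneg x])
    linarith

lemma integrable_one_add_norm_pow (h : IsStochasticOracle F ξ L ρ V₂ V₄) (γ : ℝ) (k : ℕ)
    (x : Space n) : Integrable (fun y => (1 + ‖y‖) ^ 4) ((sgdKernel F ξ γ ^ k) x) := by
  have := h.isMarkovKernel γ
  obtain ⟨hi, c, hc⟩ := h.integrable_one_add_norm_pow_kernel γ
  have hcont : Continuous fun y : Space n => (1 + ‖y‖) ^ 4 := by fun_prop
  induction k with
  | zero =>
    rw [pow_zero]
    change Integrable (fun y : Space n => (1 + ‖y‖) ^ 4) (Kernel.id x)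
    rw [Kernel.id_apply]
    exact integrable_dirac (f := fun y : Space n => (1 + ‖y‖) ^ 4) (by simp)
  | succ k ih =>
    rw [show k + 1 = 1 + k by omega, Kernel.pow_add, pow_one]
    rw [integrable_comp_iff hcont.aestronglyMeasurable]
    refine ⟨Filter.Eventually.of_forall hi, (ih.const_mul c).mono' ?_
      (Filter.Eventually.of_forall fun y => ?_)⟩
    · exact (hcont.norm.stronglyMeasurable.integral_kernel).aestronglyMeasurable
    · rw [Real.norm_of_nonneg (integral_nonneg fun _ => by positivity)]
      refine le_trans (le_of_eq ?_) (hc y)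
      congr 1; ext z
      exact Real.norm_of_nonneg (by positivity)

lemma integrable_pow (h : IsStochasticOracle F ξ L ρ V₂ V₄) (γ : ℝ) (k : ℕ)
    (x : Space n) {φ : Space n → ℝ} (hφ : QuarticGrowth φ) :
    Integrable φ ((sgdKernel F ξ γ ^ k) x) := by
  obtain ⟨hc, c, hb⟩ := hφ
  exact ((h.integrable_one_add_norm_pow γ k x).const_mul c).mono' hc.aestronglyMeasurable
    (Filter.Eventually.of_forall hb)

/-- The Chapman–Kolmogorov equation for expectations. -/
lemma integral_pow_add (h : IsStochasticOracle F ξ L ρ V₂ V₄) (γ : ℝ) (T k : ℕ)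
    (x : Space n) {φ : Space n → ℝ} (hφ : QuarticGrowth φ) :
    Integrable (fun y => ∫ y', φ y' ∂((sgdKernel F ξ γ ^ T) y)) ((sgdKernel F ξ γ ^ k) x) ∧
    ∫ y, φ y ∂((sgdKernel F ξ γ ^ (T + k)) x)
      = ∫ y, ∫ y', φ y' ∂((sgdKernel F ξ γ ^ T) y) ∂((sgdKernel F ξ γ ^ k) x) := by
  have := h.isMarkovKernel γ
  have hi := h.integrable_pow γ (T + k) x hφ
  rw [Kernel.pow_add] at hi ⊢
  exact ⟨hi.integral_comp, ProbabilityTheory.Kernel.integral_comp hi⟩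

lemma integral_pow_zero (γ : ℝ) (x : Space n) {φ : Space n → ℝ} :
    ∫ y, φ y ∂((sgdKernel F ξ γ ^ 0) x) = φ x := by
  rw [pow_zero]
  change ∫ y, φ y ∂(Kernel.id x) = φ x
  rw [Kernel.id_apply, integral_dirac]

lemma integral_pow_succ (h : IsStochasticOracle F ξ L ρ V₂ V₄) (γ : ℝ) (k : ℕ)
    (x : Space n) {φ : Space n → ℝ} (hφ : QuarticGrowth φ) :
    Integrable (fun y => ∫ z, φ (sgdStep F ξ γ y z) ∂(stdGaussian (Space n)))
      ((sgdKernel F ξ γ ^ k) x) ∧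
    ∫ y, φ y ∂((sgdKernel F ξ γ ^ (k + 1)) x)
      = ∫ y, ∫ z, φ (sgdStep F ξ γ y z) ∂(stdGaussian (Space n)) ∂((sgdKernel F ξ γ ^ k) x) := by
  have h1 := h.integral_pow_add γ 1 k x hφ
  rw [add_comm 1 k] at h1
  simp_rw [pow_one, h.integral_kernel γ _ hφ.1] at h1
  exact h1

/-- A one-step bound in expectation propagates to the laws of the iterates. -/
lemma integral_pow_succ_le (h : IsStochasticOracle F ξ L ρ V₂ V₄) (γ : ℝ) (k : ℕ)
    (x : Space n) {φ ψ : Space n → ℝ} (hφ : QuarticGrowth φ)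
    (hψ : Integrable ψ ((sgdKernel F ξ γ ^ k) x))
    (hle : ∀ y, ∫ z, φ (sgdStep F ξ γ y z) ∂(stdGaussian (Space n)) ≤ ψ y) :
    ∫ y, φ y ∂((sgdKernel F ξ γ ^ (k + 1)) x) ≤ ∫ y, ψ y ∂((sgdKernel F ξ γ ^ k) x) := by
  obtain ⟨hi, he⟩ := h.integral_pow_succ γ k x hφ
  rw [he]
  exact integral_mono hi hψ hle

lemma le_integral_pow_succ (h : IsStochasticOracle F ξ L ρ V₂ V₄) (γ : ℝ) (k : ℕ)
    (x : Space n) {φ ψ : Space n → ℝ} (hφ : QuarticGrowth φ)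
    (hψ : Integrable ψ ((sgdKernel F ξ γ ^ k) x))
    (hle : ∀ y, ψ y ≤ ∫ z, φ (sgdStep F ξ γ y z) ∂(stdGaussian (Space n))) :
    ∫ y, ψ y ∂((sgdKernel F ξ γ ^ k) x) ≤ ∫ y, φ y ∂((sgdKernel F ξ γ ^ (k + 1)) x) := by
  obtain ⟨hi, he⟩ := h.integral_pow_succ γ k x hφ
  rw [he]
  exact integral_mono hψ hi hle

/-! ### Estimates over many steps -/

/-- The expected squared gradient norms along the trajectory are controlled by the decrease of the
objective. -/
lemma integral_objective_add_sum_le (h : IsStochasticOracle F ξ L ρ V₂ V₄) {γ : ℝ} (hγ : 0 ≤ γ)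
    (hγL : γ * L ≤ 1 / 2) (x : Space n) (k : ℕ) :
    ∫ y, F y ∂((sgdKernel F ξ γ ^ k) x)
        + γ / 2 * ∑ j ∈ Finset.range k, ∫ y, ‖gradient F y‖ ^ 2 ∂((sgdKernel F ξ γ ^ j) x)
      ≤ F x + γ ^ 2 * (L * V₂) * k := by
  have := h.isMarkovKernel γ
  induction k with
  | zero => rw [integral_pow_zero]; simp
  | succ k ih =>
    have hF := h.integrable_pow γ k x h.quarticGrowth_objective
    have hG := (h.integrable_pow γ k x h.quarticGrowth_norm_gradient_sq).const_mul (γ / 2)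
    have h1 := h.integral_pow_succ_le γ k x h.quarticGrowth_objective
      ((hF.sub hG).add (integrable_const (γ ^ 2 * (L * V₂))))
      fun y => (h.integral_objective_step_le hγ hγL y).2
    simp only [Pi.add_apply, Pi.sub_apply] at h1
    rw [integral_add (by exact hF.sub hG) (integrable_const _), integral_sub hF hG,
      integral_const_mul, integral_const, probReal_univ, one_smul] at h1
    rw [Finset.sum_range_succ]
    push_cast
    linarith

lemma integral_objective_le (h : IsStochasticOracle F ξ L ρ V₂ V₄) {γ : ℝ} (hγ : 0 ≤ γ)
    (hγL : γ * L ≤ 1 / 2) (x : Space n) (k : ℕ) :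
    ∫ y, F y ∂((sgdKernel F ξ γ ^ k) x) ≤ F x + γ ^ 2 * (L * V₂) * k := by
  have h1 := h.integral_objective_add_sum_le hγ hγL x k
  have h2 : 0 ≤ γ / 2 * ∑ j ∈ Finset.range k,
      ∫ y, ‖gradient F y‖ ^ 2 ∂((sgdKernel F ξ γ ^ j) x) :=
    mul_nonneg (by linarith) (Finset.sum_nonneg fun j _ => integral_nonneg fun _ => by positivity)
  linarith

/-- Localisation: the expected squared displacement is controlled by the expected squared gradient
norms. -/
lemma integral_dist_sq_le (h : IsStochasticOracle F ξ L ρ V₂ V₄) {γ θ : ℝ} (hγ : 0 ≤ γ)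
    (hθ : 0 < θ) (x : Space n) (k : ℕ) :
    ∫ y, ‖y - x‖ ^ 2 ∂((sgdKernel F ξ γ ^ k) x)
      ≤ (1 + γ * θ) ^ k * ((γ / θ + γ ^ 2) *
        ∑ j ∈ Finset.range k, ∫ y, ‖gradient F y‖ ^ 2 ∂((sgdKernel F ξ γ ^ j) x)
          + γ ^ 2 * V₂ * k) := by
  have := h.isMarkovKernel γ
  induction k with
  | zero => rw [integral_pow_zero]; simp
  | succ k ih =>
    have hD := (h.integrable_pow γ k x (quarticGrowth_norm_sub_sq x)).const_mul (1 + γ * θ)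
    have hG := (h.integrable_pow γ k x h.quarticGrowth_norm_gradient_sq).const_mul
      (γ / θ + γ ^ 2)
    have h1 := h.integral_pow_succ_le γ k x (quarticGrowth_norm_sub_sq x)
      ((hD.add hG).add (integrable_const (γ ^ 2 * V₂)))
      fun y => h.integral_dist_sq_step_le γ hθ hγ x y
    simp only [Pi.add_apply] at h1
    rw [integral_add (by exact hD.add hG) (integrable_const _), integral_add hD hG,
      integral_const_mul, integral_const_mul, integral_const, probReal_univ, one_smul] at h1
    have hV := h.second_nonneg
    have hq : 1 ≤ 1 + γ * θ := by have := mul_nonneg hγ hθ.le; linarith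
    have hqk : 1 ≤ (1 + γ * θ) ^ (k + 1) := one_le_pow₀ hq
    set S := ∑ j ∈ Finset.range k, ∫ y, ‖gradient F y‖ ^ 2 ∂((sgdKernel F ξ γ ^ j) x)
    set G := ∫ y, ‖gradient F y‖ ^ 2 ∂((sgdKernel F ξ γ ^ k) x)
    have hG0 : 0 ≤ (γ / θ + γ ^ 2) * G + γ ^ 2 * V₂ := by
      have : 0 ≤ G := integral_nonneg fun _ => by positivity
      positivity
    have h2 := mul_le_mul_of_nonneg_left ih (by linarith : 0 ≤ 1 + γ * θ)
    have h3 := mul_le_mul_of_nonneg_right hqk hG0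
    rw [Finset.sum_range_succ]
    push_cast
    calc _ ≤ (1 + γ * θ) * ((1 + γ * θ) ^ k * ((γ / θ + γ ^ 2) * S + γ ^ 2 * V₂ * k))
          + (1 + γ * θ) ^ (k + 1) * ((γ / θ + γ ^ 2) * G + γ ^ 2 * V₂) := by linarith
      _ = _ := by ring

/-- A crude bound on the fourth moment of the displacement: over `O(1/γ)` steps it is `O(γ²)`. -/
lemma integral_dist_pow_four_le (h : IsStochasticOracle F ξ L ρ V₂ V₄) {γ B : ℝ} (hγ : 0 ≤ γ)
    (hγ1 : γ ≤ 1) (x : Space n) (hx : ‖gradient F x‖ ^ 2 ≤ B * γ) (k : ℕ) :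
    ∫ y, ‖y - x‖ ^ 4 ∂((sgdKernel F ξ γ ^ k) x)
      ≤ ((1 + γ) ^ 7 * (1 + γ * L) ^ 4) ^ k
        * (γ ^ 3 * (40 * B ^ 2 + 4 * V₂ ^ 2 + 3 * V₄) * k) := by
  have := h.isMarkovKernel γ
  set q := (1 + γ) ^ 7 * (1 + γ * L) ^ 4
  set K := γ ^ 3 * (40 * B ^ 2 + 4 * V₂ ^ 2 + 3 * V₄)
  have hV4 := h.fourth_nonneg
  have hK : 0 ≤ K := by positivity
  have hq : 1 ≤ q := by
    have hL : (0 : ℝ) ≤ L := L.2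
    exact one_le_mul_of_one_le_of_one_le (one_le_pow₀ (by linarith))
      (one_le_pow₀ (by nlinarith))
  induction k with
  | zero => rw [integral_pow_zero]; simp
  | succ k ih =>
    have hD := (h.integrable_pow γ k x (quarticGrowth_norm_sub_pow_four x)).const_mul q
    have h1 := h.integral_pow_succ_le γ k x (quarticGrowth_norm_sub_pow_four x)
      (hD.add (integrable_const K))
      fun y => h.integral_dist_pow_four_step_le hγ hγ1 x y hx
    simp only [Pi.add_apply] at h1
    rw [integral_add hD (integrable_const _), integral_const_mul, integral_const, probReal_univ,
      one_smul] at h1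
    have h2 := mul_le_mul_of_nonneg_left ih (by linarith : 0 ≤ q)
    have h3 := mul_le_mul_of_nonneg_right (one_le_pow₀ hq : 1 ≤ q ^ (k + 1)) hK
    push_cast
    calc _ ≤ q * (q ^ k * (K * k)) + q ^ (k + 1) * K := by linarith
      _ = _ := by ring

/-- Instability: the expected square of the unstable coordinate grows exponentially, as long as
the fourth moments of the displacement remain small. -/
lemma le_integral_unstableCoord_sq (h : IsStochasticOracle F ξ L ρ V₂ V₄) {γ κ c₀ C₀ K₄ : ℝ}
    (hγ : 0 < γ) (hκ : 0 < κ) (hγκ : γ * κ ≤ 1) {x v : Space n} {lam : ℝ}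
    (hlam : κ ≤ lam) (hv : ‖v‖ = 1) (hHv : hessian F x v = -lam • v)
    (hC₀ : 0 ≤ C₀) (hnoise : ∀ y, c₀ - C₀ * ‖y - x‖ ^ 4
      ≤ ∫ z, (inner ℝ v (ξ y z)) ^ 2 ∂(stdGaussian (Space n))) {T : ℕ}
    (h4 : ∀ k < T, ∫ y, ‖y - x‖ ^ 4 ∂((sgdKernel F ξ γ ^ k) x) ≤ K₄)
    (hsmall : (2 * γ * ρ ^ 2 / κ + γ ^ 2 * C₀) * K₄ ≤ γ ^ 2 * (c₀ / 2)) :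
    ∀ k ≤ T, γ * (c₀ / 2) * ((1 + γ * κ) ^ k - 1)
      ≤ κ * ∫ y, unstableCoord F x v lam y ^ 2 ∂((sgdKernel F ξ γ ^ k) x) := by
  have := h.isMarkovKernel γ
  intro k hk
  induction k with
  | zero => simp only [pow_zero, sub_self, mul_zero]; positivity
  | succ k ih =>
    have ih := ih (by omega)
    have hW := (h.integrable_pow γ k x
      (quarticGrowth_unstableCoord_sq (F := F) x v lam)).const_mul (1 + γ * κ)
    have hD := (h.integrable_pow γ k x (quarticGrowth_norm_sub_pow_four x)).const_mul
      (2 * γ * ρ ^ 2 / κ + γ ^ 2 * C₀)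
    have h1 := h.le_integral_pow_succ γ k x (quarticGrowth_unstableCoord_sq (F := F) x v lam)
      ((hW.sub hD).add (integrable_const (γ ^ 2 * c₀))) fun y => by
        refine le_trans ?_ (h.le_integral_unstableCoord_sq_step hγ hκ hγκ hlam hv hHv y)
        have := mul_le_mul_of_nonneg_left (hnoise y) (sq_nonneg γ)
        simp only [Pi.add_apply, Pi.sub_apply]
        linarith
    simp only [Pi.add_apply, Pi.sub_apply] at h1
    rw [integral_add (by exact hW.sub hD) (integrable_const _), integral_sub hW hD,
      integral_const_mul, integral_const_mul, integral_const, probReal_univ, one_smul] at h1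
    have h2 := mul_le_mul_of_nonneg_left (h4 k (by omega))
      (by positivity : 0 ≤ 2 * γ * ρ ^ 2 / κ + γ ^ 2 * C₀)
    set W := ∫ y, unstableCoord F x v lam y ^ 2 ∂((sgdKernel F ξ γ ^ k) x)
    have h3 : (1 + γ * κ) * W + γ ^ 2 * (c₀ / 2)
        ≤ ∫ y, unstableCoord F x v lam y ^ 2 ∂((sgdKernel F ξ γ ^ (k + 1)) x) := by linarith
    have h5 := mul_le_mul_of_nonneg_left h3 hκ.le
    have h6 := mul_le_mul_of_nonneg_left ih (by positivity : 0 ≤ 1 + γ * κ)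
    calc γ * (c₀ / 2) * ((1 + γ * κ) ^ (k + 1) - 1)
        = (1 + γ * κ) * (γ * (c₀ / 2) * ((1 + γ * κ) ^ k - 1)) + κ * (γ ^ 2 * (c₀ / 2)) := by ring
      _ ≤ (1 + γ * κ) * (κ * W) + κ * (γ ^ 2 * (c₀ / 2)) := by linarith
      _ = κ * ((1 + γ * κ) * W + γ ^ 2 * (c₀ / 2)) := by ring
      _ ≤ _ := h5

lemma unstableCoord_sq_le {x v : Space n} {κ lam B γ : ℝ} (hκ : 0 < κ) (hlam : κ ≤ lam)
    (hv : ‖v‖ = 1) (hx : ‖gradient F x‖ ^ 2 ≤ B * γ) (y : Space n) :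
    unstableCoord F x v lam y ^ 2 ≤ 2 * ‖y - x‖ ^ 2 + 2 * (B * γ) / κ ^ 2 := by
  have hlam0 : 0 < lam := hκ.trans_le hlam
  have h1 : (inner ℝ v (y - x)) ^ 2 ≤ ‖y - x‖ ^ 2 := by
    rw [← sq_abs]
    have := abs_real_inner_le_norm v (y - x)
    rw [hv, one_mul] at this
    gcongr
  have h2 : (inner ℝ v (gradient F x) / lam) ^ 2 ≤ B * γ / κ ^ 2 := by
    have h3 : (inner ℝ v (gradient F x)) ^ 2 ≤ B * γ := by
      rw [← sq_abs]
      have := abs_real_inner_le_norm v (gradient F x)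
      rw [hv, one_mul] at this
      refine le_trans ?_ hx
      gcongr
    rw [div_pow]
    gcongr
    exact (sq_nonneg _).trans hx
  have h3 := sq_nonneg (inner ℝ v (y - x) + inner ℝ v (gradient F x) / lam)
  have h4 : 2 * (B * γ) / κ ^ 2 = 2 * (B * γ / κ ^ 2) := by ring
  rw [unstableCoord, h4]
  nlinarith

end IsStochasticOracle

end SGPnP

/-! ### Escape from strict saddles -/

namespace SGPnP

variable {n : ℕ}

lemma isOpen_setOf_exists_inner_hessian_lt {F : Space n → ℝ} (hF : Continuous (hessian F))
    (κ : ℝ) : IsOpen {x | ∃ u, inner ℝ (hessian F x u) u < -κ * ‖u‖ ^ 2} := by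
  have : {x | ∃ u, inner ℝ (hessian F x u) u < -κ * ‖u‖ ^ 2}
      = ⋃ u, {x | inner ℝ (hessian F x u) u < -κ * ‖u‖ ^ 2} := by ext x; simp
  rw [this]
  exact isOpen_iUnion fun u => isOpen_lt (by fun_prop) (by fun_prop)

namespace IsStochasticOracle

variable {F : Space n → ℝ} {ξ : Space n → Space n → Space n} {L ρ : ℝ≥0} {V₂ V₄ : ℝ}

lemma pow_mul_pow_pow_le {γ L : ℝ} (hγ : 0 ≤ γ) (hL : 0 ≤ L) {k : ℕ} {C : ℝ}
    (hk : γ * k ≤ C) :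
    ((1 + γ) ^ 7 * (1 + γ * L) ^ 4) ^ k ≤ Real.exp (C * (7 + 4 * L)) := by
  have h1 : (1 + γ) ^ 7 * (1 + γ * L) ^ 4 ≤ Real.exp (γ * (7 + 4 * L)) := by
    have e1 : 1 + γ ≤ Real.exp γ := by linarith [Real.add_one_le_exp γ]
    have e2 : 1 + γ * L ≤ Real.exp (γ * L) := by linarith [Real.add_one_le_exp (γ * L)]
    calc (1 + γ) ^ 7 * (1 + γ * L) ^ 4 ≤ Real.exp γ ^ 7 * Real.exp (γ * L) ^ 4 := by gcongr
      _ = Real.exp (γ * (7 + 4 * L)) := by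
          rw [← Real.exp_nat_mul, ← Real.exp_nat_mul, ← Real.exp_add]
          congr 1; push_cast; ring
  calc ((1 + γ) ^ 7 * (1 + γ * L) ^ 4) ^ k ≤ Real.exp (γ * (7 + 4 * L)) ^ k := by gcongr
    _ = Real.exp ((γ * k) * (7 + 4 * L)) := by
        rw [← Real.exp_nat_mul]; congr 1; ring
    _ ≤ _ := by gcongr

/-- Localisation: if the objective decreases by at most `γ Q C` over the time horizon `γ T = C`,
then the iterates have not moved far. -/
lemma integral_dist_sq_le_of_le_objective (h : IsStochasticOracle F ξ L ρ V₂ V₄)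
    {Q C γ : ℝ} {T : ℕ} (hC : 0 < C) (hγ : 0 < γ) (hγT : γ * T = C) (hγC : γ ≤ C)
    (hγL : γ * L ≤ 1 / 2) {x : Space n}
    (hcon : F x - γ * Q * C ≤ ∫ y, F y ∂((sgdKernel F ξ γ ^ T) x)) :
    ∫ y, ‖y - x‖ ^ 2 ∂((sgdKernel F ξ γ ^ T) x)
      ≤ γ * (3 * C * (4 * C * (Q + L * V₂) + V₂)) := by
  have hV2 := h.second_nonneg
  have h1 := h.integral_objective_add_sum_le hγ.le hγL x T
  have hmain := h.integral_dist_sq_le hγ.le (inv_pos.2 hC) x T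
  have hS0 : 0 ≤ ∑ j ∈ Finset.range T, ∫ y, ‖gradient F y‖ ^ 2 ∂((sgdKernel F ξ γ ^ j) x) :=
    Finset.sum_nonneg fun j _ => integral_nonneg fun _ => by positivity
  generalize ∑ j ∈ Finset.range T, ∫ y, ‖gradient F y‖ ^ 2 ∂((sgdKernel F ξ γ ^ j) x) = S at *
  have hS : γ / 2 * S ≤ γ * (C * (Q + L * V₂)) := by
    have h2 : γ ^ 2 * (L * V₂) * T = γ * (L * V₂) * (γ * T) := by ring
    rw [h2, hγT] at h1
    linarith
  refine hmain.trans ?_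
  have h1 : (1 + γ * C⁻¹) ^ T ≤ 3 := by
    calc (1 + γ * C⁻¹) ^ T ≤ Real.exp (γ * C⁻¹) ^ T := by
          gcongr
          linarith [Real.add_one_le_exp (γ * C⁻¹)]
      _ = Real.exp 1 := by
          rw [← Real.exp_nat_mul]
          congr 1
          rw [← mul_assoc, mul_comm (T : ℝ), hγT, mul_inv_cancel₀ hC.ne']
      _ ≤ 3 := by linarith [Real.exp_one_lt_d9]
  have h2 : (γ / C⁻¹ + γ ^ 2) * S + γ ^ 2 * V₂ * T
      ≤ γ * (C * (4 * C * (Q + L * V₂) + V₂)) := by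
    have e1 : γ / C⁻¹ + γ ^ 2 ≤ 2 * C * γ := by
      rw [div_inv_eq_mul]
      linarith [mul_le_mul_of_nonneg_left hγC hγ.le]
    have e2 : γ ^ 2 * V₂ * T = γ * (C * V₂) := by rw [← hγT]; ring
    have e3 := mul_le_mul_of_nonneg_right e1 hS0
    have e4 := mul_le_mul_of_nonneg_left hS (by positivity : 0 ≤ 4 * C)
    rw [e2]
    linarith
  have h3 : 0 ≤ (γ / C⁻¹ + γ ^ 2) * S + γ ^ 2 * V₂ * T := by positivity
  calc _ ≤ 3 * ((γ / C⁻¹ + γ ^ 2) * S + γ ^ 2 * V₂ * T) := mul_le_mul_of_nonneg_right h1 h3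
    _ ≤ 3 * (γ * (C * (4 * C * (Q + L * V₂) + V₂))) := mul_le_mul_of_nonneg_left h2 (by norm_num)
    _ = _ := by ring

/-- Escape from a strict saddle over a time horizon `γ T = C`, given that exponential growth at
rate `κ` over this horizon beats the quadratic bound on the displacement. -/
lemma integral_objective_le_of_saddle (h : IsStochasticOracle F ξ L ρ V₂ V₄)
    {c₀ C₀ κ Q B C γ : ℝ} {T : ℕ} (hκ : 0 < κ) (hC₀ : 0 ≤ C₀) (hC : 0 < C)
    (hγ : 0 < γ) (hγT : γ * T = C) (hγ1 : γ ≤ 1) (hγC : γ ≤ C) (hγκ : γ * κ ≤ 1)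
    (hγL : γ * L ≤ 1 / 2)
    (hsmall : (2 * γ * ρ ^ 2 / κ + γ ^ 2 * C₀) * (Real.exp (C * (7 + 4 * L)) *
      (γ ^ 2 * (40 * B ^ 2 + 4 * V₂ ^ 2 + 3 * V₄) * C)) ≤ γ ^ 2 * (c₀ / 2))
    (hbig : κ * (6 * C * (4 * C * (Q + L * V₂) + V₂) + 2 * B / κ ^ 2)
      < c₀ / 2 * ((1 + γ * κ) ^ T - 1))
    {x v : Space n} {lam : ℝ} (hlam : κ ≤ lam) (hv : ‖v‖ = 1) (hHv : hessian F x v = -lam • v)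
    (hx : ‖gradient F x‖ ^ 2 ≤ B * γ)
    (hnoise : ∀ y, c₀ - C₀ * ‖y - x‖ ^ 4
      ≤ ∫ z, (inner ℝ v (ξ y z)) ^ 2 ∂(stdGaussian (Space n))) :
    ∫ y, F y ∂((sgdKernel F ξ γ ^ T) x) ≤ F x - γ * Q * C := by
  have := h.isMarkovKernel γ
  by_contra! hcon
  have hV2 := h.second_nonneg
  have hV4 := h.fourth_nonneg
  have hL : (0 : ℝ) ≤ L := L.2
  -- instability
  have h4 : ∀ k < T, ∫ y, ‖y - x‖ ^ 4 ∂((sgdKernel F ξ γ ^ k) x)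
      ≤ Real.exp (C * (7 + 4 * L)) * (γ ^ 2 * (40 * B ^ 2 + 4 * V₂ ^ 2 + 3 * V₄) * C) := by
    intro k hk
    have hkC : γ * k ≤ C := by
      rw [← hγT]
      gcongr
    refine (h.integral_dist_pow_four_le hγ.le hγ1 x hx k).trans ?_
    have e : γ ^ 3 * (40 * B ^ 2 + 4 * V₂ ^ 2 + 3 * V₄) * k
        = γ ^ 2 * (40 * B ^ 2 + 4 * V₂ ^ 2 + 3 * V₄) * (γ * k) := by ring
    rw [e]
    have := pow_mul_pow_pow_le hγ.le hL hkC
    gcongr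
  have hgrow := h.le_integral_unstableCoord_sq hγ hκ hγκ hlam hv hHv hC₀ hnoise h4 hsmall T le_rfl
  have hdist := h.integral_dist_sq_le_of_le_objective hC hγ hγT hγC hγL hcon.le
  -- the two bounds on the unstable coordinate contradict each other
  have hcoord : ∫ y, unstableCoord F x v lam y ^ 2 ∂((sgdKernel F ξ γ ^ T) x)
      ≤ γ * (6 * C * (4 * C * (Q + L * V₂) + V₂) + 2 * B / κ ^ 2) := by
    have hD := (h.integrable_pow γ T x (quarticGrowth_norm_sub_sq x)).const_mul 2
    have h1 := integral_mono (h.integrable_pow γ T x (quarticGrowth_unstableCoord_sq x v lam))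
      (hD.add (integrable_const (2 * (B * γ) / κ ^ 2)))
      fun y => unstableCoord_sq_le (F := F) hκ hlam hv hx y
    simp only [Pi.add_apply] at h1
    rw [integral_add hD (integrable_const _), integral_const_mul, integral_const, probReal_univ,
      one_smul] at h1
    have e : 2 * (B * γ) / κ ^ 2 = γ * (2 * B / κ ^ 2) := by ring
    rw [e] at h1
    linarith
  have h1 := mul_le_mul_of_nonneg_left hcoord hκ.le
  have h2 := mul_lt_mul_of_pos_left hbig hγ
  nlinarith

open Filter Topology in
/-- Escape from strict saddles: for a suitable time horizon `C` and all small step sizes `C / T`,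
the expected objective drops by `γ Q C` within `T` steps, from every point with
`‖∇F‖² ≤ B γ` at which the Hessian has an eigenvalue at most `-κ` with noise along the
eigenvector. -/
theorem exists_forall_eventually_escape (h : IsStochasticOracle F ξ L ρ V₂ V₄)
    {c₀ C₀ κ : ℝ} (hκ : 0 < κ) (hc₀ : 0 < c₀) (hC₀ : 0 ≤ C₀) (Q B : ℝ) :
    ∃ C : ℝ, 0 < C ∧ ∀ᶠ T : ℕ in atTop, ∀ (x v : Space n) (lam : ℝ), κ ≤ lam → ‖v‖ = 1 →
      hessian F x v = -lam • v → ‖gradient F x‖ ^ 2 ≤ B * (C / T) →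
      (∀ y, c₀ - C₀ * ‖y - x‖ ^ 4
        ≤ ∫ z, (inner ℝ v (ξ y z)) ^ 2 ∂(stdGaussian (Space n))) →
      ∫ y, F y ∂((sgdKernel F ξ (C / T) ^ T) x) ≤ F x - C / T * Q * C := by
  -- the horizon: exponential growth in `C` beats quadratic growth
  obtain ⟨C, hC, hbig⟩ : ∃ C : ℝ, 0 < C ∧
      κ * (6 * C * (4 * C * (Q + L * V₂) + V₂) + 2 * B / κ ^ 2)
        < c₀ / 2 * (Real.exp (κ * C) - 1) := by
    have hexp : ∀ m : ℕ, Tendsto (fun C : ℝ => C ^ m * Real.exp (-(κ * C))) atTop (𝓝 0) := by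
      intro m
      have h1 := tendsto_rpow_mul_exp_neg_mul_atTop_nhds_zero m κ hκ
      simpa [neg_mul] using h1
    have h1 : Tendsto (fun C : ℝ =>
        (κ * 24 * (Q + L * V₂)) * (C ^ 2 * Real.exp (-(κ * C)))
          + (κ * 6 * V₂) * (C ^ 1 * Real.exp (-(κ * C)))
          + (κ * (2 * B / κ ^ 2) + c₀ / 2) * (C ^ 0 * Real.exp (-(κ * C)))) atTop
        (𝓝 ((κ * 24 * (Q + L * V₂)) * 0 + (κ * 6 * V₂) * 0
          + (κ * (2 * B / κ ^ 2) + c₀ / 2) * 0)) :=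
      (((hexp 2).const_mul _).add ((hexp 1).const_mul _)).add ((hexp 0).const_mul _)
    have h2 : (κ * 24 * (Q + L * V₂)) * 0 + (κ * 6 * V₂) * 0
          + (κ * (2 * B / κ ^ 2) + c₀ / 2) * 0 < c₀ / 2 := by linarith
    obtain ⟨C, hlt, hpos⟩ := ((h1.eventually_lt_const h2).and (eventually_gt_atTop 0)).exists
    refine ⟨C, hpos, ?_⟩
    have h3 := mul_lt_mul_of_pos_right hlt (Real.exp_pos (κ * C))
    have h4 : Real.exp (-(κ * C)) * Real.exp (κ * C) = 1 := by
      rw [← Real.exp_add]; simp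
    have h5 : ((κ * 24 * (Q + L * V₂)) * (C ^ 2 * Real.exp (-(κ * C)))
          + (κ * 6 * V₂) * (C ^ 1 * Real.exp (-(κ * C)))
          + (κ * (2 * B / κ ^ 2) + c₀ / 2) * (C ^ 0 * Real.exp (-(κ * C)))) * Real.exp (κ * C)
        = ((κ * 24 * (Q + L * V₂)) * C ^ 2 + (κ * 6 * V₂) * C
          + (κ * (2 * B / κ ^ 2) + c₀ / 2)) * (Real.exp (-(κ * C)) * Real.exp (κ * C)) := by ring
    rw [h5, h4, mul_one] at h3
    linarith
  refine ⟨C, hC, ?_⟩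
  have hγ0 : Tendsto (fun T : ℕ => C / T) atTop (𝓝 0) := tendsto_const_div_atTop_nhds_zero_nat C
  have hpow : Tendsto (fun T : ℕ => c₀ / 2 * ((1 + C / T * κ) ^ T - 1)) atTop
      (𝓝 (c₀ / 2 * (Real.exp (κ * C) - 1))) := by
    have h1 := Real.tendsto_one_add_div_pow_exp (κ * C)
    have h2 : ∀ T : ℕ, (1 + C / T * κ) ^ T = (1 + κ * C / T) ^ T := fun T => by
      congr 2; ring
    simp_rw [h2]
    exact (h1.sub_const 1).const_mul _
  set K := Real.exp (C * (7 + 4 * L)) * ((40 * B ^ 2 + 4 * V₂ ^ 2 + 3 * V₄) * C) with hK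
  have hs : Tendsto (fun T : ℕ => (2 * (C / T) * ρ ^ 2 / κ + (C / T) ^ 2 * C₀) * K) atTop
      (𝓝 ((2 * 0 * ρ ^ 2 / κ + 0 ^ 2 * C₀) * K)) :=
    (((((hγ0.const_mul 2).mul_const _).div_const κ).add ((hγ0.pow 2).mul_const C₀)).mul_const K)
  have hs' : (2 * 0 * (ρ : ℝ) ^ 2 / κ + 0 ^ 2 * C₀) * K < c₀ / 2 := by
    have : (2 * 0 * (ρ : ℝ) ^ 2 / κ + 0 ^ 2 * C₀) * K = 0 := by ring
    rw [this]; positivity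
  have hl : Tendsto (fun T : ℕ => C / T * L) atTop (𝓝 (0 * L)) := hγ0.mul_const _
  have hk : Tendsto (fun T : ℕ => C / T * κ) atTop (𝓝 (0 * κ)) := hγ0.mul_const _
  filter_upwards [eventually_gt_atTop 0, hγ0.eventually_le_const one_pos,
    hγ0.eventually_le_const hC, hpow.eventually_const_lt hbig, hs.eventually_lt_const hs',
    hl.eventually_le_const (by norm_num : 0 * (L : ℝ) < 1 / 2),
    hk.eventually_le_const (by norm_num : 0 * κ < 1)]
    with T hT hT1 hTC hTbig hTs hTL hTκ x v lam hlam hv hHv hx hnoise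
  have hT0 : (0 : ℝ) < T := by exact_mod_cast hT
  have hγ : 0 < C / T := by positivity
  refine h.integral_objective_le_of_saddle hκ hC₀ hC hγ (by field_simp) hT1 hTC hTκ hTL ?_ hTbig
    hlam hv hHv hx hnoise
  calc _ = (C / T) ^ 2 * ((2 * (C / T) * ρ ^ 2 / κ + (C / T) ^ 2 * C₀) * K) := by rw [hK]; ring
    _ ≤ _ := by gcongr

/-! ### Averaging over time -/

lemma sum_range_sub_add (e : ℕ → ℝ) (N T : ℕ) :
    ∑ k ∈ Finset.range N, (e k - e (k + T))
      = ∑ j ∈ Finset.range T, (e j - e (N + j)) := by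
  induction N with
  | zero => simp
  | succ N ih =>
    rw [Finset.sum_range_succ, ih]
    have h1 : ∑ j ∈ Finset.range T, (e (N + j) - e (N + (j + 1))) = e N - e (N + T) := by
      simpa using Finset.sum_range_sub' (fun j => e (N + j)) T
    rw [← h1, ← Finset.sum_add_distrib]
    refine Finset.sum_congr rfl fun j _ => ?_
    rw [show N + 1 + j = N + (j + 1) by omega]
    ring

open Filter Topology in
/-- At some deterministic time, the iterate of constant-step stochastic gradient descent is a
second-order stationary point with high probability. The expected objective decreases by order
`γ²` per step at points with large gradient and near strict saddles, and increases by at most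
`L V₂ γ²` elsewhere; since it is bounded below, the former happens for a small fraction of the
first `N` times. -/
theorem exists_measure_not_stationary_le (h : IsStochasticOracle F ξ L ρ V₂ V₄)
    {m : ℝ} (hm : ∀ x, m ≤ F x) {c₀ C₀ κ : ℝ} (hκ : 0 < κ) (hc₀ : 0 < c₀) (hC₀ : 0 ≤ C₀)
    (hsaddle : ∀ x, (∃ u, inner ℝ (hessian F x u) u < -κ * ‖u‖ ^ 2) → ∃ (v : Space n) (lam : ℝ),
      κ ≤ lam ∧ ‖v‖ = 1 ∧ hessian F x v = -lam • v ∧ ∀ y, c₀ - C₀ * ‖y - x‖ ^ 4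
        ≤ ∫ z, (inner ℝ v (ξ y z)) ^ 2 ∂(stdGaussian (Space n)))
    (x₀ : Space n) {η ε : ℝ} (hη : 0 < η) (hε : 0 < ε) :
    ∃ (γ : ℝ) (k : ℕ), 0 < γ ∧ ((sgdKernel F ξ γ ^ k) x₀).real
      {x | ε < ‖gradient F x‖ ∨ ∃ u, inner ℝ (hessian F x u) u < -κ * ‖u‖ ^ 2} ≤ η := by
  have hV2 := h.second_nonneg
  have hL : (0 : ℝ) ≤ L := L.2
  -- `B` and `Q` are large multiples of `A`, the rate at which the noise can increase the objective;
  -- the summand `1` makes `A` positive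
  obtain ⟨A, hA⟩ : ∃ A : ℝ, A = L * V₂ + 1 := ⟨_, rfl⟩
  have hApos : 0 < A := by rw [hA]; positivity
  obtain ⟨B, hB⟩ : ∃ B : ℝ, B = 8 * A / η := ⟨_, rfl⟩
  have hBpos : 0 < B := by rw [hB]; positivity
  obtain ⟨Q, hQ⟩ : ∃ Q : ℝ, Q = 4 * A / η := ⟨_, rfl⟩
  have hQpos : 0 < Q := by rw [hQ]; positivity
  obtain ⟨C, hC, hev⟩ := h.exists_forall_eventually_escape hκ hc₀ hC₀ Q B
  have hγ0 : Tendsto (fun T : ℕ => C / T) atTop (𝓝 0) := tendsto_const_div_atTop_nhds_zero_nat C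
  have hl : Tendsto (fun T : ℕ => C / T * L) atTop (𝓝 (0 * L)) := hγ0.mul_const _
  have hb : Tendsto (fun T : ℕ => B * (C / T)) atTop (𝓝 (B * 0)) := hγ0.const_mul _
  obtain ⟨T, hT, hTB, hTL, hesc⟩ := ((eventually_gt_atTop 0).and
    ((hb.eventually_le_const (by rw [mul_zero]; positivity : B * 0 < ε ^ 2)).and
    ((hl.eventually_le_const (by norm_num : 0 * (L : ℝ) < 1 / 2)).and hev))).exists
  have hT0 : (0 : ℝ) < T := by exact_mod_cast hT
  obtain ⟨γ, hγdef⟩ : ∃ γ : ℝ, γ = C / T := ⟨_, rfl⟩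
  rw [← hγdef] at hTB hTL hesc
  have hγ : 0 < γ := by rw [hγdef]; positivity
  have hγT : γ * T = C := by rw [hγdef]; field_simp
  have := h.isMarkovKernel γ
  set ν : ℕ → Measure (Space n) := fun k => (sgdKernel F ξ γ ^ k) x₀ with hν
  set M := F x₀ - m with hM
  have hM0 : 0 ≤ M := sub_nonneg.2 (hm x₀)
  set e : ℕ → ℝ := fun k => ∫ y, F y ∂(ν k) with he
  have hem : ∀ k, m ≤ e k := fun k => by
    have := integral_mono (integrable_const m) (h.integrable_pow γ k x₀ h.quarticGrowth_objective) hm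
    rwa [integral_const, probReal_univ, one_smul] at this
  have heu : ∀ (k : ℕ) x, ∫ y, F y ∂((sgdKernel F ξ γ ^ k) x) ≤ F x + γ ^ 2 * A * k := fun k x => by
    refine (h.integral_objective_le hγ.le hTL x k).trans ?_
    gcongr
    linarith
  -- the large-gradient set
  set 𝒢 : Set (Space n) := {x | B * γ ≤ ‖gradient F x‖ ^ 2} with h𝒢
  have hGc := h.smooth.continuous_gradient
  have hHc := h.smooth.continuous_hessian
  have hlarge : ∀ k, B * γ * (ν k).real 𝒢 ≤ ∫ y, ‖gradient F y‖ ^ 2 ∂(ν k) := fun k =>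
    mul_meas_ge_le_integral_of_nonneg (Eventually.of_forall fun y => by positivity)
      (h.integrable_pow γ k x₀ h.quarticGrowth_norm_gradient_sq) _
  have hsum1 : ∀ N : ℕ, γ / 2 * (B * γ * ∑ k ∈ Finset.range N, (ν k).real 𝒢)
      ≤ M + γ ^ 2 * A * N := by
    intro N
    have h1 := h.integral_objective_add_sum_le hγ.le hTL x₀ N
    have h2 : B * γ * ∑ k ∈ Finset.range N, (ν k).real 𝒢
        ≤ ∑ j ∈ Finset.range N, ∫ y, ‖gradient F y‖ ^ 2 ∂(ν j) := by
      rw [Finset.mul_sum]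
      exact Finset.sum_le_sum fun k _ => hlarge k
    have h3 := hem N
    have h4 : γ ^ 2 * (L * V₂) * N ≤ γ ^ 2 * A * N := by gcongr; linarith
    have h5 := mul_le_mul_of_nonneg_left h2 (by positivity : 0 ≤ γ / 2)
    simp only [he, hν] at h3
    linarith
  -- the set of approximate saddles
  set 𝒮 : Set (Space n) := {x | ‖gradient F x‖ ^ 2 < B * γ ∧
    ∃ u, inner ℝ (hessian F x u) u < -κ * ‖u‖ ^ 2} with h𝒮
  have h𝒮m : MeasurableSet 𝒮 := by
    exact MeasurableSet.inter (measurableSet_lt (hGc.norm.pow 2).measurable measurable_const)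
      (isOpen_setOf_exists_inner_hessian_lt hHc κ).measurableSet
  have hTstep : ∀ x, ∫ y, F y ∂((sgdKernel F ξ γ ^ T) x)
      ≤ F x + γ * A * C - 𝒮.indicator (fun _ => γ * C * (Q + A)) x := by
    intro x
    by_cases hx : x ∈ 𝒮
    · obtain ⟨v, lam, hlam, hv, hHv, hnoise⟩ := hsaddle x hx.2
      have := hesc x v lam hlam hv hHv hx.1.le hnoise
      rw [Set.indicator_of_mem hx]
      linarith
    · rw [Set.indicator_of_notMem hx, sub_zero]
      refine (heu T x).trans (le_of_eq ?_)
      rw [← hγT]; ring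
  have hrec : ∀ k, γ * C * (Q + A) * (ν k).real 𝒮 ≤ γ * A * C + (e k - e (k + T)) := by
    intro k
    obtain ⟨hi, heq⟩ := h.integral_pow_add γ T k x₀ h.quarticGrowth_objective
    have hF := h.integrable_pow γ k x₀ h.quarticGrowth_objective
    have hI : Integrable (𝒮.indicator fun _ => γ * C * (Q + A)) (ν k) :=
      (integrable_const _).indicator h𝒮m
    have hF' : Integrable (fun x => F x + γ * A * C) (ν k) := hF.add (integrable_const _)
    have h1 := integral_mono hi (hF'.sub hI) hTstep
    simp only [Pi.sub_apply] at h1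
    rw [← heq, integral_sub hF' hI, integral_add hF (integrable_const _), integral_const,
      probReal_univ, one_smul, integral_indicator_const _ h𝒮m, smul_eq_mul] at h1
    have h2 : e (k + T) = ∫ y, F y ∂((sgdKernel F ξ γ ^ (T + k)) x₀) := by
      simp only [he, hν, add_comm k T]
    rw [h2]
    simp only [he]
    linarith
  have hsum2 : ∀ N : ℕ, γ * C * (Q + A) * ∑ k ∈ Finset.range N, (ν k).real 𝒮
      ≤ N * (γ * A * C) + T * (M + γ * A * C) := by
    intro N
    have h1 : ∑ k ∈ Finset.range N, γ * C * (Q + A) * (ν k).real 𝒮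
        ≤ ∑ k ∈ Finset.range N, (γ * A * C + (e k - e (k + T))) :=
      Finset.sum_le_sum fun k _ => hrec k
    rw [← Finset.mul_sum, Finset.sum_add_distrib, sum_range_sub_add, Finset.sum_const,
      Finset.card_range, nsmul_eq_mul] at h1
    have h2 : ∑ j ∈ Finset.range T, (e j - e (N + j)) ≤ T * (M + γ * A * C) := by
      have h3 : ∀ j ∈ Finset.range T, e j - e (N + j) ≤ M + γ * A * C := by
        intro j hj
        have hj' : (j : ℝ) ≤ T := by exact_mod_cast (Finset.mem_range.1 hj).le
        have h4 := heu j x₀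
        have h5 : γ ^ 2 * A * j ≤ γ * A * C := by
          rw [← hγT]
          calc γ ^ 2 * A * j ≤ γ ^ 2 * A * T := by gcongr
            _ = _ := by ring
        have h6 := hem (N + j)
        have h7 : e j ≤ F x₀ + γ ^ 2 * A * j := h4
        linarith
      have := Finset.sum_le_sum h3
      rwa [Finset.sum_const, Finset.card_range, nsmul_eq_mul] at this
    linarith
  -- a large number of steps
  obtain ⟨N, hN⟩ := exists_nat_gt
    ((2 * M / (B * γ ^ 2) + T * (M + γ * A * C) / (γ * C * (Q + A))) / (η / 4))
  have hN0 : (0 : ℝ) < N := lt_of_le_of_lt (by positivity) hN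
  rw [div_lt_iff₀ (by positivity)] at hN
  have hP1 : ∑ k ∈ Finset.range N, (ν k).real 𝒢 ≤ 2 * M / (B * γ ^ 2) + η / 4 * N := by
    have h1 : (B * γ ^ 2 / 2) * ∑ k ∈ Finset.range N, (ν k).real 𝒢
        ≤ (B * γ ^ 2 / 2) * (2 * M / (B * γ ^ 2) + η / 4 * N) := by
      calc _ = γ / 2 * (B * γ * ∑ k ∈ Finset.range N, (ν k).real 𝒢) := by ring
        _ ≤ M + γ ^ 2 * A * N := hsum1 N
        _ = _ := by
          have : B * η = 8 * A := by rw [hB]; field_simp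
          have h2 : A = B * η / 8 := by linarith
          rw [h2]
          field_simp
          ring
    exact le_of_mul_le_mul_left h1 (by positivity)
  have hP2 : ∑ k ∈ Finset.range N, (ν k).real 𝒮
      ≤ T * (M + γ * A * C) / (γ * C * (Q + A)) + η / 4 * N := by
    have hQA : A ≤ η / 4 * (Q + A) := by
      have : η * Q = 4 * A := by rw [hQ]; field_simp
      nlinarith [mul_pos hη hApos]
    have h1 : (γ * C * (Q + A)) * ∑ k ∈ Finset.range N, (ν k).real 𝒮
        ≤ (γ * C * (Q + A)) * (T * (M + γ * A * C) / (γ * C * (Q + A)) + η / 4 * N) := by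
      calc _ ≤ N * (γ * A * C) + T * (M + γ * A * C) := hsum2 N
        _ ≤ N * (γ * (η / 4 * (Q + A)) * C) + T * (M + γ * A * C) := by gcongr
        _ = _ := by field_simp; ring
    exact le_of_mul_le_mul_left h1 (by positivity)
  have hNe : (Finset.range N).Nonempty := Finset.nonempty_range_iff.2 (by
    rintro rfl
    simp at hN0)
  obtain ⟨k, -, hk⟩ := Finset.exists_le_of_sum_le (s := Finset.range N)
    (f := fun k => (ν k).real 𝒢 + (ν k).real 𝒮) (g := fun _ => η) hNe (by
      rw [Finset.sum_add_distrib, Finset.sum_const, Finset.card_range, nsmul_eq_mul]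
      have : 0 < η * N := by positivity
      linarith)
  refine ⟨γ, k, hγ, le_trans ?_ hk⟩
  refine (measureReal_mono ?_ (measure_ne_top (ν k) _)).trans (measureReal_union_le 𝒢 𝒮)
  rintro x (hx | hx)
  · left
    have : ε ^ 2 ≤ ‖gradient F x‖ ^ 2 := by gcongr
    exact hTB.trans this
  · by_cases hg : B * γ ≤ ‖gradient F x‖ ^ 2
    · exact Or.inl hg
    · exact Or.inr ⟨not_le.1 hg, hx⟩

end IsStochasticOracle

end SGPnP

namespace SGPnP

variable {n : ℕ}

/-! ### Strict saddles and second-order stationarity -/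

namespace HasLipschitzDerivatives

variable {F G : Space n → ℝ} {L ρ L' ρ' : ℝ≥0}

lemma gradient_add (hF : HasLipschitzDerivatives F L ρ) (hG : HasLipschitzDerivatives G L' ρ')
    (x : Space n) : gradient (fun y => F y + G y) x = gradient F x + gradient G x := by
  refine HasGradientAt.gradient (hasGradientAt_iff_hasFDerivAt.2 ?_)
  refine ((hF.hasFDerivAt x).add (hG.hasFDerivAt x)).congr_fderiv ?_
  ext u
  simp

lemma hessian_add (hF : HasLipschitzDerivatives F L ρ) (hG : HasLipschitzDerivatives G L' ρ')
    (x : Space n) : hessian (fun y => F y + G y) x = hessian F x + hessian G x := by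
  have h : gradient (fun y => F y + G y) = fun x => gradient F x + gradient G x :=
    funext (hF.gradient_add hG)
  rw [hessian, h]
  exact ((hF.hasFDerivAt_gradient x).add (hG.hasFDerivAt_gradient x)).fderiv

lemma add (hF : HasLipschitzDerivatives F L ρ) (hG : HasLipschitzDerivatives G L' ρ') :
    HasLipschitzDerivatives (fun y => F y + G y) (L + L') (ρ + ρ') where
  differentiable := hF.differentiable.add hG.differentiable
  differentiable_gradient := by
    rw [funext (hF.gradient_add hG)]
    exact hF.differentiable_gradient.add hG.differentiable_gradient
  lipschitz_gradient := by
    rw [funext (hF.gradient_add hG)]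
    exact hF.lipschitz_gradient.add hG.lipschitz_gradient
  lipschitz_hessian := by
    rw [funext (hF.hessian_add hG)]
    exact hF.lipschitz_hessian.add hG.lipschitz_hessian

/-- The gradient vanishes identically on the set of critical points, so its derivative vanishes at
every density point of this set. -/
lemma volume_critical_hessian_ne_zero (hF : HasLipschitzDerivatives F L ρ) :
    volume {x | gradient F x = 0 ∧ hessian F x ≠ 0} = 0 := by
  have hZ : MeasurableSet {x | gradient F x = 0} :=
    (isClosed_eq hF.continuous_gradient continuous_const).measurableSet
  have happ : ApproximatesLinearOn (gradient F) (0 : Space n →L[ℝ] Space n)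
      {x | gradient F x = 0} 0 := by
    intro x hx y hy
    have hx' : gradient F x = 0 := hx
    have hy' : gradient F y = 0 := hy
    simp [hx', hy']
  have h := happ.norm_fderiv_sub_le volume hZ (hessian F)
    fun x _ => (hF.hasFDerivAt_gradient x).hasFDerivWithinAt
  rw [ae_restrict_iff' hZ] at h
  rw [measure_eq_zero_iff_ae_notMem]
  filter_upwards [h] with x hx hx'
  have := hx hx'.1
  rw [sub_zero, nonpos_iff_eq_zero, nnnorm_eq_zero] at this
  exact hx'.2 this

lemma measurableSet_critical_hessian_ne_zero (hF : HasLipschitzDerivatives F L ρ) :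
    MeasurableSet {x | gradient F x = 0 ∧ hessian F x ≠ 0} :=
  ((isClosed_eq hF.continuous_gradient continuous_const).measurableSet).inter
    (isOpen_ne_fun hF.continuous_hessian continuous_const).measurableSet

/-- An affine gradient field that is bounded is constant. -/
lemma hessian_eq_zero_of_bounded (hF : HasLipschitzDerivatives F L 0) {B : ℝ}
    (hB : ∀ x, ‖gradient F x‖ ≤ B) (x : Space n) : hessian F x = 0 := by
  ext1 u
  rw [_root_.zero_apply, ← norm_le_zero_iff]
  by_contra! hpos
  obtain ⟨t, ht⟩ := exists_nat_gt (2 * B / ‖hessian F x u‖)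
  rw [div_lt_iff₀ hpos] at ht
  have h := hF.norm_gradient_taylor_le x ((t : ℝ) • u)
  rw [NNReal.coe_zero, zero_mul, norm_le_zero_iff, sub_eq_zero, map_smul] at h
  have h1 := norm_sub_le (gradient F (x + (t : ℝ) • u)) (gradient F x)
  rw [h, norm_smul, Real.norm_natCast] at h1
  linarith [hB x, hB (x + (t : ℝ) • u)]

/-- Second-order stationarity is stable under small displacements. -/
lemma isSecondOrderStationary_of_norm_sub_le (hF : HasLipschitzDerivatives F L ρ) {x y : Space n}
    {r ε εh κ : ℝ} (hg : ‖gradient F x‖ ≤ ε / 2)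
    (hH : ∀ u, -κ * ‖u‖ ^ 2 ≤ inner ℝ (hessian F x u) u) (hr : ‖y - x‖ ≤ r)
    (hL : L * r ≤ ε / 2) (hρ : ρ * r + κ ≤ εh) : IsSecondOrderStationary F ε εh y := by
  refine ⟨?_, fun u => ?_⟩
  · have h1 := hF.lipschitz_gradient.norm_sub_le y x
    have h2 : (L : ℝ) * ‖y - x‖ ≤ L * r := by gcongr
    have h3 := norm_add_le (gradient F x) (gradient F y - gradient F x)
    rw [add_sub_cancel] at h3
    linarith
  · have h1 := hF.lipschitz_hessian.norm_sub_le y x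
    have h2 : (ρ : ℝ) * ‖y - x‖ ≤ ρ * r := by gcongr
    have h3 : |inner ℝ ((hessian F y - hessian F x) u) u| ≤ ρ * r * ‖u‖ ^ 2 := by
      refine (abs_real_inner_le_norm _ _).trans ?_
      have := (hessian F y - hessian F x).le_of_opNorm_le (h1.trans h2) u
      calc _ ≤ ρ * r * ‖u‖ * ‖u‖ := by gcongr
        _ = _ := by ring
    rw [_root_.sub_apply, inner_sub_left] at h3
    have h4 := (abs_le.1 h3).1
    have h5 := mul_le_mul_of_nonneg_right hρ (sq_nonneg ‖u‖)
    linarith [hH u]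

end HasLipschitzDerivatives

/-- A unit eigenvector for the smallest eigenvalue detects directions of negative curvature. -/
lemma IsUnitMinEigenvector.exists_apply_eq {T : Space n →L[ℝ] Space n} {v : Space n}
    (hv : IsUnitMinEigenvector T v) (hT : ∀ u w, inner ℝ (T u) w = inner ℝ u (T w)) {κ : ℝ}
    {u : Space n} (hu : inner ℝ (T u) u < -κ * ‖u‖ ^ 2) :
    ∃ lam : ℝ, κ ≤ lam ∧ T v = -lam • v := by
  obtain ⟨hv1, μ, hμ, hmin⟩ := hv
  have hnt : Nontrivial (Space n) := nontrivial_of_ne v 0 (by rintro rfl; simp at hv1)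
  have hsymm : (T : Module.End ℝ (Space n)).IsSymmetric := hT
  have h := hmin _ hsymm.hasEigenvalue_iInf_of_finiteDimensional
  have hu0 : u ≠ 0 := by rintro rfl; simp at hu
  have hpos : 0 < ‖u‖ ^ 2 := by positivity
  have hbdd : BddBelow (Set.range fun x : {x : Space n // x ≠ 0} =>
      RCLike.re (inner ℝ ((T : Module.End ℝ (Space n)) x) (x : Space n))
        / ‖(x : Space n)‖ ^ 2) := by
    refine ⟨-‖T‖, ?_⟩
    rintro _ ⟨⟨x, hx⟩, rfl⟩
    have hxpos : 0 < ‖x‖ ^ 2 := by positivity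
    refine (le_div_iff₀ hxpos).2 ?_
    have h1 := abs_real_inner_le_norm (T x) x
    have h2 : ‖T x‖ * ‖x‖ ≤ ‖T‖ * ‖x‖ * ‖x‖ := by gcongr; exact T.le_opNorm x
    have h3 := (abs_le.1 h1).1
    change -‖T‖ * ‖x‖ ^ 2 ≤ inner ℝ (T x) x
    linarith [h2, sq ‖x‖, mul_assoc ‖T‖ ‖x‖ ‖x‖]
  have h1 := h.trans (ciInf_le hbdd ⟨u, hu0⟩)
  have h2 : inner ℝ (T u) u / ‖u‖ ^ 2 < -κ := by
    rwa [div_lt_iff₀ hpos]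
  have h3 : μ ≤ inner ℝ (T u) u / ‖u‖ ^ 2 := h1
  refine ⟨-μ, by linarith, ?_⟩
  rw [neg_neg]
  exact hμ.apply_eq_smul

lemma IsStrictSaddle.hessian_ne_zero {F : Space n → ℝ} {x : Space n} (hx : IsStrictSaddle F x) :
    hessian F x ≠ 0 := by
  intro h0
  obtain ⟨-, μ, hμ, hev⟩ := hx
  obtain ⟨w, hw⟩ := hev.exists_hasEigenvector
  have h1 := hw.apply_eq_smul
  rw [h0] at h1
  have h2 : μ • w = 0 := h1.symm
  rcases smul_eq_zero.1 h2 with h | h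
  · exact hμ.ne h
  · exact hw.2 h

/-! ### The iteration as stochastic gradient descent -/

variable {σ : ℝ} {g p : Space n → ℝ} {D : Space n → Space n} {L_g L_h ρ_g ρ_h : ℝ≥0}

lemma measurable_stochasticField (hD : Measurable D) :
    Measurable (Function.uncurry (stochasticField σ D)) := by
  unfold stochasticField Function.uncurry
  fun_prop

lemma smoothedObjective_hasLipschitzDerivatives (hg : HasLipschitzDerivatives g L_g ρ_g)
    (hh : HasLipschitzDerivatives (smoothedRegularizer σ p) L_h ρ_h) :
    HasLipschitzDerivatives (smoothedObjective σ g p) (L_g + L_h) (ρ_g + ρ_h) :=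
  hg.add hh

lemma measurable_fieldNoise (hD : Measurable D)
    (hh : HasLipschitzDerivatives (smoothedRegularizer σ p) L_h ρ_h) :
    Measurable (Function.uncurry (fieldNoise σ p D)) :=
  (measurable_stochasticField hD).sub (hh.continuous_gradient.measurable.comp measurable_fst)

lemma integral_fieldNoise
    (hunbiased : ∀ x, ∫ z, stochasticField σ D x z ∂(stdGaussian (Space n))
      = gradient (smoothedRegularizer σ p) x)
    (hL2 : ∀ x, MemLp (stochasticField σ D x) 2 (stdGaussian (Space n))) (x : Space n) :
    ∫ z, fieldNoise σ p D x z ∂(stdGaussian (Space n)) = 0 := by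
  simp_rw [fieldNoise]
  rw [integral_sub ((hL2 x).integrable (by norm_num)) (integrable_const _), hunbiased,
    integral_const, probReal_univ, one_smul, sub_self]

/-- All moments of a noise field that is bounded by an affine function of the Gaussian noise are
bounded uniformly in the point. -/
lemma integral_norm_pow_le_of_ae_le {ξ : Space n → Space n} (hξ : Measurable ξ) {a b : ℝ}
    (hab : ∀ᵐ z ∂(stdGaussian (Space n)), ‖ξ z‖ ≤ a + b * ‖z‖) (k : ℕ) :
    Integrable (fun z => ‖ξ z‖ ^ k) (stdGaussian (Space n)) ∧
      ∫ z, ‖ξ z‖ ^ k ∂(stdGaussian (Space n))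
        ≤ ∫ z : Space n, (a + b * ‖z‖) ^ k ∂(stdGaussian (Space n)) := by
  have hi := integrable_const_add_norm_pow_stdGaussian (n := n) a b k
  have hle : ∀ᵐ z ∂(stdGaussian (Space n)), ‖ξ z‖ ^ k ≤ (a + b * ‖z‖) ^ k := by
    filter_upwards [hab] with z hz
    gcongr
  refine ⟨hi.mono' (hξ.norm.pow_const k).aestronglyMeasurable ?_,
    integral_mono_of_nonneg (Filter.Eventually.of_forall fun z => by positivity) hi hle⟩
  filter_upwards [hle] with z hz
  rwa [Real.norm_of_nonneg (by positivity)]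

lemma memLp_four_of_integrable {ξ : Space n → Space n} (hξ : Measurable ξ)
    (h : Integrable (fun z => ‖ξ z‖ ^ 4) (stdGaussian (Space n))) :
    MemLp ξ 4 (stdGaussian (Space n)) := by
  rw [← integrable_norm_rpow_iff hξ.aestronglyMeasurable (by norm_num) (by norm_num)]
  have h4 : (4 : ENNReal).toReal = ((4 : ℕ) : ℝ) := by norm_num
  simp_rw [h4, Real.rpow_natCast]
  exact h

/-- The noise of an unbiased denoiser, being bounded by an affine function of the injected Gaussian
noise, makes the stochastic field a gradient oracle for the smoothed objective. -/
lemma exists_isStochasticOracle (hσ : 0 < σ) (hD : Measurable D)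
    (hg : HasLipschitzDerivatives g L_g ρ_g)
    (hh : HasLipschitzDerivatives (smoothedRegularizer σ p) L_h ρ_h)
    (hunbiased : ∀ x, ∫ z, stochasticField σ D x z ∂(stdGaussian (Space n))
      = gradient (smoothedRegularizer σ p) x)
    (hL2 : ∀ x, MemLp (stochasticField σ D x) 2 (stdGaussian (Space n)))
    {a b : ℝ} (hab : ∀ x, ∀ᵐ z ∂(stdGaussian (Space n)),
      ‖D (x + σ • z) - denoiserMean σ p x‖ ≤ a + b * ‖z‖) :
    ∃ V₂ V₄, IsStochasticOracle (smoothedObjective σ g p) (fieldNoise σ p D)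
      (L_g + L_h) (ρ_g + ρ_h) V₂ V₄ := by
  have hmeas : Measurable (Function.uncurry (fieldNoise σ p D)) := measurable_fieldNoise hD hh
  have hmeasx : ∀ x, Measurable (fieldNoise σ p D x) := fun x => hmeas.of_uncurry_left
  obtain ⟨a', b', hbd⟩ : ∃ a' b', ∀ x, ∀ᵐ z ∂(stdGaussian (Space n)),
      ‖fieldNoise σ p D x z‖ ≤ a' + b' * ‖z‖ := by
    refine ⟨(σ ^ 2)⁻¹ * a, (σ ^ 2)⁻¹ * b, fun x => ?_⟩
    filter_upwards [hab x] with z hz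
    rw [fieldNoise_eq hσ, norm_neg, norm_smul, Real.norm_of_nonneg (by positivity), mul_assoc,
      ← mul_add]
    gcongr
  have hpow := fun k x => integral_norm_pow_le_of_ae_le (hmeasx x) (hbd x) k
  exact ⟨_, _, smoothedObjective_hasLipschitzDerivatives hg hh, hmeas,
    fun x => memLp_four_of_integrable (hmeasx x) (hpow 4 x).1,
    integral_fieldNoise hunbiased hL2, fun x => (hpow 2 x).2, fun x => (hpow 4 x).2⟩

lemma iterate_succ_eq_sgdStep (hg : HasLipschitzDerivatives g L_g ρ_g)
    (hh : HasLipschitzDerivatives (smoothedRegularizer σ p) L_h ρ_h) (γ : ℕ → ℝ) (x₀ : Space n)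
    (w : ℕ → Space n) (k : ℕ) :
    iterate σ g D γ x₀ w (k + 1)
      = sgdStep (smoothedObjective σ g p) (fieldNoise σ p D) (γ k) (iterate σ g D γ x₀ w k)
        (w k) := by
  have h : gradient (smoothedObjective σ g p) (iterate σ g D γ x₀ w k) = _ :=
    hg.gradient_add hh _
  rw [iterate, sgdStep, h, fieldNoise]
  congr 2
  abel

lemma iterate_congr (γ : ℕ → ℝ) (x₀ : Space n) {w w' : ℕ → Space n} (k : ℕ)
    (h : ∀ j < k, w j = w' j) : iterate σ g D γ x₀ w k = iterate σ g D γ x₀ w' k := by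
  induction k with
  | zero => rfl
  | succ k ih =>
    simp only [iterate]
    rw [ih fun j hj => h j (by omega), h k (by omega)]

lemma measurable_iterate (hg : HasLipschitzDerivatives g L_g ρ_g) (hD : Measurable D)
    (γ : ℕ → ℝ) (x₀ : Space n) (k : ℕ) :
    Measurable fun w : ℕ → Space n => iterate σ g D γ x₀ w k := by
  have hG := hg.continuous_gradient.measurable
  induction k with
  | zero => exact measurable_const
  | succ k ih =>
    simp only [iterate]
    exact ih.sub (((hG.comp ih).add ((measurable_stochasticField hD).comp
      (ih.prodMk (measurable_pi_apply k)))).const_smul (γ k))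

section Noise

variable {Ω : Type*} [MeasurableSpace Ω] {P : Measure Ω}
  {z : ℕ → Ω → Space n}

lemma aemeasurable_iterate (hg : HasLipschitzDerivatives g L_g ρ_g) (hD : Measurable D)
    (hz_law : ∀ k, HasLaw (z k) (stdGaussian (Space n)) P) (γ : ℕ → ℝ) (x₀ : Space n) (k : ℕ) :
    AEMeasurable (fun ω => iterate σ g D γ x₀ (fun j => z j ω) k) P :=
  (measurable_iterate hg hD γ x₀ k).comp_aemeasurable
    (aemeasurable_pi_lambda _ fun j => (hz_law j).aemeasurable)

/-- The noise of a step is independent of the current iterate. -/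
lemma map_iterate_prodMk [IsProbabilityMeasure P] (hg : HasLipschitzDerivatives g L_g ρ_g)
    (hD : Measurable D)
    (hz_law : ∀ k, HasLaw (z k) (stdGaussian (Space n)) P) (hz_indep : iIndepFun z P)
    (γ : ℕ → ℝ) (x₀ : Space n) (k : ℕ) :
    P.map (fun ω => (iterate σ g D γ x₀ (fun j => z j ω) k, z k ω))
      = (P.map fun ω => iterate σ g D γ x₀ (fun j => z j ω) k).prod (stdGaussian (Space n)) := by
  have hX := aemeasurable_iterate (σ := σ) hg hD hz_law γ x₀ k
  have hind : IndepFun (fun ω => iterate σ g D γ x₀ (fun j => z j ω) k) (z k) P := by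
    have h := hz_indep.indepFun_finset₀ (Finset.range k) {k} (by simp)
      fun j => (hz_law j).aemeasurable
    -- the iterate as a function of the noise of the earlier steps
    let ext : (Finset.range k → Space n) → ℕ → Space n :=
      fun w j => if hj : j ∈ Finset.range k then w ⟨j, hj⟩ else 0
    have hext : Measurable ext := by
      refine measurable_pi_lambda _ fun j => ?_
      by_cases hj : j ∈ Finset.range k
      · simp only [ext, hj, dif_pos]
        exact measurable_pi_apply _
      · simp only [ext, hj, dif_neg, not_false_eq_true]
        exact measurable_const
    have h2 := h.comp ((measurable_iterate (σ := σ) hg hD γ x₀ k).comp hext)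
      (measurable_pi_apply (⟨k, Finset.mem_singleton_self k⟩ : ({k} : Finset ℕ)))
    convert h2 using 1
    swap
    · rfl
    ext1 ω
    refine iterate_congr γ x₀ k fun j hj => ?_
    simp [ext, hj]
  rw [(indepFun_iff_map_prod_eq_prod_map_map hX (hz_law k).aemeasurable).1 hind,
    (hz_law k).map_eq]

end Noise

end SGPnP

namespace SGPnP

variable {n : ℕ} {σ : ℝ} {g p : Space n → ℝ} {D : Space n → Space n} {L_g L_h ρ_g ρ_h L ρ : ℝ≥0}
  {V₂ V₄ : ℝ} {Ω : Type*} [MeasurableSpace Ω] {P : Measure Ω} [IsProbabilityMeasure P]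
  {z : ℕ → Ω → Space n}

/-! ### The law of the iterates -/

lemma map_iterate_succ (hg : HasLipschitzDerivatives g L_g ρ_g) (hD : Measurable D)
    (hh : HasLipschitzDerivatives (smoothedRegularizer σ p) L_h ρ_h)
    (hF : IsStochasticOracle (smoothedObjective σ g p) (fieldNoise σ p D) L ρ V₂ V₄)
    (hz_law : ∀ k, HasLaw (z k) (stdGaussian (Space n)) P) (hz_indep : iIndepFun z P)
    (γ : ℕ → ℝ) (x₀ : Space n) (k : ℕ) :
    P.map (fun ω => iterate σ g D γ x₀ (fun j => z j ω) (k + 1))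
      = ((P.map fun ω => iterate σ g D γ x₀ (fun j => z j ω) k).prod (stdGaussian (Space n))).map
        (Function.uncurry (sgdStep (smoothedObjective σ g p) (fieldNoise σ p D) (γ k))) := by
  rw [← map_iterate_prodMk hg hD hz_law hz_indep, AEMeasurable.map_map_of_aemeasurable
    (hF.measurable_step (γ k)).aemeasurable
    ((aemeasurable_iterate hg hD hz_law γ x₀ k).prodMk (hz_law k).aemeasurable)]
  congr 1
  ext1 ω
  exact iterate_succ_eq_sgdStep hg hh γ x₀ _ k

lemma map_iterate_eq_pow (hg : HasLipschitzDerivatives g L_g ρ_g) (hD : Measurable D)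
    (hh : HasLipschitzDerivatives (smoothedRegularizer σ p) L_h ρ_h)
    (hF : IsStochasticOracle (smoothedObjective σ g p) (fieldNoise σ p D) L ρ V₂ V₄)
    (hz_law : ∀ k, HasLaw (z k) (stdGaussian (Space n)) P) (hz_indep : iIndepFun z P)
    {γ : ℕ → ℝ} (x₀ : Space n) {t : ℝ} (k : ℕ) (hγ : ∀ j < k, γ j = t) :
    P.map (fun ω => iterate σ g D γ x₀ (fun j => z j ω) k)
      = (sgdKernel (smoothedObjective σ g p) (fieldNoise σ p D) t ^ k) x₀ := by
  induction k with
  | zero =>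
    have : (sgdKernel (smoothedObjective σ g p) (fieldNoise σ p D) t ^ 0) x₀
        = (Kernel.id : Kernel (Space n) (Space n)) x₀ := rfl
    rw [this, Kernel.id_apply]
    simp only [iterate, Measure.map_const, measure_univ, one_smul]
  | succ k ih =>
    rw [map_iterate_succ hg hD hh hF hz_law hz_indep, ih fun j hj => hγ j (by omega),
      hγ k (by omega), show k + 1 = 1 + k by omega, Kernel.pow_add, pow_one, Kernel.comp_apply]
    have := hF.isMarkovKernel t
    ext s hs
    rw [Measure.bind_apply hs (Kernel.aemeasurable _), Measure.map_apply (hF.measurable_step t) hs,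
      Measure.prod_apply (hF.measurable_step t hs)]
    refine lintegral_congr fun x => ?_
    rw [hF.kernel_apply, Measure.map_apply (hF.measurable_step_right t x) hs]
    rfl

/-- The expected length of a step is at most proportional to the step size. -/
lemma lintegral_enorm_iterate_sub_le (hg : HasLipschitzDerivatives g L_g ρ_g) (hD : Measurable D)
    (hh : HasLipschitzDerivatives (smoothedRegularizer σ p) L_h ρ_h)
    (hF : IsStochasticOracle (smoothedObjective σ g p) (fieldNoise σ p D) L ρ V₂ V₄)
    {B : ℝ} (hB : ∀ x, ‖gradient (smoothedObjective σ g p) x‖ ≤ B)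
    (hz_law : ∀ k, HasLaw (z k) (stdGaussian (Space n)) P) (hz_indep : iIndepFun z P)
    {γ : ℕ → ℝ} (hγ : ∀ k, 0 < γ k) (x₀ : Space n) (k : ℕ) :
    ∫⁻ ω, ‖iterate σ g D γ x₀ (fun j => z j ω) (k + 1)
        - iterate σ g D γ x₀ (fun j => z j ω) k‖ₑ ∂P ≤ ENNReal.ofReal (γ k * (B + (1 + V₂))) := by
  set F := smoothedObjective σ g p
  set ξ := fieldNoise σ p D
  have hX := aemeasurable_iterate (σ := σ) hg hD hz_law γ x₀ k
  have hφ : Measurable fun q : Space n × Space n =>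
      ‖Function.uncurry (sgdStep F ξ (γ k)) q - q.1‖ₑ :=
    ((hF.measurable_step (γ k)).sub measurable_fst).enorm
  have h1 : ∀ x, ∫⁻ w, ‖sgdStep F ξ (γ k) x w - x‖ₑ ∂(stdGaussian (Space n))
      ≤ ENNReal.ofReal (γ k * (B + (1 + V₂))) := by
    intro x
    have hi : Integrable (fun w => γ k * (B + (1 + ‖ξ x w‖ ^ 2))) (stdGaussian (Space n)) :=
      ((integrable_const B).add ((integrable_const 1).add (hF.integrable_noise_sq x))).const_mul _
    have h2 : ∀ w, ‖sgdStep F ξ (γ k) x w - x‖ ≤ γ k * (B + (1 + ‖ξ x w‖ ^ 2)) := by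
      intro w
      have e : sgdStep F ξ (γ k) x w - x = -(γ k • (gradient F x + ξ x w)) := by
        rw [sgdStep]; abel
      rw [e, norm_neg, norm_smul, Real.norm_of_nonneg (hγ k).le]
      refine mul_le_mul_of_nonneg_left ((norm_add_le _ _).trans (add_le_add (hB x) ?_)) (hγ k).le
      nlinarith [sq_nonneg (‖ξ x w‖ - 1), norm_nonneg (ξ x w)]
    calc ∫⁻ w, ‖sgdStep F ξ (γ k) x w - x‖ₑ ∂(stdGaussian (Space n))
        ≤ ∫⁻ w, ENNReal.ofReal (γ k * (B + (1 + ‖ξ x w‖ ^ 2))) ∂(stdGaussian (Space n)) := by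
          refine lintegral_mono fun w => ?_
          rw [← ofReal_norm]
          exact ENNReal.ofReal_le_ofReal (h2 w)
      _ = ENNReal.ofReal (∫ w, γ k * (B + (1 + ‖ξ x w‖ ^ 2)) ∂(stdGaussian (Space n))) :=
          (ofReal_integral_eq_lintegral_ofReal hi
            (Filter.Eventually.of_forall fun w => (norm_nonneg _).trans (h2 w))).symm
      _ ≤ _ := by
          refine ENNReal.ofReal_le_ofReal ?_
          have hi1 : Integrable (fun w => 1 + ‖ξ x w‖ ^ 2) (stdGaussian (Space n)) :=
            (integrable_const 1).add (hF.integrable_noise_sq x)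
          rw [integral_const_mul, integral_add (integrable_const B) hi1,
            integral_add (integrable_const 1) (hF.integrable_noise_sq x), integral_const,
            integral_const, probReal_univ, one_smul, one_smul]
          have := hF.second_moment x
          have := (hγ k).le
          gcongr
  calc _ = ∫⁻ ω, ‖Function.uncurry (sgdStep F ξ (γ k))
          (iterate σ g D γ x₀ (fun j => z j ω) k, z k ω)
          - (iterate σ g D γ x₀ (fun j => z j ω) k, z k ω).1‖ₑ ∂P := by
        refine lintegral_congr fun ω => ?_
        rw [iterate_succ_eq_sgdStep hg hh γ x₀ _ k]
        rfl
    _ = ∫⁻ q, ‖Function.uncurry (sgdStep F ξ (γ k)) q - q.1‖ₑ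
          ∂((P.map fun ω => iterate σ g D γ x₀ (fun j => z j ω) k).prod
            (stdGaussian (Space n))) := by
        rw [← map_iterate_prodMk hg hD hz_law hz_indep,
          lintegral_map' hφ.aemeasurable (hX.prodMk (hz_law k).aemeasurable)]
    _ = ∫⁻ x, ∫⁻ w, ‖sgdStep F ξ (γ k) x w - x‖ₑ ∂(stdGaussian (Space n))
          ∂(P.map fun ω => iterate σ g D γ x₀ (fun j => z j ω) k) :=
        lintegral_prod _ hφ.aemeasurable
    _ ≤ ∫⁻ _, ENNReal.ofReal (γ k * (B + (1 + V₂)))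
          ∂(P.map fun ω => iterate σ g D γ x₀ (fun j => z j ω) k) := lintegral_mono h1
    _ = _ := by
        have := Measure.isProbabilityMeasure_map (μ := P) hX
        rw [lintegral_const, measure_univ, mul_one]

/-- Strict saddles are avoided almost surely after the first step. -/
lemma ae_not_isStrictSaddle_iterate_succ (hσ : 0 < σ) (hp : IsProbDensity p)
    (hg : HasLipschitzDerivatives g L_g ρ_g) (hD : Measurable D)
    (hh : HasLipschitzDerivatives (smoothedRegularizer σ p) L_h ρ_h)
    (hF : IsStochasticOracle (smoothedObjective σ g p) (fieldNoise σ p D) L ρ V₂ V₄)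
    (hae : ∀ᵐ y, D y = mmse σ p y)
    (hz_law : ∀ k, HasLaw (z k) (stdGaussian (Space n)) P) (hz_indep : iIndepFun z P)
    {γ : ℕ → ℝ} (hγ : ∀ k, 0 < γ k) (x₀ : Space n) (k : ℕ) :
    ∀ᵐ ω ∂P, ¬ IsStrictSaddle (smoothedObjective σ g p)
      (iterate σ g D γ x₀ (fun j => z j ω) (k + 1)) := by
  set S := {x | gradient (smoothedObjective σ g p) x = 0 ∧ hessian (smoothedObjective σ g p) x ≠ 0}
    with hS
  have hSm : MeasurableSet S := hF.smooth.measurableSet_critical_hessian_ne_zero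
  have hS0 : volume S = 0 := hF.smooth.volume_critical_hessian_ne_zero
  have h0 : P.map (fun ω => iterate σ g D γ x₀ (fun j => z j ω) (k + 1)) S = 0 := by
    rw [map_iterate_succ hg hD hh hF hz_law hz_indep, Measure.map_apply (hF.measurable_step _) hSm,
      Measure.measure_prod_null (hF.measurable_step _ hSm)]
    refine Filter.Eventually.of_forall fun x => ?_
    have h := ae_step_notMem hσ hp hae hS0 (hγ k) x (gradient g x)
    rw [Pi.zero_apply, measure_eq_zero_iff_ae_notMem]
    filter_upwards [h] with w hw hmem
    refine hw ?_
    have e : sgdStep (smoothedObjective σ g p) (fieldNoise σ p D) (γ k) x w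
        = x - γ k • (gradient g x + stochasticField σ D x w) := by
      have : gradient (smoothedObjective σ g p) x = _ := hg.gradient_add hh x
      rw [sgdStep, this, fieldNoise]
      congr 2
      abel
    rw [← e]
    exact hmem
  have hX := aemeasurable_iterate (σ := σ) hg hD hz_law γ x₀ (k + 1)
  rw [Measure.map_apply_of_aemeasurable hX hSm, measure_eq_zero_iff_ae_notMem] at h0
  filter_upwards [h0] with ω hω hsad
  exact hω ⟨hsad.1, hsad.hessian_ne_zero⟩

/-- With step sizes decaying geometrically from time `k` on, the total length of the path after
time `k` is small with high probability. -/
lemma measure_le_tsum_enorm_iterate_sub_le (hg : HasLipschitzDerivatives g L_g ρ_g)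
    (hD : Measurable D) (hh : HasLipschitzDerivatives (smoothedRegularizer σ p) L_h ρ_h)
    (hF : IsStochasticOracle (smoothedObjective σ g p) (fieldNoise σ p D) L ρ V₂ V₄)
    {B : ℝ} (hB : ∀ x, ‖gradient (smoothedObjective σ g p) x‖ ≤ B)
    (hz_law : ∀ k, HasLaw (z k) (stdGaussian (Space n)) P) (hz_indep : iIndepFun z P)
    {γ : ℕ → ℝ} (hγ : ∀ k, 0 < γ k) (x₀ : Space n) {k : ℕ} {θ r η : ℝ} (hr : 0 < r)
    (hγk : ∀ i, γ (k + i) = θ / 2 / 2 ^ i) (hθ : θ * (B + (1 + V₂)) ≤ η * r) :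
    P {ω | ENNReal.ofReal r ≤ ∑' i, ‖iterate σ g D γ x₀ (fun j => z j ω) (k + i + 1)
        - iterate σ g D γ x₀ (fun j => z j ω) (k + i)‖ₑ} ≤ ENNReal.ofReal η := by
  have hB0 : 0 ≤ B := (norm_nonneg _).trans (hB 0)
  have hV := hF.second_nonneg
  have hθ0 : 0 < θ := by
    have h0 := hγ k
    have h1 := hγk 0
    rw [add_zero, pow_zero, div_one] at h1
    linarith
  have hmeas : ∀ i, AEMeasurable (fun ω => ‖iterate σ g D γ x₀ (fun j => z j ω) (k + i + 1)
        - iterate σ g D γ x₀ (fun j => z j ω) (k + i)‖ₑ) P := fun i =>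
    ((aemeasurable_iterate hg hD hz_law γ x₀ _).sub
      (aemeasurable_iterate hg hD hz_law γ x₀ _)).enorm
  have h1 : ∫⁻ ω, ∑' i, ‖iterate σ g D γ x₀ (fun j => z j ω) (k + i + 1)
        - iterate σ g D γ x₀ (fun j => z j ω) (k + i)‖ₑ ∂P
      ≤ ENNReal.ofReal η * ENNReal.ofReal r := by
    rw [lintegral_tsum hmeas]
    calc _ ≤ ∑' i, ENNReal.ofReal (θ * (B + (1 + V₂)) / 2 / 2 ^ i) := by
          refine ENNReal.tsum_le_tsum fun i => ?_
          refine (lintegral_enorm_iterate_sub_le hg hD hh hF hB hz_law hz_indep hγ x₀ _).trans ?_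
          rw [hγk]
          refine ENNReal.ofReal_le_ofReal (le_of_eq ?_)
          ring
      _ = ENNReal.ofReal (∑' i : ℕ, θ * (B + (1 + V₂)) / 2 / 2 ^ i) :=
          (ENNReal.ofReal_tsum_of_nonneg (fun i => by positivity) (summable_geometric_two' _)).symm
      _ = ENNReal.ofReal (θ * (B + (1 + V₂))) := by rw [tsum_geometric_two']
      _ ≤ ENNReal.ofReal (η * r) := ENNReal.ofReal_le_ofReal hθ
      _ = _ := ENNReal.ofReal_mul' hr.le
  have h2 := (mul_meas_ge_le_lintegral₀ (AEMeasurable.tsum hmeas) (ENNReal.ofReal r)).trans h1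
  rw [mul_comm] at h2
  exact (ENNReal.mul_le_mul_iff_left (by simpa using hr) ENNReal.ofReal_ne_top).1 h2

lemma norm_sub_le_of_tsum_enorm_lt {x : ℕ → Space n} {r : ℝ} {k : ℕ}
    (h : ∑' i, ‖x (k + i + 1) - x (k + i)‖ₑ < ENNReal.ofReal r) (j : ℕ) :
    ‖x (k + j) - x k‖ ≤ r := by
  have h1 : x (k + j) - x k = ∑ i ∈ Finset.range j, (x (k + i + 1) - x (k + i)) :=
    (Finset.sum_range_sub (fun i => x (k + i)) j).symm
  have h2 : ‖x (k + j) - x k‖ₑ ≤ ∑' i, ‖x (k + i + 1) - x (k + i)‖ₑ := by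
    rw [h1]
    exact (enorm_sum_le _ _).trans (ENNReal.sum_le_tsum _)
  have hr : 0 < r := by
    by_contra! hr
    rw [ENNReal.ofReal_of_nonpos hr] at h
    exact not_lt_zero h
  have h3 := h2.trans h.le
  rw [← ofReal_norm, ENNReal.ofReal_le_ofReal_iff hr.le] at h3
  exact h3

end SGPnP

/-! ### Stationarity of the iterates -/

namespace SGPnP

variable {n : ℕ}

/-- There are a neighbourhood size and a strengthened curvature tolerance which guarantee
second-order stationarity on a neighbourhood. If `ρ = 0`, the bounded gradient forces a zero
Hessian, so that any curvature tolerance will do. -/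
lemma HasLipschitzDerivatives.exists_forall_isSecondOrderStationary {F : Space n → ℝ} {L ρ : ℝ≥0}
    (hF : HasLipschitzDerivatives F L ρ) {B : ℝ} (hB : ∀ x, ‖gradient F x‖ ≤ B) {ε : ℝ}
    (hε : 0 < ε) :
    ∃ κ r : ℝ, 0 < κ ∧ 0 < r ∧ ∀ x y, ‖gradient F x‖ ≤ ε / 2 →
      (∀ u, -κ * ‖u‖ ^ 2 ≤ inner ℝ (hessian F x u) u) → ‖y - x‖ ≤ r →
      IsSecondOrderStationary F ε (Real.sqrt ρ * ε) y := by
  have hL : (L : ℝ) * (ε / (2 * (L + 1))) ≤ ε / 2 := by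
    have : (L : ℝ) * (ε / (2 * (L + 1))) = ε / 2 * (L / (L + 1)) := by field_simp
    rw [this]
    have h1 : (L : ℝ) / (L + 1) ≤ 1 := (div_le_one (by positivity)).2 (by linarith)
    nlinarith
  rcases eq_or_ne ρ 0 with rfl | hρ
  · refine ⟨1, ε / (2 * (L + 1)), one_pos, by positivity, fun x y hg _ hr => ?_⟩
    refine hF.isSecondOrderStationary_of_norm_sub_le (κ := 0) hg (fun u => ?_) hr hL (by simp)
    simp [hF.hessian_eq_zero_of_bounded hB x]
  · have hρ0 : (0 : ℝ) < ρ := by positivity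
    refine ⟨Real.sqrt ρ * ε / 2, min (ε / (2 * (L + 1))) (Real.sqrt ρ * ε / 2 / ρ), by positivity,
      by positivity, fun x y hg hH hr => ?_⟩
    refine hF.isSecondOrderStationary_of_norm_sub_le hg hH hr ?_ ?_
    · refine le_trans ?_ hL
      gcongr
      exact min_le_left _ _
    · have h1 : (ρ : ℝ) * min (ε / (2 * (L + 1))) (Real.sqrt ρ * ε / 2 / ρ)
          ≤ ρ * (Real.sqrt ρ * ε / 2 / ρ) := by
        gcongr
        exact min_le_right _ _
      rw [mul_div_cancel₀ _ hρ0.ne'] at h1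
      linarith

end SGPnP

open SGPnP in
theorem theorem1 {n : ℕ} {σ : ℝ} (hσ : 0 < σ)
    -- the data-fidelity term, the prior density and the denoiser
    (g p : SGPnP.Space n → ℝ) (hp : SGPnP.IsProbDensity p)
    (D : SGPnP.Space n → SGPnP.Space n) (hD : Measurable D)
    -- Lipschitz gradients and Hessians; bounded gradient; the objective is bounded below
    {L_g L_h ρ_g ρ_h : ℝ≥0}
    (hg : SGPnP.HasLipschitzDerivatives g L_g ρ_g)
    (hh : SGPnP.HasLipschitzDerivatives (SGPnP.smoothedRegularizer σ p) L_h ρ_h)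
    (hgrad : ∃ B : ℝ, ∀ x, ‖gradient (SGPnP.smoothedObjective σ g p) x‖ ≤ B)
    (hbelow : BddBelow (Set.range (SGPnP.smoothedObjective σ g p)))
    -- unbiasedness of the denoiser
    (hunbiased : ∀ x, ∫ z, SGPnP.stochasticField σ D x z ∂(stdGaussian (SGPnP.Space n))
      = gradient (SGPnP.smoothedRegularizer σ p) x)
    -- bounded variance
    {V_max : ℝ}
    (hL2 : ∀ x, MemLp (SGPnP.stochasticField σ D x) 2 (stdGaussian (SGPnP.Space n)))
    (hvar : ∀ x, ∫ z, ‖SGPnP.stochasticField σ D x z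
        - ∫ z', SGPnP.stochasticField σ D x z' ∂(stdGaussian (SGPnP.Space n))‖ ^ 2
      ∂(stdGaussian (SGPnP.Space n)) ≤ V_max)
    -- variance lower bound along a minimum-eigenvalue direction of the Hessian of the objective
    (v : SGPnP.Space n → SGPnP.Space n)
    (hv : ∀ x, SGPnP.IsUnitMinEigenvector
      (SGPnP.hessian (SGPnP.smoothedObjective σ g p) x) (v x))
    {c : ℝ} (hc : 0 < c)
    (hvar_lower : ∀ x, c ≤ variance (fun z => inner ℝ (v x) (D (x + σ • z)))
      (stdGaussian (SGPnP.Space n)))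
    -- the starting point and the injected i.i.d. standard Gaussian noise
    (x₀ : SGPnP.Space n)
    {Ω : Type*} [MeasurableSpace Ω] (P : Measure Ω) [IsProbabilityMeasure P]
    (z : ℕ → Ω → SGPnP.Space n)
    (hz_law : ∀ k, HasLaw (z k) (stdGaussian (SGPnP.Space n)) P)
    (hz_indep : iIndepFun z P)
    -- the failure probability and the accuracy
    {δ : ℝ} (hδ : δ ∈ Set.Ioo (0 : ℝ) 1) {ε : ℝ} (hε : 0 < ε) :
    ∃ γ : ℕ → ℝ, (∀ k, 0 < γ k) ∧ ∃ K : ℕ,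
      ENNReal.ofReal (1 - δ) ≤ P {ω | ∀ k ≥ K,
        SGPnP.IsSecondOrderStationary (SGPnP.smoothedObjective σ g p) ε
          (Real.sqrt (ρ_g + ρ_h) * ε)
          (SGPnP.iterate σ g D γ x₀ (fun j => z j ω) k) ∧
        ¬ SGPnP.IsStrictSaddle (SGPnP.smoothedObjective σ g p)
          (SGPnP.iterate σ g D γ x₀ (fun j => z j ω) k)} := by
  obtain ⟨B, hB⟩ := hgrad
  obtain ⟨m, hm⟩ := hbelow
  have hae := denoiser_ae_eq_mmse hσ hp hD hunbiased hL2
  -- the noise of the oracle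
  obtain ⟨a, b, -, -, hab⟩ := exists_norm_denoiser_sub_le hσ hp hD hh.lipschitz_gradient
    hunbiased hL2 hvar
  obtain ⟨V₂, V₄, hF⟩ := exists_isStochasticOracle hσ hD hg hh hunbiased hL2 hab
  obtain ⟨c₀, C₀, hc₀, hC₀, hnoise⟩ := exists_le_integral_inner_fieldNoise_sq hσ
    hh.lipschitz_gradient hL2 hab (fun x => (hv x).1) hc hvar_lower
  obtain ⟨κ, r, hκ, hr, hstat⟩ := hF.smooth.exists_forall_isSecondOrderStationary hB hε
  have hδ2 : 0 < δ / 2 := half_pos hδ.1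
  -- at time `k` the iterate is well inside the set of second-order stationary points
  obtain ⟨t, k, ht, hk⟩ := hF.exists_measure_not_stationary_le
    (fun x => hm (Set.mem_range_self x)) hκ hc₀ hC₀
    (fun x ⟨u, hu⟩ => by
      obtain ⟨lam, hlam, hvl⟩ := (hv x).exists_apply_eq (hF.smooth.inner_hessian_comm x) hu
      exact ⟨v x, lam, hlam, (hv x).1, hvl, fun y => hnoise x y⟩)
    x₀ hδ2 (half_pos hε)
  have hM : 0 < B + (1 + V₂) := by
    have := hF.second_nonneg
    have := (norm_nonneg _).trans (hB 0)
    positivity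
  -- constant steps before time `k`, then geometrically decaying ones
  obtain ⟨θ, hθ⟩ : ∃ θ : ℝ, θ = δ / 2 * r / (B + (1 + V₂)) := ⟨_, rfl⟩
  have hθ0 : 0 < θ := by rw [hθ]; positivity
  obtain ⟨γ, hγdef⟩ : ∃ γ : ℕ → ℝ, γ = fun j => if j < k then t else θ / 2 / 2 ^ (j - k) :=
    ⟨_, rfl⟩
  have hγ : ∀ j, 0 < γ j := fun j => by
    rw [hγdef]
    dsimp only
    split_ifs
    · exact ht
    · positivity
  have hγt : ∀ j < k, γ j = t := fun j hj => by rw [hγdef]; exact if_pos hj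
  have hγθ : ∀ i, γ (k + i) = θ / 2 / 2 ^ i := fun i => by rw [hγdef]; simp
  refine ⟨γ, hγ, k + 1, ?_⟩
  set f := smoothedObjective σ g p
  set X : ℕ → Ω → Space n := fun j ω => iterate σ g D γ x₀ (fun j => z j ω) j with hXdef
  have hX : ∀ j, AEMeasurable (X j) P := aemeasurable_iterate hg hD hz_law γ x₀
  set bad : Set (Space n) :=
    {x | ε / 2 < ‖gradient f x‖ ∨ ∃ u, inner ℝ (hessian f x u) u < -κ * ‖u‖ ^ 2}
  have hbadm : MeasurableSet bad :=
    (measurableSet_lt measurable_const hF.smooth.continuous_gradient.norm.measurable).union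
      (isOpen_setOf_exists_inner_hessian_lt hF.smooth.continuous_hessian κ).measurableSet
  have h1 : P (X k ⁻¹' bad) ≤ ENNReal.ofReal (δ / 2) := by
    have := hF.isMarkovKernel t
    rw [← Measure.map_apply_of_aemeasurable (hX k) hbadm,
      map_iterate_eq_pow hg hD hh hF hz_law hz_indep x₀ k hγt,
      ENNReal.le_ofReal_iff_toReal_le (measure_ne_top _ _) hδ2.le]
    exact hk
  have h2 : P {ω | ENNReal.ofReal r ≤ ∑' i, ‖X (k + i + 1) ω - X (k + i) ω‖ₑ}
      ≤ ENNReal.ofReal (δ / 2) :=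
    measure_le_tsum_enorm_iterate_sub_le hg hD hh hF hB hz_law hz_indep hγ x₀ hr hγθ
      (by rw [hθ, div_mul_cancel₀ _ hM.ne'])
  have h3 : P {ω | ∃ j, IsStrictSaddle f (X (j + 1) ω)} = 0 := by
    have := ae_all_iff.2 fun j => ae_not_isStrictSaddle_iterate_succ hσ hp hg hD hh hF hae hz_law
      hz_indep hγ x₀ j
    rw [measure_eq_zero_iff_ae_notMem]
    filter_upwards [this] with ω hω ⟨j, hj⟩
    exact hω j hj
  set good := {ω | ∀ j ≥ k + 1, IsSecondOrderStationary f ε (Real.sqrt (ρ_g + ρ_h) * ε) (X j ω) ∧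
    ¬ IsStrictSaddle f (X j ω)}
  have hsub : goodᶜ ⊆ X k ⁻¹' bad
      ∪ {ω | ENNReal.ofReal r ≤ ∑' i, ‖X (k + i + 1) ω - X (k + i) ω‖ₑ}
      ∪ {ω | ∃ j, IsStrictSaddle f (X (j + 1) ω)} := by
    intro ω hω
    by_contra hcon
    refine hω fun j hj => ?_
    obtain ⟨⟨hn1, hn2⟩, hn3⟩ : (ω ∉ X k ⁻¹' bad ∧
        ω ∉ {ω | ENNReal.ofReal r ≤ ∑' i, ‖X (k + i + 1) ω - X (k + i) ω‖ₑ}) ∧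
        ω ∉ {ω | ∃ j, IsStrictSaddle f (X (j + 1) ω)} := by
      refine ⟨⟨fun h => hcon (Or.inl (Or.inl h)), fun h => hcon (Or.inl (Or.inr h))⟩,
        fun h => hcon (Or.inr h)⟩
    constructor
    · have hn1' : ¬ (ε / 2 < ‖gradient f (X k ω)‖ ∨
        ∃ u, inner ℝ (hessian f (X k ω) u) u < -κ * ‖u‖ ^ 2) := hn1
      push Not at hn1'
      have hlt : ∑' i, ‖X (k + i + 1) ω - X (k + i) ω‖ₑ < ENNReal.ofReal r := not_le.1 hn2
      have hd := norm_sub_le_of_tsum_enorm_lt (x := fun j => X j ω) hlt (j - k)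
      rw [show k + (j - k) = j by omega] at hd
      have := hstat _ _ hn1'.1 hn1'.2 hd
      rwa [NNReal.coe_add] at this
    · intro hs
      refine hn3 ⟨j - 1, ?_⟩
      rwa [show j - 1 + 1 = j by omega]
  have hcompl : P goodᶜ ≤ ENNReal.ofReal δ := by
    calc P goodᶜ ≤ P (X k ⁻¹' bad)
          + P {ω | ENNReal.ofReal r ≤ ∑' i, ‖X (k + i + 1) ω - X (k + i) ω‖ₑ}
          + P {ω | ∃ j, IsStrictSaddle f (X (j + 1) ω)} :=
          (measure_mono hsub).trans ((measure_union_le _ _).trans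
            (by gcongr; exact measure_union_le _ _))
      _ ≤ ENNReal.ofReal (δ / 2) + ENNReal.ofReal (δ / 2) + 0 := by
          gcongr
          exact h3.le
      _ = ENNReal.ofReal δ := by
          rw [add_zero, ← ENNReal.ofReal_add hδ2.le hδ2.le, add_halves]
  have hone : 1 ≤ P good + P goodᶜ := by
    rw [← measure_univ (μ := P), ← Set.union_compl_self good]
    exact measure_union_le _ _
  rw [ENNReal.ofReal_sub _ hδ.1.le, ENNReal.ofReal_one, tsub_le_iff_right]
  exact hone.trans (by gcongr)
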